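/- For $n\ge 1$ let $H_n$ be the real vector space of $n\times n$ complex Hermitian matrices, with the Euclidean (Lebesgue) measure $m_n$ associated to the inner product $\langle x,y\rangle=\operatorname{tr}(xy)$. For $\mu\ge 0$ let $\mathbb P_{n,\mu}$ be the probability measure on $H_n$ $$\mathbb P_{n,\mu}(dx)=\frac1{C_{n,\mu}}\,|\det x|^{2\mu}\,e^{-\operatorname{tr}(x^2)}\,m_n(dx),\qquad C_{n,\mu}=\int_{H_n}|\det x|^{2\mu}e^{-\operatorname{tr}(x^2)}\,m_n(dx).$$ Let $(\mu_n)_n$ be a sequence of nonnegative real numbers such that $\lim_{n\to\infty}\mu_n/n=c\ge 0$, and let $\nu_n$ be the mean eigenvalue distribution, that is, the probability measure on $\mathbb R$ with $$\int_{\mathbb R} f(t)\,\nu_n(dt)=\int_{H_n}\frac1n\sum_{i=1}^n f(\lambda_i(x))\,\mathbb P_{n,\mu_n}(dx)$$ for all bounded measurable $f$, where $\lambda_1(x),\dots,\lambda_n(x)$ are the eigenvalues of $x$ counted with multiplicity. Put $$a=\sqrt{1+c-\sqrt{1+2c}},\qquad b=\sqrt{1+c+\sqrt{1+2c}},\qquad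 S=[-b,-a]\cup[a,b],$$ and let $\nu_c$ be the measure supported on $S$ with Lebesgue density $$f_c(t)=\frac1{\pi|t|}\sqrt{(t^2-a^2)(b^2-t^2)}\qquad(t\in S).$$ Then $\nu_c$ is a probability measure and, after scaling by $1/\sqrt n$, the measures $\nu_n$ converge weakly to $\nu_c$: for every bounded continuous function $\varphi$ on $\mathbb R$, $$\lim_{n\to\infty}\int_{\mathbb R}\varphi\Big(\frac u{\sqrt n}\Big)\,\nu_n(du)=\int_S\varphi(u)\,\nu_c(du).$$ If $c=0$, then $\nu_c$ is the Wigner semicircle law on $[-\sqrt2,\sqrt2]$, with density $\frac1\pi\sqrt{2-t^2}$. -/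

import Mathlib

open MeasureTheory Filter Topology
open scoped ENNReal BoundedContinuousFunction

noncomputable section

namespace GenHermitian

/-- The real vector space of `n × n` complex Hermitian matrices. It is a type synonym, so that it
carries the Euclidean structure of the inner product `tr (x y)` and no other norm. -/
def Herm (n : ℕ) : Type := selfAdjoint (Matrix (Fin n) (Fin n) ℂ)

namespace Herm

variable {n : ℕ}

instance : AddCommGroup (Herm n) :=
  inferInstanceAs (AddCommGroup (selfAdjoint (Matrix (Fin n) (Fin n) ℂ)))

instance : Module ℝ (Herm n) :=
  inferInstanceAs (Module ℝ (selfAdjoint (Matrix (Fin n) (Fin n) ℂ)))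

/-- The underlying complex matrix, as a real-linear map. -/
def toMatrix : Herm n →ₗ[ℝ] Matrix (Fin n) (Fin n) ℂ where
  toFun x := x.1
  map_add' _ _ := rfl
  map_smul' _ _ := rfl

theorem toMatrix_injective : Function.Injective (toMatrix (n := n)) := Subtype.val_injective

theorem isHermitian (x : Herm n) : (toMatrix x).IsHermitian := x.2

instance : FiniteDimensional ℝ (Herm n) := by
  have : Module.Finite ℝ (Matrix (Fin n) (Fin n) ℂ) := Module.Finite.trans ℂ _
  exact Module.Finite.of_injective toMatrix toMatrix_injective

theorem trace_mul_self_re (x : Herm n) :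
    (Matrix.trace (toMatrix x * toMatrix x)).re = ∑ i, ∑ j, ‖toMatrix x i j‖ ^ 2 := by
  simp only [Matrix.trace, Matrix.diag, Matrix.mul_apply, Complex.re_sum]
  refine Finset.sum_congr rfl fun i _ => Finset.sum_congr rfl fun j _ => ?_
  rw [← (isHermitian x).apply j i, Complex.star_def, Complex.mul_conj, Complex.ofReal_re,
    Complex.normSq_eq_norm_sq]

/-- The inner product `⟨x, y⟩ = tr (x y)` (which is real for Hermitian `x` and `y`). -/
abbrev innerCore : InnerProductSpace.Core ℝ (Herm n) where
  inner x y := (Matrix.trace (toMatrix x * toMatrix y)).re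
  conj_inner_symm x y := by
    change (Matrix.trace (toMatrix y * toMatrix x)).re = _
    rw [Matrix.trace_mul_comm]
  re_inner_nonneg x := by
    change 0 ≤ (Matrix.trace (toMatrix x * toMatrix x)).re
    rw [trace_mul_self_re]
    positivity
  add_left x y z := by
    simp only [map_add, add_mul, Matrix.trace_add, Complex.add_re]
  smul_left x y r := by
    simp
  definite x h := by
    change (Matrix.trace (toMatrix x * toMatrix x)).re = 0 at h
    rw [trace_mul_self_re, Finset.sum_eq_zero_iff_of_nonneg (fun i _ => by positivity)] at h
    apply toMatrix_injective
    ext i j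
    have hi := h i (Finset.mem_univ i)
    rw [Finset.sum_eq_zero_iff_of_nonneg (fun i _ => by positivity)] at hi
    simpa using hi j (Finset.mem_univ j)

instance : NormedAddCommGroup (Herm n) := innerCore.toNormedAddCommGroup

instance : InnerProductSpace ℝ (Herm n) := InnerProductSpace.ofCore innerCore.toCore

instance : MeasurableSpace (Herm n) := borel _

instance : BorelSpace (Herm n) := ⟨rfl⟩

theorem inner_def (x y : Herm n) :
    inner ℝ x y = (Matrix.trace (toMatrix x * toMatrix y)).re := rfl

end Herm

/-- The unnormalized density `|det x| ^ (2 μ) * exp (- tr (x ^ 2))`. -/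
def weight (n : ℕ) (μ : ℝ) (x : Herm n) : ℝ :=
  ‖(Herm.toMatrix x).det‖ ^ (2 * μ) * Real.exp (-(Matrix.trace (Herm.toMatrix x ^ 2)).re)

/-- The measure on Hermitian matrices with density proportional to `weight n μ` with respect to the
Euclidean (Lebesgue) measure `volume` of the inner product `tr (x y)`, normalized by its
total mass. -/
def ensemble (n : ℕ) (μ : ℝ) : Measure (Herm n) :=
  (∫⁻ x : Herm n, ENNReal.ofReal (weight n μ x))⁻¹ •
    (volume : Measure (Herm n)).withDensity (fun x => ENNReal.ofReal (weight n μ x))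

/-- The mean eigenvalue distribution: the measure `ν` on `ℝ` with
`∫ f dν = ∫ (1 / n) ∑ᵢ f (λᵢ x) d(ensemble n μ)(x)`, where `λᵢ x` are the eigenvalues of `x`
counted with multiplicity. -/
def meanEigenvalueDist (n : ℕ) (μ : ℝ) : Measure ℝ :=
  (n : ℝ≥0∞)⁻¹ • ∑ i : Fin n, (ensemble n μ).map (fun x => (Herm.isHermitian x).eigenvalues i)

def endA (c : ℝ) : ℝ := √(1 + c - √(1 + 2 * c))

def endB (c : ℝ) : ℝ := √(1 + c + √(1 + 2 * c))

/-- The set `[-b, -a] ∪ [a, b]`. -/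
def limitSupport (c : ℝ) : Set ℝ :=
  Set.Icc (-endB c) (-endA c) ∪ Set.Icc (endA c) (endB c)

def limitDensity (c t : ℝ) : ℝ :=
  1 / (Real.pi * |t|) * √((t ^ 2 - endA c ^ 2) * (endB c ^ 2 - t ^ 2))

/-- The measure on `ℝ` with Lebesgue density `limitDensity c` on `limitSupport c`, and zero
elsewhere. -/
def limitMeasure (c : ℝ) : Measure ℝ :=
  (volume.restrict (limitSupport c)).withDensity (fun t => ENNReal.ofReal (limitDensity c t))

/-- The semicircle law on `[-√2, √2]`, with density `(1 / π) √(2 - t ^ 2)`. -/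
def semicircleLaw : Measure ℝ :=
  (volume.restrict (Set.Icc (-√2) √2)).withDensity
    (fun t => ENNReal.ofReal (1 / Real.pi * √(2 - t ^ 2)))

end GenHermitian

end

/-!
The eigenvalue densities of the Gaussian unitary ensemble and of the Vandermonde weight
`∏_{i < j} (yᵢ - yⱼ)² exp (-∑ yᵢ²)` are compared through their moments: integration by parts along
the vector fields `x ↦ q(x) xᵏ`, `q` a polynomial in the power sums of the eigenvalues, gives the
same loop equations for both, and these determine all expectations of symmetric polynomials by
recursion on the degree. Both laws have exponential moments, so they agree up to a constant (Weyl's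
integration formula). Multiplying by `∏ |yᵢ|^(2μ)` and writing the Vandermonde determinant in
terms of the polynomials `φₖ` orthonormal for `w(x) = |x|^(2μ) exp (-x²)`, one obtains the mean
eigenvalue density `(1/n) ∑_{k < n} φₖ² w`.

The recurrence `x φₖ = √aₖ₊₁ φₖ₊₁ + √aₖ φₖ₋₁` with `aₖ = k/2` for even `k` and `aₖ = k/2 + μ` for
odd `k` makes `x²` a tridiagonal matrix in every second `φₖ`. If `k/n → τ` and `μ/n → c`, its
entries near `k`, divided by `n`, tend to those of the Toeplitz matrix with symbol
`τ + c + √(τ (τ + 2c)) cos θ`. Hence the limiting even moments are those of a mixture over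
`τ ∈ [0, 1]` of arcsine laws for `x²`, and integrating the arcsine densities over `τ` gives `f_c`.
As the limit has compact support, convergence of moments implies weak convergence.
-/

noncomputable section

namespace GenHermitian

/-! ### Gaussian integrals of functions of exponential growth -/

/-- Continuous functions of at most exponential growth: a class that is closed under the algebraic
operations, contains `exp (s * ‖x‖)`, and is integrable against the Gaussian weight
`exp (-‖x‖ ^ 2)`. -/
structure ExpGrowth {E F : Type*} [NormedAddCommGroup E] [NormedAddCommGroup F] (f : E → F) :
    Prop where
  continuous : Continuous f
  bound : ∃ C s : ℝ, 0 ≤ C ∧ 0 ≤ s ∧ ∀ x, ‖f x‖ ≤ C * Real.exp (s * ‖x‖)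

namespace ExpGrowth

variable {E F G A : Type*} [NormedAddCommGroup E] [NormedAddCommGroup F] [NormedAddCommGroup G]
  [NormedRing A]

theorem const (c : F) : ExpGrowth (fun _ : E => c) :=
  ⟨continuous_const, ‖c‖, 0, norm_nonneg _, le_rfl, by simp⟩

theorem add {f g : E → F} (hf : ExpGrowth f) (hg : ExpGrowth g) :
    ExpGrowth (fun x => f x + g x) := by
  obtain ⟨C, s, hC, hs, hfb⟩ := hf.bound
  obtain ⟨D, t, hD, ht, hgb⟩ := hg.bound
  refine ⟨hf.continuous.add hg.continuous, C + D, s + t, by positivity, by positivity, fun x => ?_⟩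
  calc ‖f x + g x‖ ≤ C * Real.exp (s * ‖x‖) + D * Real.exp (t * ‖x‖) :=
        (norm_add_le _ _).trans (add_le_add (hfb x) (hgb x))
    _ ≤ C * Real.exp ((s + t) * ‖x‖) + D * Real.exp ((s + t) * ‖x‖) := by gcongr <;> linarith
    _ = (C + D) * Real.exp ((s + t) * ‖x‖) := by ring

theorem smul [Module A F] [IsBoundedSMul A F] {f : E → A} {g : E → F} (hf : ExpGrowth f)
    (hg : ExpGrowth g) : ExpGrowth (fun x => f x • g x) := by
  obtain ⟨C, s, hC, hs, hfb⟩ := hf.bound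
  obtain ⟨D, t, hD, ht, hgb⟩ := hg.bound
  refine ⟨hf.continuous.smul hg.continuous, C * D, s + t, by positivity, by positivity, fun x => ?_⟩
  calc ‖f x • g x‖ ≤ (C * Real.exp (s * ‖x‖)) * (D * Real.exp (t * ‖x‖)) :=
        (norm_smul_le _ _).trans (by gcongr; exacts [hfb x, hgb x])
    _ = C * D * Real.exp ((s + t) * ‖x‖) := by rw [add_mul, Real.exp_add]; ring

theorem mul {f g : E → A} (hf : ExpGrowth f) (hg : ExpGrowth g) :
    ExpGrowth (fun x => f x * g x) :=
  hf.smul hg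

theorem sum {ι : Type*} (s : Finset ι) {f : ι → E → F} (hf : ∀ i, ExpGrowth (f i)) :
    ExpGrowth (fun x => ∑ i ∈ s, f i x) := by
  classical
  induction s using Finset.induction_on with
  | empty => simpa only [Finset.sum_empty] using const 0
  | insert a s ha ih => simpa only [Finset.sum_insert ha] using (hf a).add ih

theorem pow {f : E → A} (hf : ExpGrowth f) (k : ℕ) : ExpGrowth (fun x => f x ^ k) := by
  induction k with
  | zero => simpa only [pow_zero] using const 1
  | succ k ih => simpa only [pow_succ] using ih.mul hf

theorem exp_norm (s : ℝ) : ExpGrowth fun x : E => Real.exp (s * ‖x‖) := by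
  refine ⟨by fun_prop, 1, |s|, zero_le_one, abs_nonneg s, fun x => ?_⟩
  rw [one_mul, Real.norm_of_nonneg (Real.exp_nonneg _)]
  gcongr
  exact le_abs_self s

variable [NormedSpace ℝ F] [NormedSpace ℝ G]

theorem clm_comp (L : F →L[ℝ] G) {f : E → F} (hf : ExpGrowth f) : ExpGrowth (fun x => L (f x)) := by
  obtain ⟨C, s, hC, hs, hfb⟩ := hf.bound
  refine ⟨L.continuous.comp hf.continuous, ‖L‖ * C, s, by positivity, hs, fun x => ?_⟩
  rw [mul_assoc]
  exact (L.le_opNorm _).trans (by gcongr; exact hfb x)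

theorem clm [NormedSpace ℝ E] (L : E →L[ℝ] F) : ExpGrowth (fun x => L x) := by
  have hid : ExpGrowth fun x : E => x := by
    refine ⟨continuous_id, 1, 1, zero_le_one, zero_le_one, fun x => ?_⟩
    linarith [Real.add_one_le_exp (1 * ‖x‖)]
  exact clm_comp L hid

end ExpGrowth

section Gaussian

variable {E F : Type*} [NormedAddCommGroup E] [InnerProductSpace ℝ E] [NormedAddCommGroup F]
  [NormedSpace ℝ F]

theorem hasLineDerivAt_exp_neg_norm_sq (x v : E) :
    HasLineDerivAt ℝ (fun x : E => Real.exp (-‖x‖ ^ 2))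
      (-(2 * inner ℝ v x * Real.exp (-‖x‖ ^ 2))) x v := by
  have h := ((hasStrictFDerivAt_norm_sq x).hasFDerivAt.neg).exp.hasLineDerivAt v
  refine h.congr_deriv ?_
  simp only [smul_apply, neg_apply, innerSL_apply_apply,
    smul_eq_mul, nsmul_eq_mul, real_inner_comm v x, Nat.cast_ofNat, Pi.neg_apply]
  ring

variable [FiniteDimensional ℝ E] [MeasurableSpace E] [BorelSpace E]

theorem integrable_exp_neg_mul_norm_sq {b : ℝ} (hb : 0 < b) :
    Integrable fun x : E => Real.exp (-b * ‖x‖ ^ 2) :=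
  .of_integral_ne_zero <| by
    rw [GaussianFourier.integral_rexp_neg_mul_sq_norm hb]
    positivity

theorem ExpGrowth.integrable {f : E → F} (hf : ExpGrowth f) :
    Integrable fun x => Real.exp (-‖x‖ ^ 2) • f x := by
  obtain ⟨C, s, hC, -, hfb⟩ := hf.bound
  have hdom : Integrable fun x : E => C * Real.exp (s ^ 2 / 2) * Real.exp (-(1 / 2) * ‖x‖ ^ 2) :=
    (integrable_exp_neg_mul_norm_sq one_half_pos).const_mul _
  have hcont : Continuous fun x : E => Real.exp (-‖x‖ ^ 2) := by fun_prop
  refine hdom.mono' (hcont.smul hf.continuous).aestronglyMeasurable (.of_forall fun x => ?_)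
  rw [norm_smul, Real.norm_of_nonneg (Real.exp_nonneg _)]
  calc Real.exp (-‖x‖ ^ 2) * ‖f x‖ ≤ Real.exp (-‖x‖ ^ 2) * (C * Real.exp (s * ‖x‖)) := by
        gcongr; exact hfb x
    _ = C * Real.exp (s * ‖x‖ + -‖x‖ ^ 2) := by rw [Real.exp_add]; ring
    _ ≤ C * Real.exp (s ^ 2 / 2 + -(1 / 2) * ‖x‖ ^ 2) := by
        gcongr _ * Real.exp ?_; nlinarith [sq_nonneg (s - ‖x‖)]
    _ = C * Real.exp (s ^ 2 / 2) * Real.exp (-(1 / 2) * ‖x‖ ^ 2) := by rw [Real.exp_add]; ring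

theorem integral_gaussian_smul_lineDeriv {f f' : E → F} {v : E} (hf : ExpGrowth f)
    (hf' : ExpGrowth f') (h : ∀ x, HasLineDerivAt ℝ f (f' x) x v) :
    ∫ x, Real.exp (-‖x‖ ^ 2) • f' x = ∫ x, Real.exp (-‖x‖ ^ 2) • (2 * inner ℝ v x) • f x := by
  have hinner : ExpGrowth fun x => (2 * inner ℝ v x) • f x :=
    ((ExpGrowth.const (2 : ℝ)).mul (.clm (innerSL ℝ v))).smul hf
  have hcomm : ∀ x, -(2 * inner ℝ v x * Real.exp (-‖x‖ ^ 2)) • f x =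
      -(Real.exp (-‖x‖ ^ 2) • (2 * inner ℝ v x) • f x) := fun x => by
    rw [neg_smul, mul_comm, mul_smul]
  have hparts := integral_bilinear_hasLineDerivAt_right_eq_neg_left_of_integrable
    (μ := (volume : Measure E)) (B := ContinuousLinearMap.lsmul ℝ ℝ) (v := v)
    (f' := fun x => -(2 * inner ℝ v x * Real.exp (-‖x‖ ^ 2))) (g := f) (g' := f')
    (by simpa only [ContinuousLinearMap.lsmul_apply, hcomm] using hinner.integrable.fun_neg)
    hf'.integrable hf.integrable (fun x _ => hasLineDerivAt_exp_neg_norm_sq x v) (fun x _ => h x)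
  simpa only [ContinuousLinearMap.lsmul_apply, hcomm, integral_neg, neg_neg] using hparts

theorem integral_gaussian_smul_divergence {ι : Type*} [Fintype ι] (e : ι → E) {f f' : ι → E → F}
    (hf : ∀ a, ExpGrowth (f a)) (hf' : ∀ a, ExpGrowth (f' a))
    (h : ∀ a x, HasLineDerivAt ℝ (f a) (f' a x) x (e a)) :
    ∫ x, Real.exp (-‖x‖ ^ 2) • ∑ a, f' a x =
      ∫ x, Real.exp (-‖x‖ ^ 2) • ∑ a, (2 * inner ℝ (e a) x) • f a x := by
  have hf₂ : ∀ a, ExpGrowth fun x => (2 * inner ℝ (e a) x) • f a x := fun a =>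
    ((ExpGrowth.const (2 : ℝ)).mul (.clm (innerSL ℝ (e a)))).smul (hf a)
  simp only [Finset.smul_sum]
  rw [integral_finsetSum _ fun a _ => (hf' a).integrable,
    integral_finsetSum _ fun a _ => (hf₂ a).integrable]
  exact Finset.sum_congr rfl fun a _ => integral_gaussian_smul_lineDeriv (hf a) (hf' a) (h a)

end Gaussian

/-! ### Polynomials in functions of exponential growth -/

section Aeval

open MvPolynomial

variable {σ : Type*}

theorem derivation_eq_sum_vars_pderiv_smul {R A : Type*} [CommSemiring R] [AddCommMonoid A]
    [Module R A] [Module (MvPolynomial σ R) A] [IsScalarTower R (MvPolynomial σ R) A]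
    (D : Derivation R (MvPolynomial σ R) A) (p : MvPolynomial σ R) :
    D p = ∑ l ∈ p.vars, pderiv l p • D (X l) := by
  classical
  let D' : Derivation R (MvPolynomial σ R) A := ∑ l ∈ p.vars,
    (LinearMap.toSpanSingleton (MvPolynomial σ R) A (D (X l))).compDer (pderiv l)
  have hD' : ∀ q, D' q = ∑ l ∈ p.vars, pderiv l q • D (X l) := fun q => by
    have h := congrFun (map_sum Derivation.coeFnAddMonoidHom (fun l =>
      (LinearMap.toSpanSingleton (MvPolynomial σ R) A (D (X l))).compDer (pderiv l)) p.vars) q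
    exact h.trans (Finset.sum_apply _ _ _)
  rw [← hD']
  refine derivation_eq_of_forall_mem_vars fun i hi => ?_
  rw [hD', Finset.sum_eq_single_of_mem i hi fun l _ hl => by rw [pderiv_X_of_ne hl.symm, zero_smul],
    pderiv_X_self, one_smul]

theorem hasDerivAt_aeval {u : σ → ℝ → ℂ} {u' : σ → ℂ} {t : ℝ} (hu : ∀ l, HasDerivAt (u l) (u' l) t)
    (q : MvPolynomial σ ℂ) :
    HasDerivAt (fun s => aeval (fun l => u l s) q)
      (∑ l ∈ q.vars, aeval (fun l => u l t) (pderiv l q) * u' l) t := by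
  let : Module (MvPolynomial σ ℂ) ℂ := Module.compHom ℂ (aeval fun l => u l t).toRingHom
  have hsmul : ∀ (p : MvPolynomial σ ℂ) (z : ℂ), p • z = aeval (fun l => u l t) p * z := fun _ _ =>
    rfl
  have : IsScalarTower ℂ (MvPolynomial σ ℂ) ℂ := ⟨fun c p z => by simp [hsmul, mul_assoc]⟩
  suffices h : HasDerivAt (fun s => aeval (fun l => u l s) q) (mkDerivation ℂ u' q) t by
    rw [derivation_eq_sum_vars_pderiv_smul] at h
    simpa only [mkDerivation_X, hsmul] using h
  induction q using MvPolynomial.induction_on with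
  | C a => simpa only [aeval_C, derivation_C] using hasDerivAt_const t _
  | add p q hp hq => simpa only [map_add] using hp.fun_add hq
  | mul_X p l hp =>
    simp only [map_mul, aeval_X, Derivation.leibniz, mkDerivation_X, hsmul]
    exact (hp.mul (hu l)).congr_deriv (by ring)

variable {E : Type*} [NormedAddCommGroup E]

theorem ExpGrowth.aeval {u : σ → E → ℂ} (hu : ∀ l, ExpGrowth (u l)) (q : MvPolynomial σ ℂ) :
    ExpGrowth fun x => aeval (fun l => u l x) q := by
  induction q using MvPolynomial.induction_on with
  | C a => simpa only [aeval_C] using ExpGrowth.const _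
  | add p q hp hq => simpa only [map_add] using hp.add hq
  | mul_X p l hp => simpa only [map_mul, aeval_X] using hp.mul (hu l)

variable [InnerProductSpace ℝ E] [FiniteDimensional ℝ E] [MeasurableSpace E] [BorelSpace E]

/-- The Gaussian integral of a polynomial in a family of functions of exponential growth, as a
linear functional of the polynomial. -/
def gaussFunctional (u : σ → E → ℂ) (hu : ∀ l, ExpGrowth (u l)) : MvPolynomial σ ℂ →ₗ[ℂ] ℂ where
  toFun q := ∫ x, Real.exp (-‖x‖ ^ 2) • aeval (fun l => u l x) q
  map_add' p q := by
    simp only [map_add, smul_add]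
    exact integral_add (ExpGrowth.aeval hu p).integrable (ExpGrowth.aeval hu q).integrable
  map_smul' c q := by
    simp only [map_smul, smul_comm _ c]
    exact integral_smul c _

theorem gaussFunctional_apply (u : σ → E → ℂ) (hu : ∀ l, ExpGrowth (u l)) (q : MvPolynomial σ ℂ) :
    gaussFunctional u hu q = ∫ x, Real.exp (-‖x‖ ^ 2) • aeval (fun l => u l x) q := rfl

end Aeval

/-! ### The vector fields `∑ i, xᵢ ^ k ∂ᵢ` -/

section PowerDeriv

open MvPolynomial

theorem derivation_prod_eq_prod_mul_sum {R A ι : Type*} [CommSemiring R] [CommSemiring A]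
    [Algebra R A] (D : Derivation R A A) {s : Finset ι} {f g : ι → A}
    (h : ∀ i ∈ s, D (f i) = f i * g i) : D (∏ i ∈ s, f i) = (∏ i ∈ s, f i) * ∑ i ∈ s, g i := by
  classical
  induction s using Finset.induction_on with
  | empty => simp
  | insert a s ha ih =>
    rw [Finset.prod_insert ha, Finset.sum_insert ha, Derivation.leibniz,
      ih fun i hi => h i (Finset.mem_insert_of_mem hi), h a (Finset.mem_insert_self a s),
      smul_eq_mul, smul_eq_mul]
    ring

variable {R ι : Type*} [CommRing R]

/-- The vector field `∑ i, xᵢ ^ k ∂ᵢ`. -/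
def powerDeriv (R ι : Type*) [CommRing R] (k : ℕ) :
    Derivation R (MvPolynomial ι R) (MvPolynomial ι R) :=
  mkDerivation R fun i => X i ^ k

theorem powerDeriv_X (k : ℕ) (i : ι) : powerDeriv R ι k (X i) = X i ^ k :=
  mkDerivation_X R _ i

theorem powerDeriv_eq_sum [Fintype ι] (k : ℕ) (p : MvPolynomial ι R) :
    powerDeriv R ι k p = ∑ i, X i ^ k * pderiv i p := by
  rw [derivation_eq_sum_vars_pderiv_smul]
  simp only [powerDeriv_X, smul_eq_mul, mul_comm]
  exact Finset.sum_subset (Finset.subset_univ _) fun i _ hi => by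
    rw [pderiv_eq_zero_of_notMem_vars hi, mul_zero]

/-- The complete homogeneous symmetric polynomial of degree `k - 1` in `x` and `y`, that is
`(x ^ k - y ^ k) / (x - y)`. -/
def pairSum (k : ℕ) (x y : R) : R := ∑ a ∈ Finset.range k, x ^ a * y ^ (k - 1 - a)

theorem pairSum_comm (k : ℕ) (x y : R) : pairSum k x y = pairSum k y x :=
  (Commute.all x y).geom_sum₂_comm k

theorem pairSum_self (k : ℕ) (x : R) : pairSum k x x = k * x ^ (k - 1) :=
  geom_sum₂_self x k

theorem sum_sum_eq_diag_add_two_mul [Fintype ι] [LinearOrder ι] [LocallyFiniteOrderTop ι]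
    [LocallyFiniteOrderBot ι] {f : ι → ι → R} (hf : ∀ i j, f i j = f j i) :
    ∑ i, ∑ j, f i j = ∑ i, f i i + 2 * ∑ i, ∑ j ∈ Finset.Ioi i, f i j := by
  have hoff : ∑ i, ∑ j ∈ {i}ᶜ, f i j = 2 * ∑ i, ∑ j ∈ Finset.Ioi i, f i j := by
    rw [← Finset.sum_sum_Ioi_add_eq_sum_sum_off_diag fun i j => f j i]
    simp_rw [Finset.mul_sum, two_mul]
    exact Finset.sum_congr rfl fun i _ => Finset.sum_congr rfl fun j _ => by rw [hf j i]
  rw [← hoff, ← Finset.sum_add_distrib]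
  exact Finset.sum_congr rfl fun i _ => Fintype.sum_eq_add_sum_compl i _

theorem powerDeriv_det_vandermonde {n : ℕ} (k : ℕ) :
    powerDeriv R (Fin n) k (Matrix.vandermonde X).det =
      (Matrix.vandermonde X).det * ∑ i, ∑ j ∈ Finset.Ioi i, pairSum k (X i) (X j) := by
  rw [Matrix.det_vandermonde]
  refine derivation_prod_eq_prod_mul_sum _ fun i _ => derivation_prod_eq_prod_mul_sum _
    fun j _ => ?_
  rw [map_sub, powerDeriv_X, powerDeriv_X, pairSum_comm, pairSum]
  exact ((Commute.all _ _).mul_geom_sum₂ k).symm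

/-- The divergence of the vector field `∑ i, xᵢ ^ k ∂ᵢ` with respect to the squared Vandermonde
determinant, as a polynomial in the power sums. -/
def powerDiv (K : Type*) [CommRing K] (k : ℕ) : MvPolynomial ℕ K :=
  ∑ i ∈ Finset.range k, X i * X (k - 1 - i)

/-- The derivation through which the vector field `∑ i, xᵢ ^ k ∂ᵢ` acts on polynomials in the power
sums, the variable `X l` standing for the power sum `∑ i, xᵢ ^ l`. -/
def powerFlow (K : Type*) [CommRing K] (k : ℕ) :
    Derivation K (MvPolynomial ℕ K) (MvPolynomial ℕ K) :=
  mkDerivation K fun l => (l : K) • X (k + l - 1)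

variable [Fintype ι]

theorem sum_pairSum (k : ℕ) :
    ∑ i, ∑ j, pairSum k (X i : MvPolynomial ι R) (X j) = aeval (psum ι R) (powerDiv R k) := by
  simp only [powerDiv, map_sum, map_mul, aeval_X, pairSum, psum, Finset.sum_mul_sum]
  simp_rw [Finset.sum_comm (s := Finset.univ) (t := Finset.range k)]

theorem powerDeriv_psum (k l : ℕ) :
    powerDeriv R ι k (psum ι R l) = (l : R) • psum ι R (k + l - 1) := by
  rw [psum, map_sum, psum, Finset.smul_sum]
  refine Finset.sum_congr rfl fun i _ => ?_
  rw [Derivation.leibniz_pow, powerDeriv_X, Nat.cast_smul_eq_nsmul]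
  rcases Nat.eq_zero_or_pos l with rfl | hl
  · simp
  · rw [show k + l - 1 = (l - 1) + k by omega, pow_add, smul_eq_mul]

theorem powerDeriv_aeval_psum (k : ℕ) (q : MvPolynomial ℕ R) :
    powerDeriv R ι k (aeval (psum ι R) q) = aeval (psum ι R) (powerFlow R k q) := by
  induction q using MvPolynomial.induction_on with
  | C a => simp
  | add p q hp hq => simp only [map_add, hp, hq]
  | mul_X p l hp =>
    simp only [map_mul, aeval_X, Derivation.leibniz, hp, powerDeriv_psum, map_add, powerFlow,
      mkDerivation_X, smul_eq_mul, map_smul]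

theorem sum_pderiv_mul_det_vandermonde_sq {n : ℕ} (k : ℕ) (q : MvPolynomial ℕ R) :
    ∑ i, pderiv i (X i ^ k * (aeval (psum (Fin n) R) q * (Matrix.vandermonde X).det ^ 2)) =
      aeval (psum (Fin n) R) (powerDiv R k * q + powerFlow R k q) *
        (Matrix.vandermonde X).det ^ 2 := by
  have hleibniz : ∀ (i : Fin n) (P : MvPolynomial (Fin n) R), pderiv i (X i ^ k * P) =
      X i ^ k * pderiv i P + pairSum k (X i) (X i) * P := fun i P => by
    rw [Derivation.leibniz, Derivation.leibniz_pow, pderiv_X_self, pairSum_self]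
    simp only [smul_eq_mul, nsmul_eq_mul, mul_one]
    ring
  simp_rw [hleibniz, Finset.sum_add_distrib, ← powerDeriv_eq_sum, ← Finset.sum_mul]
  rw [Derivation.leibniz, Derivation.leibniz_pow, powerDeriv_det_vandermonde,
    powerDeriv_aeval_psum, map_add, map_mul, ← sum_pairSum, sum_sum_eq_diag_add_two_mul
      fun i j : Fin n => pairSum_comm k (X i : MvPolynomial (Fin n) R) (X j)]
  simp only [smul_eq_mul, nsmul_eq_mul, Nat.cast_ofNat, Nat.add_one_sub_one, pow_one]
  ring

end PowerDeriv

/-! ### Loop equations -/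

section LoopEquations

open MvPolynomial

variable {K : Type*} [Field K]

/-- The loop (Schwinger–Dyson) equations of the Gaussian unitary ensemble of size `N`, for a
functional on polynomials in the power sums of the eigenvalues. -/
structure LoopEquations (N : K) (Φ : MvPolynomial ℕ K →ₗ[K] K) : Prop where
  zero : ∀ q, Φ (X 0 * q) = N * Φ q
  succ : ∀ k q, 2 * Φ (X (k + 1) * q) = Φ (powerDiv K k * q + powerFlow K k q)

theorem isWeightedHomogeneous_powerDiv (k : ℕ) :
    IsWeightedHomogeneous (id : ℕ → ℕ) (powerDiv K k) (k - 1) := by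
  refine Submodule.sum_mem (weightedHomogeneousSubmodule K id (k - 1)) fun i hi => ?_
  have hik : i + (k - 1 - i) = k - 1 := by have := Finset.mem_range.1 hi; omega
  have hmul := (isWeightedHomogeneous_X K id i).mul (isWeightedHomogeneous_X K id (k - 1 - i))
  rwa [id_eq, id_eq, hik] at hmul

theorem isWeightedHomogeneous_powerFlow_monomial (k : ℕ) (d : ℕ →₀ ℕ) :
    IsWeightedHomogeneous (id : ℕ → ℕ) (powerFlow K k (monomial d 1))
      (Finsupp.weight id d + k - 1) := by
  rw [powerFlow, mkDerivation_monomial, one_smul]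
  refine Submodule.sum_mem (weightedHomogeneousSubmodule K id _) fun l hl => ?_
  rcases Nat.eq_zero_or_pos l with rfl | hl_pos
  · simp
  obtain ⟨e, rfl⟩ : ∃ e, d = Finsupp.single l 1 + e :=
    le_iff_exists_add.1 (Finsupp.single_le_iff.2
      (Nat.one_le_iff_ne_zero.2 (Finsupp.mem_support_iff.1 hl)))
  have hweight : Finsupp.weight (id : ℕ → ℕ) e + (k + l - 1) =
      Finsupp.weight id (Finsupp.single l 1 + e) + k - 1 := by
    rw [map_add, Finsupp.weight_single, one_smul, id_eq]
    omega
  beta_reduce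
  rw [add_tsub_cancel_left, smul_eq_mul, mul_smul_comm, ← hweight]
  exact Submodule.smul_mem _ _ ((isWeightedHomogeneous_monomial id e _ rfl).mul
    (isWeightedHomogeneous_X K id _))

namespace LoopEquations

variable {N : K} {Φ Ψ : MvPolynomial ℕ K →ₗ[K] K}

theorem apply_monomial_single_zero (h : LoopEquations N Φ) (h1 : Φ 1 = 0) (m : ℕ) :
    Φ (monomial (Finsupp.single 0 m) 1) = 0 := by
  induction m with
  | zero => simpa using h1
  | succ m ih =>
    have hstep := h.zero (monomial (Finsupp.single 0 m) 1)
    rwa [X, monomial_mul, ← Finsupp.single_add, one_mul, ih, mul_zero, add_comm] at hstep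

theorem apply_eq_zero_of_isWeightedHomogeneous [NeZero (2 : K)] (h : LoopEquations N Φ)
    (h1 : Φ 1 = 0) (W : ℕ) :
    ∀ p, IsWeightedHomogeneous (id : ℕ → ℕ) p W → Φ p = 0 := by
  induction W using Nat.strong_induction_on with
  | _ W ih =>
  suffices hmonomial : ∀ d : ℕ →₀ ℕ, Finsupp.weight id d = W → Φ (monomial d 1) = 0 by
    intro p hp
    rw [p.as_sum, map_sum]
    refine Finset.sum_eq_zero fun d hd => ?_
    rw [← mul_one (coeff d p), ← smul_eq_mul, ← smul_monomial, map_smul,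
      hmonomial d (hp (mem_support_iff.1 hd)), smul_zero]
  intro d hd
  by_cases hk : ∃ k, d (k + 1) ≠ 0
  · obtain ⟨k, hk⟩ := hk
    obtain ⟨e, rfl⟩ : ∃ e, d = Finsupp.single (k + 1) 1 + e :=
      le_iff_exists_add.1 (Finsupp.single_le_iff.2 (Nat.one_le_iff_ne_zero.2 hk))
    have hW : W = k + 1 + Finsupp.weight (id : ℕ → ℕ) e := by
      rw [← hd, map_add, Finsupp.weight_single, one_smul, id_eq]
    have hdiv : Φ (powerDiv K k * monomial e 1) = 0 := ih _ (by omega) _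
      ((isWeightedHomogeneous_powerDiv k).mul (isWeightedHomogeneous_monomial id e 1 rfl))
    have hflow : Φ (powerFlow K k (monomial e 1)) = 0 :=
      ih _ (by omega) _ (isWeightedHomogeneous_powerFlow_monomial k e)
    have hloop := h.succ k (monomial e 1)
    rw [map_add, hdiv, hflow, add_zero, X, monomial_mul, one_mul] at hloop
    exact (mul_eq_zero.1 hloop).resolve_left two_ne_zero
  · have hd0 : d = Finsupp.single 0 (d 0) := by
      push Not at hk
      ext (_ | i) <;> simp [hk]
    rw [hd0]
    exact h.apply_monomial_single_zero h1 _

theorem sub (hΦ : LoopEquations N Φ) (hΨ : LoopEquations N Ψ) : LoopEquations N (Φ - Ψ) where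
  zero q := by simp only [LinearMap.sub_apply, hΦ.zero, hΨ.zero]; ring
  succ k q := by simp only [LinearMap.sub_apply, mul_sub, hΦ.succ, hΨ.succ]

theorem smul (h : LoopEquations N Φ) (c : K) : LoopEquations N (c • Φ) where
  zero q := by simp only [LinearMap.smul_apply, smul_eq_mul, h.zero]; ring
  succ k q := by simp only [LinearMap.smul_apply, smul_eq_mul, ← h.succ]; ring

theorem eq_of_apply_one [NeZero (2 : K)] (hΦ : LoopEquations N Φ) (hΨ : LoopEquations N Ψ)
    (h1 : Φ 1 = Ψ 1) : Φ = Ψ := by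
  rw [← sub_eq_zero]
  refine (basisMonomials ℕ K).ext fun d => ?_
  rw [coe_basisMonomials]
  exact (hΦ.sub hΨ).apply_eq_zero_of_isWeightedHomogeneous (by simp [h1]) _ _
    (isWeightedHomogeneous_monomial id d 1 rfl)

end LoopEquations

end LoopEquations

/-! ### Loop equations of the eigenvalue density -/

section Eigenvalue

open MvPolynomial

variable {n : ℕ}

/-- The `i`-th coordinate function of Euclidean space, with complex values. -/
def coordFun (i : Fin n) (x : EuclideanSpace ℝ (Fin n)) : ℂ := x i

theorem expGrowth_coordFun (i : Fin n) : ExpGrowth (coordFun i) :=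
  ExpGrowth.clm (Complex.ofRealCLM.comp (EuclideanSpace.proj i : EuclideanSpace ℝ (Fin n) →L[ℝ] ℝ))

theorem hasLineDerivAt_aeval_coordFun (p : MvPolynomial (Fin n) ℂ) (i : Fin n)
    (x : EuclideanSpace ℝ (Fin n)) :
    HasLineDerivAt ℝ (fun x => aeval (fun l => coordFun l x) p)
      (aeval (fun l => coordFun l x) (pderiv i p)) x (EuclideanSpace.single i 1) := by
  have hcoord : ∀ l, HasDerivAt (fun t : ℝ => coordFun l (x + t • EuclideanSpace.single i (1 : ℝ)))
      (if l = i then 1 else 0) 0 := fun l => by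
    have h := ((Complex.ofRealCLM.comp
      (EuclideanSpace.proj l : EuclideanSpace ℝ (Fin n) →L[ℝ] ℝ)).hasFDerivAt
        (x := x)).hasLineDerivAt (EuclideanSpace.single i (1 : ℝ))
    exact h.congr_deriv (by by_cases hl : l = i <;> simp [hl])
  refine (hasDerivAt_aeval hcoord p).congr_deriv ?_
  simp only [zero_smul, add_zero, mul_ite, mul_one, mul_zero,
    Finset.sum_ite_eq', ite_eq_left_iff]
  exact fun hi => by rw [pderiv_eq_zero_of_notMem_vars hi, map_zero]

/-- The functional of the Gaussian eigenvalue density `Δ(x) ^ 2 * exp (-‖x‖ ^ 2)` on polynomials in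
the power sums, where `Δ` is the Vandermonde determinant. -/
def eigenFunctional (n : ℕ) : MvPolynomial ℕ ℂ →ₗ[ℂ] ℂ :=
  gaussFunctional coordFun expGrowth_coordFun ∘ₗ
    LinearMap.mulRight ℂ ((Matrix.vandermonde X).det ^ 2) ∘ₗ
      (aeval (psum (Fin n) ℂ)).toLinearMap

theorem eigenFunctional_apply (q : MvPolynomial ℕ ℂ) :
    eigenFunctional n q = gaussFunctional coordFun expGrowth_coordFun
      (aeval (psum (Fin n) ℂ) q * (Matrix.vandermonde X).det ^ 2) := rfl

theorem gaussFunctional_coordFun_divergence (p : Fin n → MvPolynomial (Fin n) ℂ) :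
    gaussFunctional coordFun expGrowth_coordFun (∑ i, pderiv i (p i)) =
      2 * gaussFunctional coordFun expGrowth_coordFun (∑ i, X i * p i) := by
  have hinner : ∀ (i : Fin n) (x : EuclideanSpace ℝ (Fin n)),
      inner ℝ (EuclideanSpace.single i (1 : ℝ)) x = x i := fun i x => by
    simpa using EuclideanSpace.inner_single_left (𝕜 := ℝ) i 1 x
  have hdiv := integral_gaussian_smul_divergence (fun i : Fin n => EuclideanSpace.single i (1 : ℝ))
    (fun i => ExpGrowth.aeval expGrowth_coordFun (p i))
    (fun i => ExpGrowth.aeval expGrowth_coordFun (pderiv i (p i)))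
    (fun i x => hasLineDerivAt_aeval_coordFun (p i) i x)
  rw [← smul_eq_mul, ← map_smul, gaussFunctional_apply, gaussFunctional_apply]
  simp only [map_sum, map_smul, map_mul, aeval_X, Finset.smul_sum]
  simp only [Finset.smul_sum, hinner] at hdiv
  rw [hdiv]
  refine integral_congr_ae (.of_forall fun x => Finset.sum_congr rfl fun i _ => ?_)
  simp [coordFun, mul_assoc]

theorem loopEquations_eigenFunctional : LoopEquations (n : ℂ) (eigenFunctional n) where
  zero q := by
    rw [eigenFunctional_apply, eigenFunctional_apply, map_mul (aeval _), aeval_X, psum_zero,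
      Fintype.card_fin, mul_assoc, ← nsmul_eq_mul, map_nsmul, nsmul_eq_mul]
  succ k q := by
    rw [eigenFunctional_apply, eigenFunctional_apply, ← sum_pderiv_mul_det_vandermonde_sq,
      gaussFunctional_coordFun_divergence]
    simp only [map_mul, aeval_X, psum, Finset.sum_mul, ← mul_assoc, pow_succ']

end Eigenvalue

/-! ### Loop equations of the matrix ensemble -/

section MatrixLoop

open MvPolynomial

open Herm

variable {n : ℕ}

theorem Herm.ofReal_inner (x y : Herm n) :
    ((inner ℝ x y : ℝ) : ℂ) = Matrix.trace (toMatrix x * toMatrix y) := by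
  rw [inner_def, ← Complex.conj_eq_iff_re, ← Complex.star_def, ← Matrix.trace_conjTranspose,
    Matrix.conjTranspose_mul, (isHermitian x).eq, (isHermitian y).eq, Matrix.trace_mul_comm]

section OrthonormalBasis

variable {ι : Type*} [Fintype ι] (e : OrthonormalBasis ι ℝ (Herm n))

theorem Herm.sum_trace_mul_smul (M : Matrix (Fin n) (Fin n) ℂ) :
    ∑ a, Matrix.trace (toMatrix (e a) * M) • toMatrix (e a) = M := by
  have hHerm : ∀ y : Herm n,
      ∑ a, Matrix.trace (toMatrix (e a) * toMatrix y) • toMatrix (e a) = toMatrix y := fun y => by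
    conv_rhs => rw [← e.sum_repr' y, map_sum]
    refine Finset.sum_congr rfl fun a _ => ?_
    rw [map_smul, ← ofReal_inner]
    exact Complex.coe_smul _ _
  obtain ⟨y, z, rfl⟩ : ∃ y z : Herm n, M = toMatrix y + Complex.I • toMatrix z :=
    ⟨(realPart M : selfAdjoint _), (imaginaryPart M : selfAdjoint _),
      (realPart_add_I_smul_imaginaryPart M).symm⟩
  simp only [mul_add, Matrix.trace_add, add_smul, Finset.sum_add_distrib, hHerm, mul_smul_comm,
    Matrix.trace_smul, smul_assoc, ← Finset.smul_sum]

theorem Herm.sum_trace_mul_mul_trace_mul (A B : Matrix (Fin n) (Fin n) ℂ) :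
    ∑ a, Matrix.trace (toMatrix (e a) * A) * Matrix.trace (toMatrix (e a) * B) =
      Matrix.trace (A * B) := by
  conv_rhs => rw [← sum_trace_mul_smul e A]
  simp only [Finset.sum_mul, Matrix.trace_sum, smul_mul_assoc, Matrix.trace_smul, smul_eq_mul]

theorem Herm.sum_mul_mul_self (A : Matrix (Fin n) (Fin n) ℂ) :
    ∑ a, toMatrix (e a) * A * toMatrix (e a) = Matrix.trace A • 1 := by
  have hsingle : ∀ i j k l, ∑ a, toMatrix (e a) i j * toMatrix (e a) k l =
      Matrix.single j i (1 : ℂ) k l := fun i j k l => by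
    conv_rhs => rw [← sum_trace_mul_smul e (Matrix.single j i 1)]
    simp [Matrix.sum_apply, Matrix.trace_mul_single]
  ext i l
  calc (∑ a, toMatrix (e a) * A * toMatrix (e a)) i l
      = ∑ k, ∑ j, A j k * ∑ a, toMatrix (e a) i j * toMatrix (e a) k l := by
        simp only [Matrix.sum_apply, Matrix.mul_apply, Finset.sum_mul, Finset.mul_sum]
        rw [Finset.sum_comm]
        refine Finset.sum_congr rfl fun k _ => ?_
        rw [Finset.sum_comm]
        exact Finset.sum_congr rfl fun j _ => Finset.sum_congr rfl fun a _ => by ring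
    _ = (Matrix.trace A • (1 : Matrix (Fin n) (Fin n) ℂ)) i l := by
        simp [hsingle, Matrix.single_apply, Matrix.one_apply, Matrix.trace, ite_and]

theorem Herm.sum_trace_mul_mul_mul (A B : Matrix (Fin n) (Fin n) ℂ) :
    ∑ a, Matrix.trace (toMatrix (e a) * A * toMatrix (e a) * B) =
      Matrix.trace A * Matrix.trace B := by
  rw [← Matrix.trace_sum, ← Finset.sum_mul, sum_mul_mul_self, smul_mul_assoc, one_mul,
    Matrix.trace_smul, smul_eq_mul]

end OrthonormalBasis

section Growth

attribute [local instance] Matrix.linftyOpNormedRing Matrix.linftyOpNormedAlgebra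

theorem expGrowth_trace {F : Herm n → Matrix (Fin n) (Fin n) ℂ} (hF : ExpGrowth F) :
    ExpGrowth fun x => Matrix.trace (F x) :=
  .clm_comp (Matrix.traceLinearMap (Fin n) ℝ ℂ).toContinuousLinearMap hF

theorem expGrowth_toMatrix_pow (k : ℕ) : ExpGrowth fun x : Herm n => toMatrix x ^ k :=
  (ExpGrowth.clm (toMatrix (n := n)).toContinuousLinearMap).pow k

theorem expGrowth_trace_mul_pow (A : Matrix (Fin n) (Fin n) ℂ) (k : ℕ) :
    ExpGrowth fun x : Herm n => Matrix.trace (A * toMatrix x ^ k) :=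
  expGrowth_trace ((ExpGrowth.const A).mul (expGrowth_toMatrix_pow k))

theorem expGrowth_trace_mul_pow_mul_mul_pow (A B : Matrix (Fin n) (Fin n) ℂ) (k l : ℕ) :
    ExpGrowth fun x : Herm n => Matrix.trace (A * toMatrix x ^ k * B * toMatrix x ^ l) :=
  expGrowth_trace ((((ExpGrowth.const A).mul (expGrowth_toMatrix_pow k)).mul (.const B)).mul
    (expGrowth_toMatrix_pow l))

theorem hasLineDerivAt_trace_mul_pow (B : Matrix (Fin n) (Fin n) ℂ) (k : ℕ) (x v : Herm n) :
    HasLineDerivAt ℝ (fun x : Herm n => Matrix.trace (B * toMatrix x ^ k))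
      (∑ i ∈ Finset.range k,
        Matrix.trace (B * toMatrix x ^ (k - 1 - i) * toMatrix v * toMatrix x ^ i)) x v := by
  have hline : HasDerivAt (fun t : ℝ => toMatrix (x + t • v)) (toMatrix v) 0 := by
    simp only [map_add, map_smul]
    exact (((hasDerivAt_id (0 : ℝ)).smul_const (toMatrix v)).const_add _).congr_deriv (one_smul _ _)
  have h := ((Matrix.traceLinearMap (Fin n) ℝ ℂ).toContinuousLinearMap.hasFDerivAt).comp_hasDerivAt
    0 ((hline.fun_pow' k).const_mul B)
  refine h.congr_deriv ?_
  change Matrix.trace (B * ∑ i ∈ Finset.range k, _) = _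
  simp only [Finset.mul_sum, Matrix.trace_sum, mul_assoc, zero_smul, add_zero, Nat.pred_eq_sub_one]

end Growth

/-- The `l`-th power sum of the eigenvalues of a Hermitian matrix, as a trace. -/
def tracePow (l : ℕ) (x : Herm n) : ℂ := Matrix.trace (toMatrix x ^ l)

theorem expGrowth_tracePow (l : ℕ) : ExpGrowth (tracePow (n := n) l) := by
  simpa only [one_mul] using! expGrowth_trace_mul_pow (n := n) 1 l

theorem hasLineDerivAt_tracePow (l : ℕ) (x v : Herm n) :
    HasLineDerivAt ℝ (tracePow l) (l * Matrix.trace (toMatrix v * toMatrix x ^ (l - 1))) x v := by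
  have h := hasLineDerivAt_trace_mul_pow 1 l x v
  simp only [one_mul] at h
  refine h.congr_deriv ?_
  have hcycle : ∀ i ∈ Finset.range l, Matrix.trace
      (toMatrix x ^ (l - 1 - i) * toMatrix v * toMatrix x ^ i) =
        Matrix.trace (toMatrix v * toMatrix x ^ (l - 1)) := fun i hi => by
    have := Finset.mem_range.1 hi
    rw [mul_assoc, Matrix.trace_mul_comm, mul_assoc, ← pow_add,
      show i + (l - 1 - i) = l - 1 by omega]
  rw [Finset.sum_congr rfl hcycle, Finset.sum_const, Finset.card_range, nsmul_eq_mul]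

/-- The derivative of a polynomial in the traces `tracePow l` in the direction `v`. -/
def traceDeriv (q : MvPolynomial ℕ ℂ) (v x : Herm n) : ℂ :=
  ∑ l ∈ q.vars, aeval (fun l => tracePow l x) (pderiv l q) *
    (l * Matrix.trace (toMatrix v * toMatrix x ^ (l - 1)))

theorem hasLineDerivAt_aeval_tracePow (q : MvPolynomial ℕ ℂ) (x v : Herm n) :
    HasLineDerivAt ℝ (fun x => aeval (fun l => tracePow l x) q) (traceDeriv q v x) x v :=
  (hasDerivAt_aeval (fun l => hasLineDerivAt_tracePow l x v) q).congr_deriv <| by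
    simp only [zero_smul, add_zero, traceDeriv]

theorem expGrowth_traceDeriv (q : MvPolynomial ℕ ℂ) (v : Herm n) : ExpGrowth (traceDeriv q v) :=
  .sum _ fun l => (ExpGrowth.aeval expGrowth_tracePow _).mul
    ((ExpGrowth.const (l : ℂ)).mul (expGrowth_trace_mul_pow (toMatrix v) (l - 1)))

theorem sum_trace_mul_traceDeriv {ι : Type*} [Fintype ι] (e : OrthonormalBasis ι ℝ (Herm n))
    (k : ℕ) (q : MvPolynomial ℕ ℂ) (x : Herm n) :
    ∑ a, Matrix.trace (toMatrix (e a) * toMatrix x ^ k) * traceDeriv q (e a) x =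
      aeval (fun l => tracePow l x) (powerFlow ℂ k q) := by
  rw [derivation_eq_sum_vars_pderiv_smul, map_sum]
  simp only [traceDeriv, Finset.mul_sum]
  rw [Finset.sum_comm]
  refine Finset.sum_congr rfl fun l _ => ?_
  have hflow : aeval (fun l => tracePow l x) (powerFlow ℂ k (X l)) =
      l * Matrix.trace (toMatrix x ^ k * toMatrix x ^ (l - 1)) := by
    rw [powerFlow, mkDerivation_X, map_smul, aeval_X, smul_eq_mul, tracePow, ← pow_add]
    rcases Nat.eq_zero_or_pos l with rfl | hl
    · simp
    · rw [Nat.add_sub_assoc hl]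
  rw [smul_eq_mul, map_mul, hflow, ← sum_trace_mul_mul_trace_mul e, Finset.mul_sum, Finset.mul_sum]
  exact Finset.sum_congr rfl fun a _ => by ring

theorem sum_inner_smul_trace_mul_pow {ι : Type*} [Fintype ι] (e : OrthonormalBasis ι ℝ (Herm n))
    (k : ℕ) (x : Herm n) :
    ∑ a, (2 * inner ℝ (e a) x) • Matrix.trace (toMatrix (e a) * toMatrix x ^ k) =
      2 * tracePow (k + 1) x := by
  rw [tracePow, pow_succ', ← sum_trace_mul_mul_trace_mul e, Finset.mul_sum]
  refine Finset.sum_congr rfl fun a _ => ?_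
  rw [mul_smul, Complex.real_smul, Complex.real_smul, ofReal_inner]
  push_cast
  ring

/-- The functional of the Gaussian unitary ensemble on polynomials in the power sums of the
eigenvalues. -/
def matrixFunctional (n : ℕ) : MvPolynomial ℕ ℂ →ₗ[ℂ] ℂ :=
  gaussFunctional (E := Herm n) tracePow expGrowth_tracePow

/-- The vector field is `x ↦ q (x) x ^ k`, where `q (x)` is the value of `q` at the power sums. -/
theorem matrixFunctional_divergence (k : ℕ) (q : MvPolynomial ℕ ℂ) :
    matrixFunctional n (powerDiv ℂ k * q + powerFlow ℂ k q) =
      2 * matrixFunctional n (X (k + 1) * q) := by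
  let e := stdOrthonormalBasis ℝ (Herm n)
  let Q : Herm n → ℂ := fun x => aeval (fun l => tracePow l x) q
  have hQ : ExpGrowth Q := ExpGrowth.aeval expGrowth_tracePow q
  let F a (x : Herm n) := Matrix.trace (toMatrix (e a) * toMatrix x ^ k) * Q x
  let F' a (x : Herm n) := (∑ i ∈ Finset.range k, Matrix.trace
      (toMatrix (e a) * toMatrix x ^ (k - 1 - i) * toMatrix (e a) * toMatrix x ^ i)) * Q x +
    Matrix.trace (toMatrix (e a) * toMatrix x ^ k) * traceDeriv q (e a) x
  have hF : ∀ a, ExpGrowth (F a) := fun a => (expGrowth_trace_mul_pow _ k).mul hQ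
  have hF' : ∀ a, ExpGrowth (F' a) := fun a =>
    ((ExpGrowth.sum _ fun i => expGrowth_trace_mul_pow_mul_mul_pow _ _ _ i).mul hQ).add
      ((expGrowth_trace_mul_pow _ k).mul (expGrowth_traceDeriv q (e a)))
  have hderiv : ∀ a x, HasLineDerivAt ℝ (F a) (F' a x) x (e a) := fun a x =>
    (HasDerivAt.fun_mul (hasLineDerivAt_trace_mul_pow (toMatrix (e a)) k x (e a))
      (hasLineDerivAt_aeval_tracePow q x (e a))).congr_deriv <| by
        simp only [zero_smul, add_zero, F', Q]
  have hsum : ∀ x, ∑ a, (2 * inner ℝ (e a) x) • F a x =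
      2 * aeval (fun l => tracePow l x) (X (k + 1) * q) := fun x => by
    simp only [F, ← smul_mul_assoc]
    rw [← Finset.sum_mul, sum_inner_smul_trace_mul_pow, map_mul, aeval_X, mul_assoc]
  have hsum' : ∀ x, ∑ a, F' a x =
      aeval (fun l => tracePow l x) (powerDiv ℂ k * q + powerFlow ℂ k q) := fun x => by
    simp only [F', Finset.sum_add_distrib, sum_trace_mul_traceDeriv]
    rw [← Finset.sum_mul, Finset.sum_comm, map_add, map_mul, powerDiv, map_sum]
    simp only [sum_trace_mul_mul_mul e, map_mul, aeval_X, tracePow, mul_comm]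
    simp only [Q, tracePow]
  have hdiv := integral_gaussian_smul_divergence e hF hF' hderiv
  simp only [hsum, hsum'] at hdiv
  rw [matrixFunctional, gaussFunctional_apply, gaussFunctional_apply, hdiv,
    ← integral_const_mul]
  simp only [mul_smul_comm]

theorem loopEquations_matrixFunctional : LoopEquations (n : ℂ) (matrixFunctional n) where
  zero q := by
    rw [← smul_eq_mul (n : ℂ), ← map_smul, matrixFunctional, gaussFunctional_apply,
      gaussFunctional_apply]
    congr 1 with x
    simp [tracePow]
  succ k q := (matrixFunctional_divergence k q).symm

end MatrixLoop

/-! ### Eigenvalues of Hermitian matrices -/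

section Eig

open Herm

variable {n : ℕ}

/-- The vector of eigenvalues of a Hermitian matrix, counted with multiplicity. -/
def eig (x : Herm n) : Fin n → ℝ := (isHermitian x).eigenvalues

theorem tracePow_eq_sum_eig (l : ℕ) (x : Herm n) : tracePow l x = ∑ i, (eig x i : ℂ) ^ l := by
  rw [tracePow, (isHermitian x).spectral_theorem, ← map_pow, Unitary.conjStarAlgAut_apply,
    Matrix.trace_mul_cycle, Unitary.coe_star_mul_self, one_mul, Matrix.diagonal_pow,
    Matrix.trace_diagonal]
  rfl

theorem Herm.norm_sq (x : Herm n) : ‖x‖ ^ 2 = (Matrix.trace (toMatrix x ^ 2)).re := by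
  rw [← real_inner_self_eq_norm_sq, inner_def, sq]

theorem norm_sq_eq_sum_eig (x : Herm n) : ‖x‖ ^ 2 = ∑ i, eig x i ^ 2 := by
  rw [Herm.norm_sq, ← tracePow, tracePow_eq_sum_eig]
  norm_cast

theorem norm_det_eq_prod_eig (x : Herm n) : ‖(toMatrix x).det‖ = ∏ i, |eig x i| := by
  rw [(isHermitian x).det_eq_prod_eigenvalues, norm_prod]
  simp only [RCLike.norm_ofReal, eig]

theorem norm_eig_le (x : Herm n) : ‖eig x‖ ≤ ‖x‖ := by
  refine (pi_norm_le_iff_of_nonneg (norm_nonneg _)).2 fun i => ?_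
  rw [Real.norm_eq_abs]
  refine abs_le_of_sq_le_sq ?_ (norm_nonneg x)
  rw [norm_sq_eq_sum_eig]
  exact Finset.single_le_sum (f := fun i => eig x i ^ 2) (fun i _ => sq_nonneg _)
    (Finset.mem_univ i)

theorem eq_of_antitone_of_prod_natCast_sub_eq {R : Type*} [CommRing R] [LinearOrder R]
    [IsStrictOrderedRing R] {m : ℕ} {v w : Fin m → R} (hv : Antitone v) (hw : Antitone w)
    (h : ∀ k : ℕ, ∏ i, ((k : R) - v i) = ∏ i, ((k : R) - w i)) : v = w := by
  have hpoly : ∏ i, (Polynomial.X - Polynomial.C (v i)) =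
      ∏ i, (Polynomial.X - Polynomial.C (w i)) := by
    refine Polynomial.eq_of_infinite_eval_eq _ _ <|
      (Set.infinite_range_of_injective (Nat.cast_injective (R := R))).mono ?_
    rintro _ ⟨k, rfl⟩
    simpa only [Set.mem_ofPred_eq, Polynomial.eval_prod, Polynomial.eval_sub, Polynomial.eval_X,
      Polynomial.eval_C] using h k
  have hroots : ∀ z : Fin m → R, (∏ i, (Polynomial.X - Polynomial.C (z i))).roots =
      Multiset.ofList (List.ofFn z) := fun z => by
    rw [Polynomial.roots_prod _ _ (Finset.prod_ne_zero_iff.2 fun _ _ =>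
      Polynomial.X_sub_C_ne_zero _), funext fun i => Polynomial.roots_X_sub_C (z i),
      Multiset.bind_singleton, Fin.univ_val_map]
  have hperm := congrArg Polynomial.roots hpoly
  rw [hroots, hroots, Multiset.coe_eq_coe] at hperm
  exact List.ofFn_injective (hperm.eq_of_sortedGE hv.sortedGE_ofFn hw.sortedGE_ofFn)

theorem Herm.continuous_toMatrix : Continuous (toMatrix (n := n)) :=
  toMatrix.continuous_of_finiteDimensional

theorem prod_sub_eig (a : ℝ) (x : Herm n) :
    ∏ i, (a - eig x i) = ((Matrix.scalar (Fin n) (a : ℂ) - toMatrix x).det).re := by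
  rw [← Matrix.eval_charpoly, (isHermitian x).charpoly_eq, Polynomial.eval_prod]
  simp only [Polynomial.eval_sub, Polynomial.eval_X, Polynomial.eval_C]
  rw [← Complex.ofReal_re (∏ i, (a - eig x i))]
  push_cast
  rfl

/-- A decreasing vector is determined by the values of the associated monic polynomial at the
natural numbers, and the characteristic polynomial depends continuously on the matrix. By the
Lusin–Souslin theorem the inverse of this injective map is measurable. -/
theorem measurable_eig : Measurable (eig (n := n)) := by
  let W : Set (Fin (Fintype.card (Fin n)) → ℝ) := {v | Antitone v}
  have hW : IsClosed W := by
    simp only [W, Antitone, Set.ofPred_forall]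
    exact isClosed_iInter fun i => isClosed_iInter fun j => isClosed_iInter fun _ =>
      isClosed_le (continuous_apply _) (continuous_apply _)
  have : StandardBorelSpace W := hW.measurableSet.standardBorel
  let g : W → ℕ → ℝ := fun v k => ∏ i, ((k : ℝ) - v.1 i)
  have hg : Measurable g := measurable_pi_lambda _ fun k => Finset.measurable_prod _ fun i _ =>
    measurable_const.sub ((measurable_pi_apply i).comp measurable_subtype_coe)
  have hinj : Function.Injective g := fun v w h =>
    Subtype.ext (eq_of_antitone_of_prod_natCast_sub_eq v.2 w.2 fun k => congrFun h k)
  let e₀ : Herm n → W := fun x =>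
    ⟨(isHermitian x).eigenvalues₀, (isHermitian x).eigenvalues₀_antitone⟩
  let σ : Fin (Fintype.card (Fin n)) ≃ Fin n := Fintype.equivOfCardEq (Fintype.card_fin _)
  have hge : ∀ k, (fun x => g (e₀ x) k) =
      fun x => ((Matrix.scalar (Fin n) ((k : ℝ) : ℂ) - toMatrix x).det).re := fun k =>
    funext fun x => (Equiv.prod_comp σ.symm fun i => (k : ℝ) - (e₀ x).1 i).symm.trans
      (prod_sub_eig k x)
  have he₀ : Measurable e₀ := by
    rw [← (hg.measurableEmbedding hinj).measurable_comp_iff]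
    refine measurable_pi_lambda _ fun k => ?_
    simp only [Function.comp_apply, hge]
    exact (Complex.continuous_re.comp
      (continuous_const.sub Herm.continuous_toMatrix).matrix_det).measurable
  exact measurable_pi_lambda _ fun i =>
    (measurable_pi_apply (σ.symm i)).comp (measurable_subtype_coe.comp he₀)

end Eig

/-! ### Moments determine measures with exponential moments -/

section Determinacy

open MvPolynomial

theorem hasSum_charFunDual {E : Type*} [NormedAddCommGroup E] [NormedSpace ℝ E]
    [MeasurableSpace E] [OpensMeasurableSpace E] {ρ : Measure E}
    (hρ : ∀ s : ℝ, Integrable (fun y => Real.exp (s * ‖y‖)) ρ) (L : StrongDual ℝ E) :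
    HasSum (fun m : ℕ => ∫ y, ((L y : ℂ) * Complex.I) ^ m / (m.factorial : ℂ) ∂ρ)
      (charFunDual ρ L) := by
  rw [charFunDual_apply]
  refine hasSum_integral_of_dominated_convergence (fun m y => |L y| ^ m / m.factorial)
    (fun m => Continuous.aestronglyMeasurable (by fun_prop)) (fun m => .of_forall fun y => ?_)
    (.of_forall fun y => Real.summable_pow_div_factorial _) ?_ (.of_forall fun y => ?_)
  · simp
  · have hexp : ∀ y, ∑' m : ℕ, |L y| ^ m / (m.factorial : ℝ) = Real.exp |L y| := fun y => by
      rw [Real.exp_eq_exp_ℝ, NormedSpace.exp_eq_tsum_div]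
    simp_rw [hexp]
    refine (hρ ‖L‖).mono' (Continuous.aestronglyMeasurable (by fun_prop)) (.of_forall fun y => ?_)
    rw [Real.norm_of_nonneg (Real.exp_pos _).le]
    exact Real.exp_le_exp.2 (L.le_opNorm y)
  · rw [Complex.exp_eq_exp_ℂ]
    exact NormedSpace.expSeries_div_hasSum_exp _

theorem continuous_aeval_ofReal {ι : Type*} (P : MvPolynomial ι ℂ) :
    Continuous fun y : ι → ℝ => aeval (fun i => (y i : ℂ)) P :=
  (MvPolynomial.continuous_eval P).comp
    (by fun_prop : Continuous fun (y : ι → ℝ) (i : ι) => (y i : ℂ))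

theorem exists_aeval_eq_pow_div_factorial {ι : Type*} [Finite ι] (L : StrongDual ℝ (ι → ℝ))
    (m : ℕ) :
    ∃ P : MvPolynomial ι ℂ, ∀ y : ι → ℝ,
      aeval (fun i => (y i : ℂ)) P = ((L y : ℂ) * Complex.I) ^ m / (m.factorial : ℂ) := by
  classical
  cases nonempty_fintype ι
  refine ⟨C ((m.factorial : ℂ)⁻¹) * ((∑ i, C (L (Pi.single i 1) : ℂ) * X i) * C Complex.I) ^ m,
    fun y => ?_⟩
  have hL : L y = ∑ i, L (Pi.single i 1) * y i := by
    conv_lhs => rw [pi_eq_sum_univ' y, map_sum]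
    exact Finset.sum_congr rfl fun i _ => by rw [map_smul, smul_eq_mul, mul_comm]
  simp only [map_mul, map_pow, map_sum, aeval_X, aeval_C, hL, Complex.ofReal_sum,
    Complex.ofReal_mul, Algebra.algebraMap_self, RingHom.id_apply]
  rw [div_eq_inv_mul]

variable {ι : Type*} [Fintype ι]

theorem measure_ext_of_moments {ρ ρ' : Measure (ι → ℝ)} [IsFiniteMeasure ρ] [IsFiniteMeasure ρ']
    (hρ : ∀ s : ℝ, Integrable (fun y => Real.exp (s * ‖y‖)) ρ)
    (hρ' : ∀ s : ℝ, Integrable (fun y => Real.exp (s * ‖y‖)) ρ')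
    (h : ∀ P : MvPolynomial ι ℂ, ∫ y, aeval (fun i => (y i : ℂ)) P ∂ρ =
      ∫ y, aeval (fun i => (y i : ℂ)) P ∂ρ') : ρ = ρ' := by
  refine Measure.ext_of_charFunDual (funext fun L => (hasSum_charFunDual hρ L).unique ?_)
  refine (hasSum_charFunDual hρ' L).congr_fun fun m => ?_
  obtain ⟨P, hP⟩ := exists_aeval_eq_pow_div_factorial L m
  simpa only [hP] using h P

theorem integrable_aeval_of_integrable_exp {ρ : Measure (ι → ℝ)}
    (hρ : ∀ s : ℝ, Integrable (fun y => Real.exp (s * ‖y‖)) ρ) (P : MvPolynomial ι ℂ) :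
    Integrable (fun y => aeval (fun i => (y i : ℂ)) P) ρ := by
  have hcoord : ∀ i, ExpGrowth fun y : ι → ℝ => (y i : ℂ) := fun i =>
    .clm_comp Complex.ofRealCLM (.clm (ContinuousLinearMap.proj (R := ℝ) (φ := fun _ : ι => ℝ) i))
  have hgrowth := ExpGrowth.aeval hcoord P
  obtain ⟨K, s, -, -, hbound⟩ := hgrowth.bound
  exact ((hρ s).const_mul K).mono' hgrowth.continuous.aestronglyMeasurable (.of_forall hbound)

end Determinacy

/-! ### Power sums generate the symmetric polynomials -/

section Symmetric

open MvPolynomial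

theorem isSymmetric_sum_rename {σ R : Type*} [Fintype σ] [DecidableEq σ] [CommSemiring R]
    (P : MvPolynomial σ R) : (∑ τ : Equiv.Perm σ, rename τ P).IsSymmetric := fun τ => by
  rw [map_sum]
  simp only [rename_rename]
  exact Fintype.sum_equiv (Equiv.mulLeft τ) _ _ fun _ => rfl

variable {σ R : Type*} [Fintype σ] [CommRing R] [Algebra ℚ R]

theorem esymm_mem_adjoin_psum (k : ℕ) :
    esymm σ R k ∈ Algebra.adjoin R (Set.range (psum σ R)) := by
  induction k using Nat.strong_induction_on with
  | _ k ih =>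
  rcases Nat.eq_zero_or_pos k with rfl | hk
  · rw [esymm_zero]
    exact one_mem _
  · have hnewton : (k : MvPolynomial σ R) * esymm σ R k ∈
        Algebra.adjoin R (Set.range (psum σ R)) := by
      classical
      rw [mul_esymm_eq_sum]
      refine mul_mem (pow_mem (neg_mem (one_mem _)) _) (sum_mem fun a ha => ?_)
      exact mul_mem (mul_mem (pow_mem (neg_mem (one_mem _)) _) (ih _ (Finset.mem_filter.1 ha).2))
        (Algebra.subset_adjoin ⟨a.2, rfl⟩)
    have hsmul : esymm σ R k =
        algebraMap ℚ R (k : ℚ)⁻¹ • ((k : MvPolynomial σ R) * esymm σ R k) := by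
      rw [← nsmul_eq_mul, ← Nat.cast_smul_eq_nsmul R, smul_smul, ← map_natCast (algebraMap ℚ R),
        ← map_mul, inv_mul_cancel₀ (by exact_mod_cast hk.ne'), map_one, one_smul]
    rw [hsmul]
    exact Subalgebra.smul_mem _ hnewton _

theorem exists_aeval_psum_eq {P : MvPolynomial σ R} (hP : P.IsSymmetric) :
    ∃ q : MvPolynomial ℕ R, aeval (psum σ R) q = P := by
  obtain ⟨r, hr⟩ := esymmAlgHom_surjective (σ := σ) (R := R) le_rfl ⟨P, hP⟩
  have hr' : aeval (fun i : Fin (Fintype.card σ) => esymm σ R (i + 1)) r = P := by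
    rw [← esymmAlgHom_apply, hr]
  have hmem : P ∈ Algebra.adjoin R
      (Set.range fun i : Fin (Fintype.card σ) => esymm σ R (i + 1)) := by
    rw [Algebra.adjoin_range_eq_range_aeval]
    exact ⟨r, hr'⟩
  have hpsum : P ∈ Algebra.adjoin R (Set.range (psum σ R)) :=
    Algebra.adjoin_le (Set.range_subset_iff.2 fun _ => esymm_mem_adjoin_psum _) hmem
  rwa [Algebra.adjoin_range_eq_range_aeval] at hpsum

end Symmetric

/-! ### The Weyl integration formula -/

section WithDensity

variable {α E : Type*} [MeasurableSpace α] {ρ : Measure α} [NormedAddCommGroup E] [NormedSpace ℝ E]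
  {g : α → ℝ}

theorem integral_withDensity_ofReal (hg : Measurable g) (h0 : ∀ x, 0 ≤ g x) (f : α → E) :
    ∫ x, f x ∂(ρ.withDensity fun x => ENNReal.ofReal (g x)) = ∫ x, g x • f x ∂ρ := by
  rw [integral_withDensity_eq_integral_toReal_smul hg.ennreal_ofReal
    (.of_forall fun _ => ENNReal.ofReal_lt_top)]
  simp only [ENNReal.toReal_ofReal (h0 _)]

theorem integrable_withDensity_ofReal (hg : Measurable g) (h0 : ∀ x, 0 ≤ g x) (f : α → E) :
    Integrable f (ρ.withDensity fun x => ENNReal.ofReal (g x)) ↔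
      Integrable (fun x => g x • f x) ρ := by
  rw [integrable_withDensity_iff_integrable_smul' hg.ennreal_ofReal
    (.of_forall fun _ => ENNReal.ofReal_lt_top)]
  simp only [ENNReal.toReal_ofReal (h0 _)]

theorem withDensity_ofReal_ne_zero [TopologicalSpace α] [BorelSpace α] [ρ.IsOpenPosMeasure]
    (hg : Continuous g) {x : α} (hx : 0 < g x) :
    ρ.withDensity (fun x => ENNReal.ofReal (g x)) ≠ 0 := fun h => by
  have hcont : Continuous fun x => ENNReal.ofReal (g x) := ENNReal.continuous_ofReal.comp hg
  rw [withDensity_eq_zero_iff hcont.aemeasurable, hcont.ae_eq_iff_eq ρ continuous_zero] at h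
  exact hx.not_ge (ENNReal.ofReal_eq_zero.1 (congrFun h x))

end WithDensity

section Euclidean

variable {ι F : Type*} [Fintype ι] [NormedAddCommGroup F] [NormedSpace ℝ F]

theorem integrable_gaussian_smul_pi {f : (ι → ℝ) → F}
    (hf : ExpGrowth fun x : EuclideanSpace ℝ ι => f (WithLp.ofLp x)) :
    Integrable fun y : ι → ℝ => Real.exp (-∑ i, y i ^ 2) • f y := by
  rw [← (PiLp.volume_preserving_ofLp ι).integrable_comp_emb
    (MeasurableEquiv.toLp 2 (ι → ℝ)).symm.measurableEmbedding]
  simpa only [EuclideanSpace.real_norm_sq_eq] using! hf.integrable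

theorem integral_gaussian_smul_pi (f : (ι → ℝ) → F) :
    ∫ y : ι → ℝ, Real.exp (-∑ i, y i ^ 2) • f y =
      ∫ x : EuclideanSpace ℝ ι, Real.exp (-‖x‖ ^ 2) • f (WithLp.ofLp x) := by
  rw [← (PiLp.volume_preserving_ofLp ι).integral_comp
    (MeasurableEquiv.toLp 2 (ι → ℝ)).symm.measurableEmbedding]
  simp only [EuclideanSpace.real_norm_sq_eq]

theorem expGrowth_exp_norm_ofLp (s : ℝ) :
    ExpGrowth fun x : EuclideanSpace ℝ ι => Real.exp (s * ‖WithLp.ofLp x‖) := by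
  refine ⟨by fun_prop, 1, |s|, zero_le_one, abs_nonneg _, fun x => ?_⟩
  rw [Real.norm_of_nonneg (Real.exp_pos _).le, one_mul]
  gcongr
  · exact le_abs_self s
  · exact (pi_norm_le_iff_of_nonneg (norm_nonneg _)).2 fun i => PiLp.norm_apply_le x i

end Euclidean

section Weyl

open MvPolynomial

variable {n : ℕ}

/-- The joint density of the eigenvalues of the Gaussian unitary ensemble, up to a constant. -/
def eigWeight (y : Fin n → ℝ) : ℝ := (Matrix.vandermonde y).det ^ 2 * Real.exp (-∑ i, y i ^ 2)

theorem continuous_eigWeight : Continuous (eigWeight (n := n)) := by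
  unfold eigWeight
  simp only [Matrix.det_vandermonde]
  fun_prop

theorem eigWeight_nonneg (y : Fin n → ℝ) : 0 ≤ eigWeight y := by unfold eigWeight; positivity

theorem det_vandermonde_comp_perm_sq {R : Type*} [CommRing R] (τ : Equiv.Perm (Fin n))
    (y : Fin n → R) : (Matrix.vandermonde (y ∘ τ)).det ^ 2 = (Matrix.vandermonde y).det ^ 2 := by
  have hsub : Matrix.vandermonde (y ∘ τ) = (Matrix.vandermonde y).submatrix τ id := rfl
  have hsign : ((Equiv.Perm.sign τ : ℤ) : R) ^ 2 = 1 := by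
    rw [← Int.cast_pow, ← Units.val_pow_eq_pow_val, Int.units_sq, Units.val_one, Int.cast_one]
  rw [hsub, Matrix.det_permute, mul_pow, hsign, one_mul]

theorem eigWeight_comp_perm (τ : Equiv.Perm (Fin n)) (y : Fin n → ℝ) :
    eigWeight (y ∘ τ) = eigWeight y := by
  rw [eigWeight, eigWeight, det_vandermonde_comp_perm_sq]
  congr 3
  exact Equiv.sum_comp τ fun i => y i ^ 2

/-- The unnormalized Gaussian unitary ensemble. -/
def gue (n : ℕ) : Measure (Herm n) :=
  volume.withDensity fun x => ENNReal.ofReal (Real.exp (-‖x‖ ^ 2))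

/-- The unnormalized joint law of the eigenvalues of the Gaussian unitary ensemble, with the
eigenvalues in random order. -/
def eigLaw (n : ℕ) : Measure (Fin n → ℝ) := volume.withDensity fun y => ENNReal.ofReal (eigWeight y)

theorem aeval_det_vandermonde (y : Fin n → ℝ) :
    aeval (fun i => (y i : ℂ)) (Matrix.vandermonde (X : Fin n → MvPolynomial (Fin n) ℂ)).det =
      ((Matrix.vandermonde y).det : ℂ) := by
  simp only [Matrix.det_vandermonde, map_prod, map_sub, aeval_X, Complex.ofReal_prod,
    Complex.ofReal_sub]

theorem expGrowth_det_vandermonde_sq :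
    ExpGrowth fun x : EuclideanSpace ℝ (Fin n) => (Matrix.vandermonde (WithLp.ofLp x)).det ^ 2 := by
  have h := ExpGrowth.clm_comp Complex.reCLM
    (ExpGrowth.aeval expGrowth_coordFun ((Matrix.vandermonde (X (R := ℂ) (σ := Fin n))).det ^ 2))
  convert h using 2 with x
  rw [map_pow, ← Complex.ofReal_re (_ ^ 2), Complex.ofReal_pow, ← aeval_det_vandermonde]
  rfl

theorem integrable_exp_eigLaw (s : ℝ) : Integrable (fun y => Real.exp (s * ‖y‖)) (eigLaw n) := by
  rw [eigLaw, integrable_withDensity_ofReal continuous_eigWeight.measurable eigWeight_nonneg]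
  refine (integrable_gaussian_smul_pi
    (f := fun y => (Matrix.vandermonde y).det ^ 2 * Real.exp (s * ‖y‖))
    (expGrowth_det_vandermonde_sq.mul (expGrowth_exp_norm_ofLp s))).congr (.of_forall fun y => ?_)
  simp only [eigWeight, smul_eq_mul]
  ring

theorem integrable_exp_gue (s : ℝ) : Integrable (fun x => Real.exp (s * ‖x‖)) (gue n) := by
  rw [gue, integrable_withDensity_ofReal (by fun_prop) fun _ => (Real.exp_pos _).le]
  exact (ExpGrowth.exp_norm s).integrable

instance : IsFiniteMeasure (eigLaw n) := by
  have h := integrable_exp_eigLaw (n := n) 0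
  simp only [zero_mul, Real.exp_zero] at h
  exact (integrable_const_iff_isFiniteMeasure one_ne_zero).1 h

instance : IsFiniteMeasure (gue n) := by
  have h := integrable_exp_gue (n := n) 0
  simp only [zero_mul, Real.exp_zero] at h
  exact (integrable_const_iff_isFiniteMeasure one_ne_zero).1 h

instance : NeZero (eigLaw n) where
  out := by
    refine withDensity_ofReal_ne_zero continuous_eigWeight (x := fun i => (i : ℝ)) ?_
    have hdet : (Matrix.vandermonde fun i : Fin n => (i : ℝ)).det ≠ 0 :=
      Matrix.det_vandermonde_ne_zero_iff.2 (Nat.cast_injective.comp Fin.val_injective)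
    unfold eigWeight
    positivity

instance : NeZero (gue n) where
  out := withDensity_ofReal_ne_zero (by fun_prop) (x := 0) (Real.exp_pos _)

theorem eigenFunctional_eq_integral (q : MvPolynomial ℕ ℂ) :
    eigenFunctional n q =
      ∫ y, aeval (fun i => (y i : ℂ)) (aeval (psum (Fin n) ℂ) q) ∂(eigLaw n) := by
  rw [eigLaw, integral_withDensity_ofReal continuous_eigWeight.measurable eigWeight_nonneg,
    eigenFunctional_apply, gaussFunctional_apply]
  refine (integral_gaussian_smul_pi fun y : Fin n → ℝ => aeval (fun i => (y i : ℂ))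
    (aeval (psum (Fin n) ℂ) q * (Matrix.vandermonde X).det ^ 2)).symm.trans ?_
  congr 1 with y
  rw [map_mul, map_pow, aeval_det_vandermonde, eigWeight, Complex.real_smul, Complex.real_smul]
  push_cast
  ring

theorem matrixFunctional_eq_integral (q : MvPolynomial ℕ ℂ) :
    matrixFunctional n q =
      ∫ x, aeval (fun i => (eig x i : ℂ)) (aeval (psum (Fin n) ℂ) q) ∂(gue n) := by
  rw [gue, integral_withDensity_ofReal (by fun_prop) fun _ => (Real.exp_pos _).le,
    matrixFunctional, gaussFunctional_apply]
  simp only [comp_aeval_apply, tracePow_eq_sum_eig, psum, map_sum, map_pow, aeval_X]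

/-- The ratio of the total masses of `gue` and `eigLaw`. -/
def weylConst (n : ℕ) : ℝ := (gue n).real Set.univ / (eigLaw n).real Set.univ

theorem weylConst_pos : 0 < weylConst n := div_pos measureReal_univ_pos measureReal_univ_pos

theorem matrixFunctional_eq_smul : matrixFunctional n = (weylConst n : ℂ) • eigenFunctional n := by
  refine loopEquations_matrixFunctional.eq_of_apply_one (loopEquations_eigenFunctional.smul _) ?_
  have hne : (((eigLaw n).real Set.univ : ℝ) : ℂ) ≠ 0 := by exact_mod_cast measureReal_univ_ne_zero
  rw [LinearMap.smul_apply, matrixFunctional_eq_integral, eigenFunctional_eq_integral]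
  simp only [map_one, integral_const, smul_eq_mul, Complex.real_smul, mul_one, weylConst,
    Complex.ofReal_div]
  rw [div_mul_cancel₀ _ hne]

theorem integral_aeval_eig_gue {P : MvPolynomial (Fin n) ℂ} (hP : P.IsSymmetric) :
    ∫ x, aeval (fun i => (eig x i : ℂ)) P ∂(gue n) =
      weylConst n * ∫ y, aeval (fun i => (y i : ℂ)) P ∂(eigLaw n) := by
  obtain ⟨q, rfl⟩ := exists_aeval_psum_eq hP
  rw [← matrixFunctional_eq_integral, ← eigenFunctional_eq_integral, matrixFunctional_eq_smul,
    LinearMap.smul_apply, smul_eq_mul]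

theorem measurable_comp_perm (τ : Equiv.Perm (Fin n)) :
    Measurable fun y : Fin n → ℝ => y ∘ τ :=
  measurable_pi_lambda _ fun i => measurable_pi_apply (τ i)

theorem map_comp_perm_eigLaw (τ : Equiv.Perm (Fin n)) :
    (eigLaw n).map (fun y => y ∘ τ) = eigLaw n := by
  have hvol : MeasurePreserving (fun y : Fin n → ℝ => y ∘ τ) :=
    volume_preserving_arrowCongr' τ.symm (MeasurableEquiv.refl ℝ) (.id _)
  ext s hs
  rw [Measure.map_apply (measurable_comp_perm τ) hs, eigLaw,
    withDensity_apply _ (measurable_comp_perm τ hs), withDensity_apply _ hs,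
    ← hvol.setLIntegral_comp_preimage hs continuous_eigWeight.measurable.ennreal_ofReal]
  simp only [eigWeight_comp_perm]

/-- The sum over all permutations of the laws of the permuted eigenvalues. -/
def symEigLaw (n : ℕ) : Measure (Fin n → ℝ) :=
  ∑ τ : Equiv.Perm (Fin n), (gue n).map fun x => eig x ∘ τ

instance : IsFiniteMeasure (symEigLaw n) := by unfold symEigLaw; infer_instance

theorem measurable_eig_comp_perm (τ : Equiv.Perm (Fin n)) :
    Measurable fun x : Herm n => eig x ∘ τ := (measurable_comp_perm τ).comp measurable_eig

theorem integrable_exp_map_eig_comp_perm (τ : Equiv.Perm (Fin n)) (s : ℝ) :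
    Integrable (fun y => Real.exp (s * ‖y‖)) ((gue n).map fun x => eig x ∘ τ) := by
  rw [integrable_map_measure (Continuous.aestronglyMeasurable (by fun_prop))
    (measurable_eig_comp_perm τ).aemeasurable]
  refine (integrable_exp_gue |s|).mono' ?_ (.of_forall fun x => ?_)
  · exact ((measurable_eig_comp_perm τ).norm.const_mul s).exp.aestronglyMeasurable
  · rw [Function.comp_apply, Real.norm_of_nonneg (Real.exp_pos _).le]
    gcongr
    · exact le_abs_self s
    · exact (pi_norm_le_iff_of_nonneg (norm_nonneg _)).2 fun i =>
        (norm_le_pi_norm (eig x) (τ i)).trans (norm_eig_le x)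

theorem integral_aeval_rename (ρ : Measure (Fin n → ℝ)) (τ : Equiv.Perm (Fin n))
    (P : MvPolynomial (Fin n) ℂ) :
    ∫ y, aeval (fun i => (y i : ℂ)) (rename τ P) ∂ρ =
      ∫ y, aeval (fun i => (y i : ℂ)) P ∂(ρ.map fun y => y ∘ τ) := by
  rw [integral_map (measurable_comp_perm τ).aemeasurable
    (continuous_aeval_ofReal P).aestronglyMeasurable]
  simp only [aeval_rename]
  rfl

theorem integral_aeval_symEigLaw (P : MvPolynomial (Fin n) ℂ) :
    ∫ y, aeval (fun i => (y i : ℂ)) P ∂(symEigLaw n) =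
      ∫ x, aeval (fun i => (eig x i : ℂ)) (∑ τ : Equiv.Perm (Fin n), rename τ P) ∂(gue n) := by
  have hmap : ∀ τ : Equiv.Perm (Fin n), (gue n).map (fun x => eig x ∘ τ) =
      ((gue n).map eig).map fun y => y ∘ τ := fun τ =>
    (Measure.map_map (measurable_comp_perm τ) measurable_eig).symm
  have heig : ∀ s, Integrable (fun y => Real.exp (s * ‖y‖)) ((gue n).map eig) :=
    integrable_exp_map_eig_comp_perm (Equiv.refl _)
  have hint : ∀ τ : Equiv.Perm (Fin n), Integrable (fun y : Fin n → ℝ =>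
      aeval (fun i => (y i : ℂ)) (rename τ P)) ((gue n).map eig) := fun τ =>
    integrable_aeval_of_integrable_exp heig _
  rw [symEigLaw, integral_finsetSum_measure fun τ _ =>
    integrable_aeval_of_integrable_exp (integrable_exp_map_eig_comp_perm τ) P]
  simp only [hmap, ← integral_aeval_rename]
  rw [← integral_finsetSum _ fun τ _ => hint τ, integral_map measurable_eig.aemeasurable
    (integrable_finsetSum _ fun τ _ => hint τ).aestronglyMeasurable]
  simp only [map_sum]

theorem symEigLaw_eq : symEigLaw n = ENNReal.ofReal (weylConst n * n.factorial) • eigLaw n := by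
  have : IsFiniteMeasure (ENNReal.ofReal (weylConst n * n.factorial) • eigLaw n) :=
    Measure.smul_finite _ ENNReal.ofReal_ne_top
  have hint : ∀ P : MvPolynomial (Fin n) ℂ,
      Integrable (fun y : Fin n → ℝ => aeval (fun i => (y i : ℂ)) P) (eigLaw n) :=
    integrable_aeval_of_integrable_exp integrable_exp_eigLaw
  refine measure_ext_of_moments (fun s => ?_)
    (fun s => (integrable_exp_eigLaw s).smul_measure ENNReal.ofReal_ne_top) fun P => ?_
  · rw [symEigLaw, integrable_finsetSum_measure]
    exact fun τ _ => integrable_exp_map_eig_comp_perm τ s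
  · rw [integral_aeval_symEigLaw, integral_aeval_eig_gue (isSymmetric_sum_rename P)]
    simp only [map_sum]
    rw [integral_finsetSum _ fun τ _ => hint _, integral_smul_measure, ENNReal.toReal_ofReal
      (mul_nonneg weylConst_pos.le n.factorial.cast_nonneg)]
    simp only [integral_aeval_rename, map_comp_perm_eigLaw, Finset.sum_const, Finset.card_univ,
      Fintype.card_perm, Fintype.card_fin, nsmul_eq_mul, Complex.real_smul, Complex.ofReal_mul,
      Complex.ofReal_natCast, mul_assoc]

theorem lintegral_eig_gue {g : (Fin n → ℝ) → ℝ≥0∞} (hg : Measurable g)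
    (hsymm : ∀ (τ : Equiv.Perm (Fin n)) y, g (y ∘ τ) = g y) :
    ∫⁻ x, g (eig x) ∂(gue n) = ENNReal.ofReal (weylConst n) * ∫⁻ y, g y ∂(eigLaw n) := by
  have h := congrArg (fun ρ => ∫⁻ y, g y ∂ρ) (symEigLaw_eq (n := n))
  simp only [symEigLaw, lintegral_finsetSum_measure, lintegral_smul_measure,
    lintegral_map hg (measurable_eig_comp_perm _), hsymm, Finset.sum_const, Finset.card_univ,
    Fintype.card_perm, Fintype.card_fin, nsmul_eq_mul, smul_eq_mul] at h
  rw [mul_comm (weylConst n), ENNReal.ofReal_mul (by positivity), ENNReal.ofReal_natCast,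
    mul_assoc] at h
  exact (ENNReal.mul_right_inj (by exact_mod_cast n.factorial_ne_zero)
    (ENNReal.natCast_ne_top _)).1 h

end Weyl

/-! ### Generalized Hermite polynomials -/

section Hermite

open Polynomial

/-- The weight of the generalized Hermite polynomials. -/
def hermWeight (μ x : ℝ) : ℝ := |x| ^ (2 * μ) * Real.exp (-x ^ 2)

theorem hermWeight_nonneg (μ x : ℝ) : 0 ≤ hermWeight μ x := by unfold hermWeight; positivity

theorem hermWeight_neg (μ x : ℝ) : hermWeight μ (-x) = hermWeight μ x := by simp [hermWeight]

theorem measurable_hermWeight (μ : ℝ) : Measurable (hermWeight μ) := by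
  unfold hermWeight; fun_prop

theorem integral_abs_rpow_mul_exp {s : ℝ} (hs : -1 < s) :
    ∫ x : ℝ, |x| ^ s * Real.exp (-x ^ 2) = Real.Gamma ((s + 1) / 2) := by
  have h := integral_comp_abs (f := fun x => x ^ s * Real.exp (-x ^ (2 : ℝ)))
  rw [integral_rpow_mul_exp_neg_rpow two_pos hs] at h
  simp only [Real.rpow_two, sq_abs] at h
  rw [h]
  ring

theorem integrable_abs_rpow_mul_exp {s : ℝ} (hs : -1 < s) :
    Integrable fun x : ℝ => |x| ^ s * Real.exp (-x ^ 2) := by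
  refine .of_integral_ne_zero ?_
  rw [integral_abs_rpow_mul_exp hs]
  exact (Real.Gamma_pos_of_pos (by linarith)).ne'

theorem integral_eq_zero_of_odd {f : ℝ → ℝ} (hf : ∀ x, f (-x) = -f x) : ∫ x, f x = 0 := by
  have h := integral_neg_eq_self f volume
  simp only [hf, integral_neg] at h
  linarith

variable {μ : ℝ}

theorem abs_pow_mul_hermWeight (hμ : 0 ≤ μ) (m : ℕ) (x : ℝ) :
    |x| ^ m * hermWeight μ x = |x| ^ (m + 2 * μ) * Real.exp (-x ^ 2) := by
  rw [hermWeight, Real.rpow_add_of_nonneg (abs_nonneg x) (by positivity) (by positivity),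
    Real.rpow_natCast, mul_assoc]

theorem integrable_pow_mul_hermWeight (hμ : 0 ≤ μ) (m : ℕ) :
    Integrable fun x : ℝ => x ^ m * hermWeight μ x := by
  refine (integrable_abs_rpow_mul_exp (s := m + 2 * μ) (neg_one_lt_zero.trans_le (by positivity))
    ).mono' ((measurable_id.pow_const m).mul (measurable_hermWeight μ)).aestronglyMeasurable
    (.of_forall fun x => ?_)
  rw [← abs_pow_mul_hermWeight hμ, norm_mul, Real.norm_of_nonneg (hermWeight_nonneg _ _), norm_pow,
    Real.norm_eq_abs]

theorem integrable_eval_mul_hermWeight (hμ : 0 ≤ μ) (p : ℝ[X]) :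
    Integrable fun x : ℝ => p.eval x * hermWeight μ x := by
  induction p using Polynomial.induction_on' with
  | add p q hp hq =>
    simp only [eval_add, add_mul]
    exact hp.add hq
  | monomial m a =>
    simp only [eval_monomial, mul_assoc]
    exact (integrable_pow_mul_hermWeight hμ m).const_mul a

/-- Integration of polynomials against the weight `hermWeight μ`. -/
def hermInt (hμ : 0 ≤ μ) : ℝ[X] →ₗ[ℝ] ℝ where
  toFun p := ∫ x, p.eval x * hermWeight μ x
  map_add' p q := by
    simp only [eval_add, add_mul]
    exact integral_add (integrable_eval_mul_hermWeight hμ p) (integrable_eval_mul_hermWeight hμ q)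
  map_smul' c p := by
    simp only [eval_smul, smul_eq_mul, mul_assoc, RingHom.id_apply]
    exact integral_const_mul _ _

theorem hermInt_apply (hμ : 0 ≤ μ) (p : ℝ[X]) :
    hermInt hμ p = ∫ x, p.eval x * hermWeight μ x := rfl

theorem hermInt_monomial (hμ : 0 ≤ μ) (m : ℕ) (a : ℝ) :
    hermInt hμ (monomial m a) = a * hermInt hμ (X ^ m) := by
  rw [← C_mul_X_pow_eq_monomial, ← smul_eq_C_mul, map_smul, smul_eq_mul]

theorem hermInt_X_pow_of_odd (hμ : 0 ≤ μ) {m : ℕ} (hm : Odd m) : hermInt hμ (X ^ m) = 0 :=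
  integral_eq_zero_of_odd fun x => by
    simp only [eval_pow, eval_X, hermWeight_neg, hm.neg_pow, neg_mul]

theorem hermInt_X_pow_of_even (hμ : 0 ≤ μ) {m : ℕ} (hm : Even m) :
    hermInt hμ (X ^ m) = Real.Gamma ((m + 2 * μ + 1) / 2) := by
  rw [hermInt_apply, ← integral_abs_rpow_mul_exp (neg_one_lt_zero.trans_le (by positivity))]
  congr 1 with x
  rw [← abs_pow_mul_hermWeight hμ, eval_pow, eval_X, hm.pow_abs]

/-- The coefficients of the three-term recurrence of the monic generalized Hermite polynomials. -/
def hermCoeff (μ : ℝ) (k : ℕ) : ℝ := (k + if Odd k then 2 * μ else 0) / 2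

theorem hermCoeff_of_odd {k : ℕ} (hk : Odd k) : hermCoeff μ k = k / 2 + μ := by
  rw [hermCoeff, if_pos hk]
  ring

theorem hermCoeff_of_even {k : ℕ} (hk : Even k) : hermCoeff μ k = k / 2 := by
  rw [hermCoeff, if_neg (Nat.not_odd_iff_even.2 hk), add_zero]

theorem hermCoeff_zero : hermCoeff μ 0 = 0 := by simp [hermCoeff]

theorem hermCoeff_nonneg (hμ : 0 ≤ μ) (k : ℕ) : 0 ≤ hermCoeff μ k := by
  unfold hermCoeff; split_ifs <;> positivity

theorem hermCoeff_succ_pos (hμ : 0 ≤ μ) (k : ℕ) : 0 < hermCoeff μ (k + 1) := by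
  unfold hermCoeff; split_ifs <;> positivity

theorem hermCoeff_succ (k : ℕ) :
    hermCoeff μ (k + 1) = hermCoeff μ k + 1 / 2 + μ * (-1) ^ k := by
  rcases Nat.even_or_odd k with hk | hk
  · rw [hermCoeff_of_even hk, hermCoeff_of_odd hk.add_one, hk.neg_one_pow]
    push_cast; ring
  · rw [hermCoeff_of_odd hk, hermCoeff_of_even hk.add_one, hk.neg_one_pow]
    push_cast; ring

theorem hermCoeff_succ_add (k : ℕ) : hermCoeff μ (k + 1) + hermCoeff μ k = k + 1 / 2 + μ := by
  rcases Nat.even_or_odd k with hk | hk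
  · rw [hermCoeff_of_even hk, hermCoeff_of_odd hk.add_one]
    push_cast; ring
  · rw [hermCoeff_of_odd hk, hermCoeff_of_even hk.add_one]
    push_cast; ring

theorem hermCoeff_add_of_odd {i j : ℕ} (h : Odd (i + j)) :
    hermCoeff μ (i + j) = hermCoeff μ i + hermCoeff μ j := by
  rcases Nat.even_or_odd i with hi | hi
  · rw [hermCoeff_of_odd h, hermCoeff_of_even hi, hermCoeff_of_odd ((Nat.odd_add'.1 h).2 hi)]
    push_cast; ring
  · rw [hermCoeff_of_odd h, hermCoeff_of_odd hi, hermCoeff_of_even ((Nat.odd_add.1 h).1 hi)]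
    push_cast; ring

/-- For `m = 0` both sides vanish, although `m - 1` is truncated. -/
theorem hermInt_X_pow_succ (hμ : 0 ≤ μ) (m : ℕ) :
    hermInt hμ (X ^ (m + 1)) = hermCoeff μ m * hermInt hμ (X ^ (m - 1)) := by
  rcases m with _ | m
  · rw [zero_add, hermInt_X_pow_of_odd hμ odd_one, hermCoeff_zero, zero_mul]
  rw [Nat.add_sub_cancel]
  rcases Nat.even_or_odd m with hm | hm
  · have harg : ((m + 1 + 1 : ℕ) + 2 * μ + 1) / 2 = (m + 2 * μ + 1) / 2 + 1 := by push_cast; ring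
    rw [hermInt_X_pow_of_even hμ hm, hermInt_X_pow_of_even hμ hm.add_one.add_one, harg,
      Real.Gamma_add_one (by positivity), hermCoeff_of_odd hm.add_one]
    push_cast
    ring
  · rw [hermInt_X_pow_of_odd hμ hm, hermInt_X_pow_of_odd hμ hm.add_one.add_one, mul_zero]

/-- The Dunkl operator `f ↦ f' + μ (f x - f (-x)) / x` on polynomials, given by its values
`x ^ m ↦ (m + μ (1 - (-1) ^ m)) x ^ (m - 1)` on monomials. -/
def dunkl (μ : ℝ) : ℝ[X] →ₗ[ℝ] ℝ[X] :=
  Polynomial.lsum fun m => (2 * hermCoeff μ m) • monomial (m - 1)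

theorem dunkl_monomial (m : ℕ) (a : ℝ) :
    dunkl μ (monomial m a) = (2 * hermCoeff μ m) • monomial (m - 1) a := by
  rw [dunkl, Polynomial.lsum_apply, Polynomial.sum_monomial_index a _ (LinearMap.map_zero _),
    LinearMap.smul_apply]

theorem dunkl_one : dunkl μ 1 = 0 := by
  rw [← monomial_zero_one, dunkl_monomial, hermCoeff_zero, mul_zero, zero_smul]

theorem monomial_comp_neg_X {R : Type*} [CommRing R] (m : ℕ) (a : R) :
    (monomial m a).comp (-X) = (-1 : R) ^ m • monomial m a := by
  rw [monomial_comp, neg_pow, smul_eq_C_mul, ← C_mul_X_pow_eq_monomial, C_pow, C_neg, C_1]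
  ring

theorem dunkl_comp_neg_X (f : ℝ[X]) : dunkl μ (f.comp (-X)) = -(dunkl μ f).comp (-X) := by
  induction f using Polynomial.induction_on' with
  | add p q hp hq => rw [add_comp, map_add, hp, hq, map_add, add_comp, neg_add]
  | monomial m a =>
    rw [monomial_comp_neg_X, map_smul, dunkl_monomial, smul_comp, monomial_comp_neg_X]
    rcases m with _ | m
    · simp only [hermCoeff_zero, mul_zero, zero_smul, smul_zero, neg_zero]
    · rw [Nat.add_sub_cancel, pow_succ]
      module

theorem dunkl_X_mul (f : ℝ[X]) :
    dunkl μ (X * f) = X * dunkl μ f + f + (2 * μ) • f.comp (-X) := by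
  induction f using Polynomial.induction_on' with
  | add p q hp hq => simp only [mul_add, map_add, hp, hq, add_comp, smul_add]; ring
  | monomial m a =>
    have hX : X * dunkl μ (monomial m a) = (2 * hermCoeff μ m) • monomial m a := by
      rw [dunkl_monomial, mul_smul_comm, X_mul_monomial]
      rcases m with _ | m
      · rw [hermCoeff_zero, mul_zero, zero_smul, zero_smul]
      · rw [Nat.add_sub_cancel]
    rw [hX, X_mul_monomial, dunkl_monomial, Nat.add_sub_cancel, monomial_comp_neg_X, hermCoeff_succ]
    module

theorem hermInt_dunkl_mul_add (hμ : 0 ≤ μ) (f g : ℝ[X]) :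
    hermInt hμ (dunkl μ f * g) + hermInt hμ (f * dunkl μ g) = 2 * hermInt hμ (X * f * g) := by
  induction f using Polynomial.induction_on' with
  | add p q hp hq =>
    simp only [map_add, add_mul, mul_add]
    linarith
  | monomial i a =>
  induction g using Polynomial.induction_on' with
  | add p q hp hq =>
    simp only [map_add, mul_add]
    linarith
  | monomial j b =>
    have hi : hermCoeff μ i * hermInt hμ (X ^ (i - 1 + j)) =
        hermCoeff μ i * hermInt hμ (X ^ (i + j - 1)) := by
      rcases i with _ | i
      · rw [hermCoeff_zero, zero_mul, zero_mul]
      · rw [Nat.add_sub_cancel, Nat.succ_add_sub_one]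
    have hj : hermCoeff μ j * hermInt hμ (X ^ (i + (j - 1))) =
        hermCoeff μ j * hermInt hμ (X ^ (i + j - 1)) := by
      rcases j with _ | j
      · rw [hermCoeff_zero, zero_mul, zero_mul]
      · rfl
    have hij : hermCoeff μ (i + j) * hermInt hμ (X ^ (i + j - 1)) =
        (hermCoeff μ i + hermCoeff μ j) * hermInt hμ (X ^ (i + j - 1)) := by
      rcases Nat.even_or_odd (i + j) with h | h
      · rcases Nat.eq_zero_or_pos (i + j) with h0 | h0
        · obtain ⟨rfl, rfl⟩ := Nat.add_eq_zero_iff.1 h0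
          rw [hermCoeff_zero, add_zero, add_zero]
        · rw [hermInt_X_pow_of_odd hμ (Nat.Even.sub_odd h0 h odd_one), mul_zero, mul_zero]
      · rw [hermCoeff_add_of_odd h]
    simp only [dunkl_monomial, smul_mul_assoc, mul_smul_comm, X_mul_monomial, map_smul,
      monomial_mul_monomial, hermInt_monomial, smul_eq_mul]
    rw [add_right_comm, hermInt_X_pow_succ, hij]
    linear_combination 2 * a * b * (hi + hj)

/-- The monic generalized Hermite polynomials. The recursion is by the adjoint of half the Dunkl
operator. -/
def hermPoly (μ : ℝ) : ℕ → ℝ[X]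
  | 0 => 1
  | k + 1 => X * hermPoly μ k - (1 / 2 : ℝ) • dunkl μ (hermPoly μ k)

theorem hermPoly_zero : hermPoly μ 0 = 1 := rfl

theorem hermPoly_succ (k : ℕ) :
    hermPoly μ (k + 1) = X * hermPoly μ k - (1 / 2 : ℝ) • dunkl μ (hermPoly μ k) := rfl

theorem hermPoly_comp_neg_X (k : ℕ) : (hermPoly μ k).comp (-X) = (-1 : ℝ) ^ k • hermPoly μ k := by
  induction k with
  | zero => rw [hermPoly_zero, one_comp, pow_zero, one_smul]
  | succ k ih =>
    have h : (dunkl μ (hermPoly μ k)).comp (-X) = -((-1 : ℝ) ^ k • dunkl μ (hermPoly μ k)) := by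
      rw [← map_smul, ← ih, dunkl_comp_neg_X, neg_neg]
    rw [hermPoly_succ, sub_comp, mul_comp, X_comp, smul_comp, ih, h, pow_succ, neg_mul,
      mul_smul_comm]
    module

theorem dunkl_hermPoly (k : ℕ) :
    dunkl μ (hermPoly μ k) = (2 * hermCoeff μ k) • hermPoly μ (k - 1) := by
  induction k with
  | zero => rw [hermPoly_zero, dunkl_one, hermCoeff_zero, mul_zero, zero_smul]
  | succ k ih =>
    have hX : X * dunkl μ (hermPoly μ k) = (2 * hermCoeff μ k) • hermPoly μ k +
        (1 / 2 : ℝ) • dunkl μ (dunkl μ (hermPoly μ k)) := by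
      rw [ih]
      rcases k with _ | k
      · rw [hermCoeff_zero, mul_zero, zero_smul, map_zero, mul_zero, smul_zero, add_zero]
      · rw [Nat.add_sub_cancel, hermPoly_succ, map_smul, mul_smul_comm]
        module
    rw [hermPoly_succ, map_sub, map_smul, dunkl_X_mul, hX, hermPoly_comp_neg_X, hermCoeff_succ,
      Nat.add_sub_cancel]
    module

/-- For `k = 0` the last term vanishes, although `k - 1` is truncated. -/
theorem X_mul_hermPoly (k : ℕ) :
    X * hermPoly μ k = hermPoly μ (k + 1) + hermCoeff μ k • hermPoly μ (k - 1) := by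
  rw [hermPoly_succ, dunkl_hermPoly]
  module

theorem isMonicOfDegree_hermPoly (k : ℕ) : IsMonicOfDegree (hermPoly μ k) k := by
  induction k using Nat.strong_induction_on with
  | _ k ih =>
  rcases k with _ | k
  · exact isMonicOfDegree_zero_iff.2 hermPoly_zero
  · have hlt : (hermCoeff μ k • hermPoly μ (k - 1)).natDegree < 1 + k := by
      refine (natDegree_smul_le _ _).trans_lt ?_
      rw [(ih (k - 1) (by omega)).natDegree_eq]
      omega
    rw [eq_sub_of_add_eq (X_mul_hermPoly k).symm, add_comm]
    exact ((isMonicOfDegree_X ℝ).mul (ih k k.lt_succ_self)).sub hlt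

/-- The squared norm of `hermPoly μ k` in `L²` of the weight. -/
def hermNormSq (hμ : 0 ≤ μ) (k : ℕ) : ℝ := hermInt hμ (hermPoly μ k * hermPoly μ k)

theorem hermInt_hermPoly_succ_mul (hμ : 0 ≤ μ) (k : ℕ) (g : ℝ[X]) :
    hermInt hμ (hermPoly μ (k + 1) * g) = 1 / 2 * hermInt hμ (hermPoly μ k * dunkl μ g) := by
  have h := hermInt_dunkl_mul_add hμ (hermPoly μ k) g
  rw [hermPoly_succ, sub_mul, map_sub, smul_mul_assoc, map_smul, smul_eq_mul]
  linarith

theorem hermInt_hermPoly_succ_mul_hermPoly (hμ : 0 ≤ μ) (k l : ℕ) :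
    hermInt hμ (hermPoly μ (k + 1) * hermPoly μ l) =
      hermCoeff μ l * hermInt hμ (hermPoly μ k * hermPoly μ (l - 1)) := by
  rw [hermInt_hermPoly_succ_mul, dunkl_hermPoly, mul_smul_comm, map_smul, smul_eq_mul]
  ring

theorem hermInt_hermPoly_mul_of_lt (hμ : 0 ≤ μ) {k l : ℕ} (h : l < k) :
    hermInt hμ (hermPoly μ k * hermPoly μ l) = 0 := by
  induction l generalizing k with
  | zero =>
    obtain ⟨k, rfl⟩ := Nat.exists_eq_succ_of_ne_zero h.ne'
    rw [hermInt_hermPoly_succ_mul_hermPoly, hermCoeff_zero, zero_mul]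
  | succ l ih =>
    obtain ⟨k, rfl⟩ := Nat.exists_eq_succ_of_ne_zero (Nat.ne_zero_of_lt h)
    rw [hermInt_hermPoly_succ_mul_hermPoly, Nat.add_sub_cancel, ih (Nat.lt_of_succ_lt_succ h),
      mul_zero]

theorem hermNormSq_succ (hμ : 0 ≤ μ) (k : ℕ) :
    hermNormSq hμ (k + 1) = hermCoeff μ (k + 1) * hermNormSq hμ k :=
  hermInt_hermPoly_succ_mul_hermPoly hμ k (k + 1)

theorem hermNormSq_pos (hμ : 0 ≤ μ) (k : ℕ) : 0 < hermNormSq hμ k := by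
  induction k with
  | zero =>
    rw [hermNormSq, hermPoly_zero, mul_one, ← pow_zero X, hermInt_X_pow_of_even hμ Even.zero]
    exact Real.Gamma_pos_of_pos (by positivity)
  | succ k ih =>
    rw [hermNormSq_succ]
    exact mul_pos (hermCoeff_succ_pos hμ k) ih

/-- The orthonormal generalized Hermite polynomials. -/
def hermOrth (hμ : 0 ≤ μ) (k : ℕ) : ℝ[X] := (√(hermNormSq hμ k))⁻¹ • hermPoly μ k

theorem hermInt_hermOrth_mul (hμ : 0 ≤ μ) (k l : ℕ) :
    hermInt hμ (hermOrth hμ k * hermOrth hμ l) = if k = l then 1 else 0 := by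
  rw [hermOrth, hermOrth, smul_mul_smul_comm, map_smul, smul_eq_mul]
  rcases lt_trichotomy k l with h | rfl | h
  · rw [mul_comm (hermPoly μ k), hermInt_hermPoly_mul_of_lt hμ h, mul_zero, if_neg h.ne]
  · rw [if_pos rfl, ← mul_inv, Real.mul_self_sqrt (hermNormSq_pos hμ k).le]
    exact inv_mul_cancel₀ (hermNormSq_pos hμ k).ne'
  · rw [hermInt_hermPoly_mul_of_lt hμ h, mul_zero, if_neg h.ne']

theorem eval_neg_hermOrth (hμ : 0 ≤ μ) (k : ℕ) (x : ℝ) :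
    (hermOrth hμ k).eval (-x) = (-1) ^ k * (hermOrth hμ k).eval x := by
  have h := congrArg (eval x) (hermPoly_comp_neg_X (μ := μ) k)
  rw [eval_comp, eval_neg, eval_X, eval_smul, smul_eq_mul] at h
  rw [hermOrth, eval_smul, eval_smul, h, smul_eq_mul, smul_eq_mul, mul_left_comm]

theorem sqrt_hermNormSq_succ (hμ : 0 ≤ μ) (k : ℕ) :
    √(hermNormSq hμ (k + 1)) = √(hermCoeff μ (k + 1)) * √(hermNormSq hμ k) := by
  rw [hermNormSq_succ, Real.sqrt_mul (hermCoeff_nonneg hμ _)]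

theorem inv_sqrt_smul_hermPoly_succ (hμ : 0 ≤ μ) (k : ℕ) :
    (√(hermNormSq hμ k))⁻¹ • hermPoly μ (k + 1) =
      √(hermCoeff μ (k + 1)) • hermOrth hμ (k + 1) := by
  rw [hermOrth, smul_smul, sqrt_hermNormSq_succ, mul_inv,
    mul_inv_cancel_left₀ (Real.sqrt_pos.2 (hermCoeff_succ_pos hμ k)).ne']

theorem inv_sqrt_smul_hermPoly_pred (hμ : 0 ≤ μ) (k : ℕ) :
    (√(hermNormSq hμ k))⁻¹ • hermCoeff μ k • hermPoly μ (k - 1) =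
      √(hermCoeff μ k) • hermOrth hμ (k - 1) := by
  rcases k with _ | k
  · rw [hermCoeff_zero, zero_smul, smul_zero, Real.sqrt_zero, zero_smul]
  · rw [hermOrth, smul_smul, smul_smul, sqrt_hermNormSq_succ, Nat.add_sub_cancel, mul_inv,
      mul_right_comm, inv_mul_eq_div, Real.div_sqrt]

/-- For `k = 0` the last term vanishes, although `k - 1` is truncated. -/
theorem X_mul_hermOrth (hμ : 0 ≤ μ) (k : ℕ) :
    X * hermOrth hμ k = √(hermCoeff μ (k + 1)) • hermOrth hμ (k + 1) +
      √(hermCoeff μ k) • hermOrth hμ (k - 1) := by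
  rw [← inv_sqrt_smul_hermPoly_succ, ← inv_sqrt_smul_hermPoly_pred, ← smul_add, ← X_mul_hermPoly,
    hermOrth, mul_smul_comm]

/-- The matrix entry between `hermOrth hμ k` and `hermOrth hμ (k - 2)` of multiplication by `x ^ 2`.
It vanishes for `k < 2`, where the subtraction is truncated. -/
def hermHop (μ : ℝ) (k : ℕ) : ℝ := √(hermCoeff μ k * hermCoeff μ (k - 1))

theorem X_sq_mul_hermOrth (hμ : 0 ≤ μ) (k : ℕ) :
    X ^ 2 * hermOrth hμ k = hermHop μ (k + 2) • hermOrth hμ (k + 2) +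
      (k + 1 / 2 + μ) • hermOrth hμ k + hermHop μ k • hermOrth hμ (k - 2) := by
  have hnn := hermCoeff_nonneg hμ
  have hup : X * hermOrth hμ (k + 1) = √(hermCoeff μ (k + 2)) • hermOrth hμ (k + 2) +
      √(hermCoeff μ (k + 1)) • hermOrth hμ k := X_mul_hermOrth hμ (k + 1)
  have hdown : √(hermCoeff μ k) • (X * hermOrth hμ (k - 1)) =
      hermCoeff μ k • hermOrth hμ k + hermHop μ k • hermOrth hμ (k - 2) := by
    rcases k with _ | k
    · simp only [hermHop, hermCoeff_zero, zero_mul, Real.sqrt_zero, zero_smul, add_zero]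
    · rw [Nat.add_sub_cancel, X_mul_hermOrth, smul_add, smul_smul, smul_smul,
        Real.mul_self_sqrt (hnn _), ← Real.sqrt_mul (hnn _)]
      rfl
  rw [sq, mul_assoc, X_mul_hermOrth, mul_add, mul_smul_comm, mul_smul_comm, hdown, hup, smul_add,
    smul_smul, smul_smul, Real.mul_self_sqrt (hnn _), ← Real.sqrt_mul (hnn _),
    ← hermCoeff_succ_add, mul_comm (hermCoeff μ (k + 1))]
  change hermHop μ (k + 2) • _ + _ + _ = _
  module

end Hermite

/-! ### Determinantal densities -/

section Determinantal

variable {ι α : Type*} [Fintype ι] [DecidableEq ι]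

/-- The (unnormalized) Slater determinant `det (φᵢ (yⱼ))` of a family of functions `φ` at a family
of points `y`. -/
def slaterDet (φ : ι → α → ℝ) (y : ι → α) : ℝ := (Matrix.of fun i j => φ i (y j)).det

theorem slaterDet_eq_sum (φ : ι → α → ℝ) (y : ι → α) :
    slaterDet φ y = ∑ σ : Equiv.Perm ι, (Equiv.Perm.sign σ : ℤ) * ∏ j, φ (σ j) (y j) :=
  Matrix.det_apply' _

theorem slaterDet_mul_prod (φ ψ : ι → α → ℝ) (y : ι → α) :
    slaterDet φ y * ∏ j, ψ j (y j) =
      ∑ σ : Equiv.Perm ι, (Equiv.Perm.sign σ : ℤ) * ∏ j, φ (σ j) (y j) * ψ j (y j) := by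
  simp only [slaterDet_eq_sum, Finset.sum_mul, mul_assoc, Finset.prod_mul_distrib]

theorem prod_mul_slaterDet_sq (g φ : ι → α → ℝ) (y : ι → α) :
    (∏ j, g j (y j)) * slaterDet φ y ^ 2 = ∑ τ : Equiv.Perm ι, (Equiv.Perm.sign τ : ℤ) *
      (slaterDet φ y * ∏ j, g j (y j) * φ (τ j) (y j)) := by
  rw [sq]
  nth_rw 2 [slaterDet_eq_sum]
  simp only [Finset.mul_sum, Finset.prod_mul_distrib]
  exact Finset.sum_congr rfl fun τ _ => by ring

theorem det_updateCol_one_submatrix (v : ι → ℝ) (τ : Equiv.Perm ι) (i : ι) :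
    (((1 : Matrix ι ι ℝ).updateCol (τ i) v).submatrix id τ).det =
      (Equiv.Perm.sign τ : ℤ) * v (τ i) := by
  rw [Matrix.det_permute', ← Matrix.cramer_apply, Matrix.cramer_one, Module.End.one_apply]

theorem sign_mul_sign_mul (τ : Equiv.Perm ι) (r : ℝ) :
    ((Equiv.Perm.sign τ : ℤ) : ℝ) * ((Equiv.Perm.sign τ : ℤ) * r) = r := by
  rw [← mul_assoc, ← Int.cast_mul, ← Units.val_mul, Int.units_mul_self, Units.val_one,
    Int.cast_one, one_mul]

theorem sum_sum_perm_apply {M : Type*} [AddCommMonoid M] (F : ι → M) :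
    ∑ i, ∑ τ : Equiv.Perm ι, F (τ i) = (Fintype.card ι).factorial • ∑ k, F k := by
  rw [Finset.sum_comm]
  simp only [Equiv.sum_comp, Finset.sum_const, Finset.card_univ, Fintype.card_perm]

variable [MeasurableSpace α]

theorem measurable_slaterDet {φ : ι → α → ℝ} (hφ : ∀ i, Measurable (φ i)) :
    Measurable (slaterDet φ) := by
  have : slaterDet φ = fun y =>
      ∑ σ : Equiv.Perm ι, (Equiv.Perm.sign σ : ℤ) * ∏ j, φ (σ j) (y j) :=
    funext (slaterDet_eq_sum φ)
  rw [this]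
  fun_prop

variable {ρ : Measure α} [SigmaFinite ρ] {φ ψ g : ι → α → ℝ}

theorem integrable_slaterDet_mul_prod (h : ∀ i j, Integrable (fun x => φ i x * ψ j x) ρ) :
    Integrable (fun y => slaterDet φ y * ∏ j, ψ j (y j)) (Measure.pi fun _ => ρ) := by
  simp only [slaterDet_mul_prod]
  exact integrable_finsetSum _ fun σ _ =>
    (Integrable.fintype_prod fun j => h (σ j) j).const_mul _

theorem integral_slaterDet_mul_prod (h : ∀ i j, Integrable (fun x => φ i x * ψ j x) ρ) :
    ∫ y, slaterDet φ y * ∏ j, ψ j (y j) ∂(Measure.pi fun _ => ρ) =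
      (Matrix.of fun i j => ∫ x, φ i x * ψ j x ∂ρ).det := by
  simp only [slaterDet_mul_prod, Matrix.det_apply', Matrix.of_apply]
  rw [integral_finsetSum _ fun σ _ =>
    (Integrable.fintype_prod fun j => h (σ j) j).const_mul _]
  refine Finset.sum_congr rfl fun σ _ => ?_
  rw [integral_const_mul, integral_fintype_prod_eq_prod (fun j x => φ (σ j) x * ψ j x)]

theorem integrable_prod_mul_slaterDet_sq
    (h : ∀ i j k, Integrable (fun x => φ i x * (g j x * φ k x)) ρ) :
    Integrable (fun y => (∏ j, g j (y j)) * slaterDet φ y ^ 2) (Measure.pi fun _ => ρ) := by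
  simp only [prod_mul_slaterDet_sq]
  exact integrable_finsetSum _ fun τ _ =>
    (integrable_slaterDet_mul_prod fun i j => h i j (τ j)).const_mul _

/-- **Andréief's identity**, with one of the two determinants expanded. -/
theorem integral_prod_mul_slaterDet_sq
    (h : ∀ i j k, Integrable (fun x => φ i x * (g j x * φ k x)) ρ) :
    ∫ y, (∏ j, g j (y j)) * slaterDet φ y ^ 2 ∂(Measure.pi fun _ => ρ) =
      ∑ τ : Equiv.Perm ι, (Equiv.Perm.sign τ : ℤ) *
        (Matrix.of fun i j => ∫ x, φ i x * (g j x * φ (τ j) x) ∂ρ).det := by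
  simp only [prod_mul_slaterDet_sq]
  rw [integral_finsetSum _ fun τ _ =>
    (integrable_slaterDet_mul_prod (ψ := fun j x => g j x * φ (τ j) x)
      fun i j => h i j (τ j)).const_mul _]
  refine Finset.sum_congr rfl fun τ _ => ?_
  rw [integral_const_mul,
    integral_slaterDet_mul_prod (ψ := fun j x => g j x * φ (τ j) x) fun i j => h i j (τ j)]

/-- The measure with density `slaterDet φ ^ 2`. For an orthonormal family `φ` it has total mass
`(card ι)!` and is the unnormalized joint distribution of a determinantal point process. -/
def slaterMeasure (ρ : Measure α) (φ : ι → α → ℝ) : Measure (ι → α) :=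
  (Measure.pi fun _ => ρ).withDensity fun y => ENNReal.ofReal (slaterDet φ y ^ 2)

section Orthonormal

variable (hint : ∀ i j, Integrable (fun x => φ i x * φ j x) ρ)
  (horth : ∀ i j, ∫ x, φ i x * φ j x ∂ρ = if i = j then 1 else 0)

include hint

theorem integrable_slaterDet_sq :
    Integrable (fun y => slaterDet φ y ^ 2) (Measure.pi fun _ => ρ) := by
  simpa only [Finset.prod_const_one, one_mul] using
    integrable_prod_mul_slaterDet_sq (g := fun _ _ => 1) (φ := φ) (ρ := ρ)
      fun i _ k => by simpa only [one_mul] using hint i k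

include horth

theorem integral_slaterDet_sq :
    ∫ y, slaterDet φ y ^ 2 ∂(Measure.pi fun _ => ρ) = (Fintype.card ι).factorial := by
  have h := integral_prod_mul_slaterDet_sq (g := fun _ _ => 1) (φ := φ) (ρ := ρ)
    fun i _ k => by simpa only [one_mul] using hint i k
  have hgram (τ : Equiv.Perm ι) :
      (Matrix.of fun i j => ∫ x, φ i x * φ (τ j) x ∂ρ) = (1 : Matrix ι ι ℝ).submatrix id τ := by
    ext i j
    exact horth i (τ j)
  simp only [Finset.prod_const_one, one_mul, hgram, Matrix.det_permute', Matrix.det_one,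
    sign_mul_sign_mul, Finset.sum_const, Finset.card_univ, Fintype.card_perm, nsmul_one] at h
  exact h

theorem setIntegral_slaterDet_sq {s : Set α} (hs : MeasurableSet s) (i : ι) :
    ∫ y in (fun y => y i) ⁻¹' s, slaterDet φ y ^ 2 ∂(Measure.pi fun _ => ρ) =
      ∑ τ : Equiv.Perm ι, ∫ x in s, φ (τ i) x ^ 2 ∂ρ := by
  let g (j : ι) (x : α) : ℝ := if j = i then s.indicator 1 x else 1
  have hind (k l : ι) : (fun x => φ k x * (s.indicator 1 x * φ l x)) =
      s.indicator fun x => φ k x * φ l x := by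
    ext x
    by_cases hx : x ∈ s <;> simp [hx]
  have hg (k j l) : Integrable (fun x => φ k x * (g j x * φ l x)) ρ := by
    by_cases hj : j = i
    · simpa only [g, hj, if_true, hind] using (hint k l).indicator hs
    · simpa [g, hj] using hint k l
  have hgram (τ : Equiv.Perm ι) : (Matrix.of fun k j => ∫ x, φ k x * (g j x * φ (τ j) x) ∂ρ) =
      ((1 : Matrix ι ι ℝ).updateCol (τ i)
        fun k => ∫ x in s, φ k x * φ (τ i) x ∂ρ).submatrix id τ := by
    ext k j
    by_cases hj : j = i
    · simp [g, hj, hind, integral_indicator hs]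
    · simp [g, hj, horth, Matrix.one_apply]
  have h := integral_prod_mul_slaterDet_sq hg
  simp only [hgram, det_updateCol_one_submatrix, sign_mul_sign_mul, ← sq] at h
  rw [← h, ← integral_indicator (measurable_pi_apply i hs)]
  congr 1 with y
  by_cases hy : y i ∈ s <;> simp [g, hy]

theorem slaterMeasure_univ : slaterMeasure ρ φ Set.univ = (Fintype.card ι).factorial := by
  rw [slaterMeasure, withDensity_apply _ MeasurableSet.univ, Measure.restrict_univ,
    ← ofReal_integral_eq_lintegral_ofReal (integrable_slaterDet_sq hint)
      (.of_forall fun y => sq_nonneg _), integral_slaterDet_sq hint horth, ENNReal.ofReal_natCast]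

theorem sum_map_eval_slaterMeasure :
    ∑ i, (slaterMeasure ρ φ).map (fun y => y i) =
      ((Fintype.card ι).factorial : ℝ≥0∞) •
        ∑ k, ρ.withDensity fun x => ENNReal.ofReal (φ k x ^ 2) := by
  have hsq (k : ι) : Integrable (fun x => φ k x ^ 2) ρ := by simpa only [sq] using hint k k
  ext s hs
  have hmap (i : ι) : (slaterMeasure ρ φ).map (fun y => y i) s =
      ∑ τ : Equiv.Perm ι, ENNReal.ofReal (∫ x in s, φ (τ i) x ^ 2 ∂ρ) := by
    rw [Measure.map_apply (measurable_pi_apply i) hs, slaterMeasure,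
      withDensity_apply _ (measurable_pi_apply i hs),
      ← ofReal_integral_eq_lintegral_ofReal (integrable_slaterDet_sq hint).integrableOn
        (.of_forall fun y => sq_nonneg _),
      ← ENNReal.ofReal_sum_of_nonneg fun τ _ => integral_nonneg fun x => sq_nonneg _]
    exact congrArg _ (setIntegral_slaterDet_sq hint horth hs i)
  simp only [Measure.smul_apply, Measure.finsetSum_apply, hmap, smul_eq_mul]
  rw [sum_sum_perm_apply fun k => ENNReal.ofReal (∫ x in s, φ k x ^ 2 ∂ρ), nsmul_eq_mul]
  congr 2 with k
  rw [withDensity_apply _ hs, ofReal_integral_eq_lintegral_ofReal (hsq k).integrableOn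
    (.of_forall fun x => sq_nonneg _)]

end Orthonormal

end Determinantal

/-! ### The mean eigenvalue distribution -/

section MeanDensity

open Polynomial

variable {n : ℕ} {μ : ℝ}

/-- The Hermite function `φₖ √w`, for the orthonormal polynomial `φₖ` and the weight `w`. -/
def hermFun (hμ : 0 ≤ μ) (k : ℕ) (x : ℝ) : ℝ := (hermOrth hμ k).eval x * √(hermWeight μ x)

theorem measurable_hermFun (hμ : 0 ≤ μ) (k : ℕ) : Measurable (hermFun hμ k) :=
  (hermOrth hμ k).continuous.measurable.mul (measurable_hermWeight μ).sqrt

theorem hermFun_mul (hμ : 0 ≤ μ) (k l : ℕ) (x : ℝ) :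
    hermFun hμ k x * hermFun hμ l x = (hermOrth hμ k * hermOrth hμ l).eval x * hermWeight μ x := by
  rw [hermFun, hermFun, mul_mul_mul_comm, Real.mul_self_sqrt (hermWeight_nonneg μ x), eval_mul]

theorem integrable_hermFun_mul (hμ : 0 ≤ μ) (k l : ℕ) :
    Integrable fun x => hermFun hμ k x * hermFun hμ l x := by
  simpa only [hermFun_mul] using integrable_eval_mul_hermWeight hμ _

theorem integral_hermFun_mul (hμ : 0 ≤ μ) (k l : ℕ) :
    ∫ x, hermFun hμ k x * hermFun hμ l x = if k = l then 1 else 0 := by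
  simp only [hermFun_mul, ← hermInt_apply hμ, hermInt_hermOrth_mul]

/-- The probability measure with density `φₖ ^ 2 w`, for the orthonormal polynomial `φₖ` and the
weight `w`. -/
def hermMeasure (hμ : 0 ≤ μ) (k : ℕ) : Measure ℝ :=
  volume.withDensity fun x => ENNReal.ofReal (hermFun hμ k x ^ 2)

instance isProbabilityMeasure_hermMeasure (hμ : 0 ≤ μ) (k : ℕ) :
    IsProbabilityMeasure (hermMeasure hμ k) := by
  refine ⟨?_⟩
  simp only [hermMeasure, sq]
  rw [withDensity_apply _ MeasurableSet.univ, Measure.restrict_univ,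
    ← ofReal_integral_eq_lintegral_ofReal (integrable_hermFun_mul hμ k k)
      (.of_forall fun x => mul_self_nonneg _),
    integral_hermFun_mul, if_pos rfl, ENNReal.ofReal_one]

/-- The joint eigenvalue distribution of `ensemble n μ`, with total mass `n!`. -/
def hermJoint (hμ : 0 ≤ μ) (n : ℕ) : Measure (Fin n → ℝ) :=
  slaterMeasure volume fun i : Fin n => hermFun hμ i

theorem hermJoint_univ (hμ : 0 ≤ μ) : hermJoint hμ n Set.univ = n.factorial := by
  have h := slaterMeasure_univ (φ := fun i : Fin n => hermFun hμ i)
    (fun i j => integrable_hermFun_mul hμ i j)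
    (fun i j => by simp only [integral_hermFun_mul, Fin.ext_iff])
  rwa [Fintype.card_fin] at h

theorem sum_map_eval_hermJoint (hμ : 0 ≤ μ) :
    ∑ i : Fin n, (hermJoint hμ n).map (fun y => y i) =
      (n.factorial : ℝ≥0∞) • ∑ k : Fin n, hermMeasure hμ k := by
  have h := sum_map_eval_slaterMeasure (φ := fun i : Fin n => hermFun hμ i)
    (fun i j => integrable_hermFun_mul hμ i j)
    (fun i j => by simp only [integral_hermFun_mul, Fin.ext_iff])
  rwa [Fintype.card_fin] at h

theorem det_vandermonde_eq_slaterDet (μ : ℝ) (y : Fin n → ℝ) :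
    (Matrix.vandermonde y).det =
      slaterDet (fun (i : Fin n) x => (hermPoly μ i).eval x) y := by
  rw [Matrix.det_eval_matrixOfPolynomials_eq_det_vandermonde y (fun i => hermPoly μ i)
    (fun i => (isMonicOfDegree_hermPoly i).natDegree_eq)
    (fun i => (isMonicOfDegree_hermPoly i).monic), ← Matrix.det_transpose]
  rfl

theorem slaterDet_hermFun (hμ : 0 ≤ μ) (y : Fin n → ℝ) :
    slaterDet (fun i : Fin n => hermFun hμ i) y =
      (∏ j, √(hermWeight μ (y j))) *
        ((∏ i : Fin n, (√(hermNormSq hμ i))⁻¹) * (Matrix.vandermonde y).det) := by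
  rw [det_vandermonde_eq_slaterDet μ, slaterDet, slaterDet, ← Matrix.det_mul_column,
    ← Matrix.det_mul_row]
  congr 1 with i j
  simp only [hermFun, hermOrth, Matrix.of_apply, eval_smul, smul_eq_mul, mul_comm]

theorem prod_rpow_mul_eigWeight (hμ : 0 ≤ μ) (y : Fin n → ℝ) :
    (∏ i, |y i| ^ (2 * μ)) * eigWeight y =
      (∏ i : Fin n, hermNormSq hμ i) * slaterDet (fun i : Fin n => hermFun hμ i) y ^ 2 := by
  have hnorm : (∏ i : Fin n, hermNormSq hμ i) ≠ 0 :=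
    Finset.prod_ne_zero_iff.2 fun i _ => (hermNormSq_pos hμ i).ne'
  have hweight : ∏ i, hermWeight μ (y i) =
      (∏ i, |y i| ^ (2 * μ)) * Real.exp (-∑ i, y i ^ 2) := by
    simp only [hermWeight, Finset.prod_mul_distrib, ← Real.exp_sum, Finset.sum_neg_distrib]
  simp only [slaterDet_hermFun, mul_pow, ← Finset.prod_pow, inv_pow,
    Real.sq_sqrt (hermWeight_nonneg _ _), Real.sq_sqrt (hermNormSq_pos hμ _).le,
    Finset.prod_inv_distrib]
  rw [hweight, eigWeight]
  field_simp

theorem measurable_prod_abs_rpow :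
    Measurable fun y : Fin n → ℝ => ENNReal.ofReal (∏ i, |y i| ^ (2 * μ)) := by
  fun_prop

theorem withDensity_eigLaw (hμ : 0 ≤ μ) :
    (eigLaw n).withDensity (fun y => ENNReal.ofReal (∏ i, |y i| ^ (2 * μ))) =
      ENNReal.ofReal (∏ i : Fin n, hermNormSq hμ i) • hermJoint hμ n := by
  have hdet : Measurable fun y : Fin n → ℝ =>
      ENNReal.ofReal (slaterDet (fun i : Fin n => hermFun hμ i) y ^ 2) :=
    ((measurable_slaterDet fun i : Fin n => measurable_hermFun hμ i).pow_const 2).ennreal_ofReal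
  rw [eigLaw, ← withDensity_mul _ continuous_eigWeight.measurable.ennreal_ofReal
    measurable_prod_abs_rpow, hermJoint, slaterMeasure, ← withDensity_smul _ hdet]
  congr 1 with y
  rw [Pi.mul_apply, Pi.smul_apply, smul_eq_mul, mul_comm,
    ← ENNReal.ofReal_mul (Finset.prod_nonneg fun i _ => by positivity),
    ← ENNReal.ofReal_mul (Finset.prod_nonneg fun i _ => (hermNormSq_pos hμ _).le),
    prod_rpow_mul_eigWeight hμ]

theorem weight_eq (x : Herm n) :
    weight n μ x = (∏ i, |eig x i| ^ (2 * μ)) * Real.exp (-‖x‖ ^ 2) := by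
  rw [weight, norm_det_eq_prod_eig, Herm.norm_sq,
    Real.finsetProd_rpow _ _ (fun i _ => abs_nonneg _)]

theorem withDensity_weight :
    volume.withDensity (fun x => ENNReal.ofReal (weight n μ x)) =
      (gue n).withDensity (fun x => ENNReal.ofReal (∏ i, |eig x i| ^ (2 * μ))) := by
  rw [gue, ← withDensity_mul _ (by fun_prop)
    (by exact measurable_prod_abs_rpow.comp measurable_eig)]
  congr 1 with x
  rw [weight_eq, mul_comm, ENNReal.ofReal_mul (Real.exp_nonneg _)]
  rfl

theorem lintegral_eig_weight (hμ : 0 ≤ μ) {g : (Fin n → ℝ) → ℝ≥0∞} (hg : Measurable g)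
    (hsymm : ∀ (τ : Equiv.Perm (Fin n)) y, g (y ∘ τ) = g y) :
    ∫⁻ x, g (eig x) ∂volume.withDensity (fun x => ENNReal.ofReal (weight n μ x)) =
      ENNReal.ofReal (weylConst n) * ENNReal.ofReal (∏ i : Fin n, hermNormSq hμ i) *
        ∫⁻ y, g y ∂hermJoint hμ n := by
  have hprod : Measurable fun y : Fin n → ℝ => ENNReal.ofReal (∏ i, |y i| ^ (2 * μ)) :=
    measurable_prod_abs_rpow
  have hsymm' (τ : Equiv.Perm (Fin n)) (y : Fin n → ℝ) :
      ENNReal.ofReal (∏ i, |(y ∘ τ) i| ^ (2 * μ)) * g (y ∘ τ) =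
        ENNReal.ofReal (∏ i, |y i| ^ (2 * μ)) * g y := by
    rw [hsymm]
    congr 2
    exact Equiv.prod_comp τ fun i => |y i| ^ (2 * μ)
  rw [withDensity_weight, lintegral_withDensity_eq_lintegral_mul _
    (by exact hprod.comp measurable_eig) (by exact hg.comp measurable_eig)]
  refine (lintegral_eig_gue (hprod.mul hg) hsymm').trans ?_
  rw [← lintegral_withDensity_eq_lintegral_mul _ hprod hg, withDensity_eigLaw hμ,
    lintegral_smul_measure, smul_eq_mul, mul_assoc]

theorem lintegral_weight (hμ : 0 ≤ μ) :
    ∫⁻ x, ENNReal.ofReal (weight n μ x) =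
      ENNReal.ofReal (weylConst n) * ENNReal.ofReal (∏ i : Fin n, hermNormSq hμ i) *
        n.factorial := by
  have h := lintegral_eig_weight (n := n) hμ (g := 1) measurable_const fun _ _ => rfl
  simpa [hermJoint_univ] using h

theorem lintegral_eig_ensemble (hμ : 0 ≤ μ) {g : (Fin n → ℝ) → ℝ≥0∞} (hg : Measurable g)
    (hsymm : ∀ (τ : Equiv.Perm (Fin n)) y, g (y ∘ τ) = g y) :
    ∫⁻ x, g (eig x) ∂ensemble n μ = (n.factorial : ℝ≥0∞)⁻¹ * ∫⁻ y, g y ∂hermJoint hμ n := by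
  have hconst : ENNReal.ofReal (weylConst n) * ENNReal.ofReal (∏ i : Fin n, hermNormSq hμ i) ≠ 0 :=
    mul_ne_zero (ENNReal.ofReal_pos.2 weylConst_pos).ne'
      (ENNReal.ofReal_pos.2 (Finset.prod_pos fun (i : Fin n) _ => hermNormSq_pos hμ i)).ne'
  have htop : ENNReal.ofReal (weylConst n) * ENNReal.ofReal (∏ i : Fin n, hermNormSq hμ i) ≠ ∞ :=
    ENNReal.mul_ne_top ENNReal.ofReal_ne_top ENNReal.ofReal_ne_top
  rw [ensemble, lintegral_smul_measure, smul_eq_mul, lintegral_weight hμ,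
    lintegral_eig_weight hμ hg hsymm, ENNReal.mul_inv (.inl hconst) (.inl htop), ← mul_assoc,
    mul_right_comm _ _ (_ * _), ENNReal.inv_mul_cancel hconst htop, one_mul]

theorem isProbabilityMeasure_ensemble (n : ℕ) (hμ : 0 ≤ μ) :
    IsProbabilityMeasure (ensemble n μ) := by
  refine ⟨?_⟩
  have h := lintegral_eig_ensemble (n := n) hμ (g := 1) measurable_const fun _ _ => rfl
  simp only [Pi.one_apply, lintegral_one, hermJoint_univ] at h
  rw [h, ENNReal.inv_mul_cancel (Nat.cast_ne_zero.2 n.factorial_ne_zero)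
    (ENNReal.natCast_ne_top _)]

theorem sum_map_apply {Ω : Type*} [MeasurableSpace Ω] {ν : Measure Ω} {X : Ω → Fin n → ℝ}
    (hX : Measurable X) {s : Set ℝ} (hs : MeasurableSet s) :
    (∑ i, ν.map fun ω => X ω i) s = ∫⁻ ω, ∑ i, s.indicator 1 (X ω i) ∂ν := by
  have hXi (i : Fin n) : Measurable fun ω => X ω i := (measurable_pi_apply i).comp hX
  have hind (i : Fin n) : Measurable fun ω => s.indicator (1 : ℝ → ℝ≥0∞) (X ω i) :=
    (measurable_one.indicator hs).comp (hXi i)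
  rw [Measure.finsetSum_apply, lintegral_finsetSum _ fun i _ => hind i]
  refine Finset.sum_congr rfl fun i _ => ?_
  rw [← lintegral_map (measurable_one.indicator hs) (hXi i), lintegral_indicator_one hs]

theorem meanEigenvalueDist_eq (hμ : 0 ≤ μ) :
    meanEigenvalueDist n μ = (n : ℝ≥0∞)⁻¹ • ∑ k : Fin n, hermMeasure hμ k := by
  rw [meanEigenvalueDist]
  congr 1
  ext s hs
  have hcount : Measurable fun y : Fin n → ℝ => ∑ i, s.indicator (1 : ℝ → ℝ≥0∞) (y i) :=
    Finset.measurable_sum _ fun i _ =>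
      (measurable_one.indicator hs).comp (measurable_pi_apply i)
  calc (∑ i, (ensemble n μ).map fun x => eig x i) s
      = ∫⁻ x, ∑ i, s.indicator 1 (eig x i) ∂ensemble n μ := sum_map_apply measurable_eig hs
    _ = (n.factorial : ℝ≥0∞)⁻¹ * ∫⁻ y, ∑ i, s.indicator 1 (y i) ∂hermJoint hμ n :=
        lintegral_eig_ensemble hμ hcount fun τ y => Equiv.sum_comp τ fun i => s.indicator 1 (y i)
    _ = (n.factorial : ℝ≥0∞)⁻¹ * (∑ i, (hermJoint hμ n).map fun y => y i) s := by
        rw [sum_map_apply measurable_id' hs]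
    _ = (∑ k : Fin n, hermMeasure hμ k) s := by
        rw [sum_map_eval_hermJoint, Measure.smul_apply, smul_eq_mul, ← mul_assoc,
          ENNReal.inv_mul_cancel (Nat.cast_ne_zero.2 n.factorial_ne_zero)
            (ENNReal.natCast_ne_top _), one_mul]

theorem isProbabilityMeasure_meanEigenvalueDist (hμ : 0 ≤ μ) (hn : 1 ≤ n) :
    IsProbabilityMeasure (meanEigenvalueDist n μ) := by
  refine ⟨?_⟩
  rw [meanEigenvalueDist_eq hμ, Measure.smul_apply, Measure.finsetSum_apply]
  simp only [measure_univ, Finset.sum_const, Finset.card_univ, Fintype.card_fin, nsmul_eq_mul,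
    mul_one, smul_eq_mul]
  exact ENNReal.inv_mul_cancel (Nat.cast_ne_zero.2 (by omega)) (ENNReal.natCast_ne_top n)

end MeanDensity

/-! ### Asymptotics of the even moments -/

section Asymptotics

open Polynomial

section Entries

variable {μ : ℝ}

theorem hermCoeff_mul_pred_le (hμ : 0 ≤ μ) (k : ℕ) :
    hermCoeff μ k * hermCoeff μ (k - 1) ≤ k / 2 * (k / 2 + μ) := by
  rcases k with _ | j
  · simp [hermCoeff_zero]
  rw [Nat.add_sub_cancel]
  rcases Nat.even_or_odd j with h | h
  · rw [hermCoeff_of_odd h.add_one, hermCoeff_of_even h]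
    push_cast
    nlinarith [j.cast_nonneg (α := ℝ)]
  · rw [hermCoeff_of_even h.add_one, hermCoeff_of_odd h]
    push_cast
    nlinarith [j.cast_nonneg (α := ℝ)]

theorem le_hermCoeff_mul_pred (hμ : 0 ≤ μ) (k : ℕ) :
    ((k - 1 : ℕ) : ℝ) / 2 * (((k - 1 : ℕ) : ℝ) / 2 + μ) ≤
      hermCoeff μ k * hermCoeff μ (k - 1) := by
  rcases k with _ | j
  · simp [hermCoeff_zero]
  rw [Nat.add_sub_cancel]
  rcases Nat.even_or_odd j with h | h
  · rw [hermCoeff_of_odd h.add_one, hermCoeff_of_even h]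
    push_cast
    nlinarith [j.cast_nonneg (α := ℝ)]
  · rw [hermCoeff_of_even h.add_one, hermCoeff_of_odd h]
    push_cast
    nlinarith [j.cast_nonneg (α := ℝ)]

theorem hermHop_nonneg (μ : ℝ) (k : ℕ) : 0 ≤ hermHop μ k := Real.sqrt_nonneg _

theorem hermHop_le (hμ : 0 ≤ μ) (k : ℕ) : hermHop μ k ≤ k / 2 + μ := by
  refine Real.sqrt_le_iff.2 ⟨by positivity, (hermCoeff_mul_pred_le hμ k).trans ?_⟩
  rw [sq]
  gcongr
  exact le_add_of_nonneg_right hμ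

/-- The matrix entries of multiplication by `x ^ (2 m)` in the orthonormal basis. -/
def momentEntry (hμ : 0 ≤ μ) (m k l : ℕ) : ℝ :=
  hermInt hμ (X ^ (2 * m) * hermOrth hμ k * hermOrth hμ l)

theorem momentEntry_zero (hμ : 0 ≤ μ) (k l : ℕ) :
    momentEntry hμ 0 k l = if k = l then 1 else 0 := by
  rw [momentEntry, mul_zero, pow_zero, one_mul, hermInt_hermOrth_mul]

theorem momentEntry_succ (hμ : 0 ≤ μ) (m k l : ℕ) :
    momentEntry hμ (m + 1) k l = hermHop μ (l + 2) * momentEntry hμ m k (l + 2) +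
      (l + 1 / 2 + μ) * momentEntry hμ m k l + hermHop μ l * momentEntry hμ m k (l - 2) := by
  have : X ^ (2 * (m + 1)) * hermOrth hμ k * hermOrth hμ l =
      X ^ (2 * m) * hermOrth hμ k * (X ^ 2 * hermOrth hμ l) := by ring
  rw [momentEntry, this, X_sq_mul_hermOrth hμ]
  simp only [momentEntry, mul_add, mul_smul_comm, map_add, map_smul, smul_eq_mul]

theorem abs_momentEntry_le (hμ : 0 ≤ μ) (m k l : ℕ) :
    |momentEntry hμ m k l| ≤ (3 * (l + 2 * m + μ)) ^ m := by
  induction m generalizing l with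
  | zero =>
    rw [momentEntry_zero]
    split_ifs <;> simp
  | succ m ih =>
    set B : ℝ := l + 2 * ((m + 1 : ℕ) : ℝ) + μ with hB
    push_cast at hB
    have hentry {l' : ℕ} (hl' : l' ≤ l + 2) : |momentEntry hμ m k l'| ≤ (3 * B) ^ m := by
      have : (l' : ℝ) ≤ l + 2 := by exact_mod_cast hl'
      refine (ih l').trans (pow_le_pow_left₀ (by positivity) ?_ _)
      linarith
    have hhop {l' : ℕ} (hl' : l' ≤ l + 2) : |hermHop μ l'| ≤ B := by
      have : (l' : ℝ) ≤ l + 2 := by exact_mod_cast hl'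
      rw [abs_of_nonneg (hermHop_nonneg μ l')]
      refine (hermHop_le hμ l').trans ?_
      linarith [l'.cast_nonneg (α := ℝ)]
    have hdiag : |(l : ℝ) + 1 / 2 + μ| ≤ B := by
      rw [abs_of_nonneg (by positivity)]
      linarith
    rw [momentEntry_succ hμ m k]
    calc _ ≤ |hermHop μ (l + 2)| * |momentEntry hμ m k (l + 2)| +
          |(l : ℝ) + 1 / 2 + μ| * |momentEntry hμ m k l| +
          |hermHop μ l| * |momentEntry hμ m k (l - 2)| := by
            simp only [← abs_mul]
            exact abs_add_three _ _ _
      _ ≤ B * (3 * B) ^ m + B * (3 * B) ^ m + B * (3 * B) ^ m := by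
            gcongr
            exacts [hhop le_rfl, hentry le_rfl, hentry (by omega), hhop (by omega),
              hentry (by omega)]
      _ = (3 * B) ^ (m + 1) := by ring

end Entries

/-- The Fourier coefficients of `(d + e cos θ) ^ m`. -/
def arcsineCoeff (d e : ℝ) (m : ℕ) (j : ℤ) : ℝ :=
  1 / Real.pi * ∫ θ in (0 : ℝ)..Real.pi, (d + e * Real.cos θ) ^ m * Real.cos (j * θ)

theorem arcsineCoeff_zero (d e : ℝ) (j : ℤ) : arcsineCoeff d e 0 j = if j = 0 then 1 else 0 := by
  simp only [arcsineCoeff, pow_zero, one_mul]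
  split_ifs with h
  · simp [h, Real.pi_ne_zero]
  · rw [intervalIntegral.integral_comp_mul_left _ (Int.cast_ne_zero.2 h), integral_cos]
    simp [Real.sin_int_mul_pi]

theorem arcsineCoeff_succ (d e : ℝ) (m : ℕ) (j : ℤ) :
    arcsineCoeff d e (m + 1) j = e / 2 * arcsineCoeff d e m (j + 1) + d * arcsineCoeff d e m j +
      e / 2 * arcsineCoeff d e m (j - 1) := by
  let f (i : ℤ) (θ : ℝ) : ℝ := (d + e * Real.cos θ) ^ m * Real.cos (i * θ)
  have hf (r : ℝ) (i : ℤ) : IntervalIntegrable (fun θ => r * f i θ) volume 0 Real.pi :=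
    Continuous.intervalIntegrable (by fun_prop) _ _
  have hpoint (θ : ℝ) : (d + e * Real.cos θ) ^ (m + 1) * Real.cos (j * θ) =
      e / 2 * f (j + 1) θ + d * f j θ + e / 2 * f (j - 1) θ := by
    simp only [f, Int.cast_add, Int.cast_sub, Int.cast_one, add_mul, sub_mul, one_mul,
      Real.cos_add, Real.cos_sub]
    ring
  simp only [arcsineCoeff, hpoint]
  rw [intervalIntegral.integral_add ((hf _ _).add (hf _ _)) (hf _ _),
    intervalIntegral.integral_add (hf _ _) (hf _ _)]
  simp only [intervalIntegral.integral_const_mul, f]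
  ring

theorem tendsto_div_of_abs_sub_le {k l : ℕ → ℕ} {C τ : ℝ}
    (hk : Tendsto (fun n => (k n : ℝ) / n) atTop (𝓝 τ))
    (hkl : ∀ᶠ n in atTop, |(k n : ℝ) - l n| ≤ C) :
    Tendsto (fun n => (l n : ℝ) / n) atTop (𝓝 τ) := by
  refine tendsto_of_tendsto_of_dist hk (squeeze_zero' (.of_forall fun n => dist_nonneg) ?_
    (tendsto_const_div_atTop_nhds_zero_nat C))
  filter_upwards [hkl] with n hn
  rw [Real.dist_eq, ← sub_div, abs_div, Nat.abs_cast]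
  gcongr

theorem tendsto_atTop_of_tendsto_div {l : ℕ → ℕ} {τ : ℝ} (hτ : 0 < τ)
    (hl : Tendsto (fun n => (l n : ℝ) / n) atTop (𝓝 τ)) : Tendsto l atTop atTop := by
  refine tendsto_natCast_atTop_iff.1 ((hl.pos_mul_atTop hτ tendsto_natCast_atTop_atTop).congr' ?_)
  filter_upwards [eventually_ne_atTop 0] with n hn
  exact div_mul_cancel₀ _ (Nat.cast_ne_zero.2 hn)

section Limit

variable {μ : ℕ → ℝ} {c τ : ℝ}

theorem tendsto_hermHop (hμ : ∀ n, 0 ≤ μ n)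
    (hlim : Tendsto (fun n : ℕ => μ n / (n : ℝ)) atTop (𝓝 c)) {l : ℕ → ℕ}
    (hl : Tendsto (fun n => (l n : ℝ) / n) atTop (𝓝 τ)) :
    Tendsto (fun n => hermHop (μ n) (l n) / n) atTop (𝓝 (√(τ * (τ + 2 * c)) / 2)) := by
  have hpred : Tendsto (fun n => ((l n - 1 : ℕ) : ℝ) / n) atTop (𝓝 τ) := by
    refine tendsto_div_of_abs_sub_le hl (.of_forall fun n => (?_ : _ ≤ (1 : ℝ)))
    rcases l n with _ | j <;> simp
  have hbound {k : ℕ → ℕ} (hk : Tendsto (fun n => (k n : ℝ) / n) atTop (𝓝 τ)) :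
      Tendsto (fun n => k n / 2 * (k n / 2 + μ n) / (n : ℝ) ^ 2) atTop
        (𝓝 (τ * (τ + 2 * c) / 4)) := by
    have h := (hk.div_const 2).mul ((hk.div_const 2).add hlim)
    rw [show τ / 2 * (τ / 2 + c) = τ * (τ + 2 * c) / 4 by ring] at h
    exact h.congr fun n => by ring
  have hsq : Tendsto (fun n => hermCoeff (μ n) (l n) * hermCoeff (μ n) (l n - 1) / (n : ℝ) ^ 2)
      atTop (𝓝 (τ * (τ + 2 * c) / 4)) := by
    refine tendsto_of_tendsto_of_tendsto_of_le_of_le (hbound hpred) (hbound hl)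
      (fun n => ?_) (fun n => ?_)
    · exact div_le_div_of_nonneg_right (le_hermCoeff_mul_pred (hμ n) _) (by positivity)
    · exact div_le_div_of_nonneg_right (hermCoeff_mul_pred_le (hμ n) _) (by positivity)
  have h4 : √(4 : ℝ) = 2 := by rw [Real.sqrt_eq_iff_mul_self_eq] <;> norm_num
  simpa only [hermHop, Real.sqrt_div' _ (sq_nonneg _), Real.sqrt_sq (Nat.cast_nonneg _),
    Real.sqrt_div' _ zero_le_four, h4] using hsq.sqrt

theorem tendsto_momentEntry (hμ : ∀ n, 0 ≤ μ n)
    (hlim : Tendsto (fun n : ℕ => μ n / (n : ℝ)) atTop (𝓝 c)) (hτ : 0 < τ) {k : ℕ → ℕ}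
    (hk : Tendsto (fun n => (k n : ℝ) / n) atTop (𝓝 τ)) (m : ℕ) (j : ℤ)
    {l : ℕ → ℕ} (hl : ∀ᶠ n in atTop, (l n : ℤ) = k n + 2 * j) :
    Tendsto (fun n => momentEntry (hμ n) m (k n) (l n) / (n : ℝ) ^ m) atTop
      (𝓝 (arcsineCoeff (τ + c) (√(τ * (τ + 2 * c))) m j)) := by
  induction m generalizing j l with
  | zero =>
    rw [arcsineCoeff_zero]
    refine tendsto_const_nhds.congr' ?_
    filter_upwards [hl] with n hn
    rw [momentEntry_zero, pow_zero, div_one]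
    exact if_congr (by omega) rfl rfl
  | succ m ih =>
    have hlτ : Tendsto (fun n => (l n : ℝ) / n) atTop (𝓝 τ) := by
      refine tendsto_div_of_abs_sub_le (C := |2 * (j : ℝ)|) hk ?_
      filter_upwards [hl] with n hn
      have : (l n : ℝ) = k n + 2 * j := by exact_mod_cast hn
      rw [this, sub_add_cancel_left, abs_neg]
    have hl2τ : Tendsto (fun n => ((l n + 2 : ℕ) : ℝ) / n) atTop (𝓝 τ) :=
      tendsto_div_of_abs_sub_le (C := 2) hlτ (.of_forall fun n => by simp)
    have hup : ∀ᶠ n in atTop, ((l n + 2 : ℕ) : ℤ) = k n + 2 * (j + 1) := by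
      filter_upwards [hl] with n hn
      omega
    have hdown : ∀ᶠ n in atTop, ((l n - 2 : ℕ) : ℤ) = k n + 2 * (j - 1) := by
      filter_upwards [hl, (tendsto_atTop_of_tendsto_div hτ hlτ).eventually_ge_atTop 2]
        with n hn h2
      omega
    have hdiag : Tendsto (fun n => ((l n : ℝ) + 1 / 2 + μ n) / n) atTop (𝓝 (τ + c)) := by
      have h := (hlτ.add (tendsto_const_div_atTop_nhds_zero_nat (1 / 2))).add hlim
      rw [add_zero] at h
      exact h.congr fun n => by ring
    have h := (((tendsto_hermHop hμ hlim hl2τ).mul (ih (j + 1) hup)).add (hdiag.mul (ih j hl))).add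
      ((tendsto_hermHop hμ hlim hlτ).mul (ih (j - 1) hdown))
    rw [arcsineCoeff_succ]
    refine h.congr fun n => ?_
    rw [momentEntry_succ, pow_succ]
    ring

end Limit

theorem intervalIntegral_floor (f : ℕ → ℝ) (n : ℕ) :
    ∫ x in (0 : ℝ)..n, f ⌊x⌋₊ = ∑ k ∈ Finset.range n, f k := by
  have hconst (k : ℕ) :
      Set.EqOn (fun _ => f k) (fun x : ℝ => f ⌊x⌋₊) (Set.Ioo (k : ℝ) (k + 1 : ℕ)) := by
    intro x hx
    have : ⌊x⌋₊ = k := by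
      rw [Nat.floor_eq_iff ((Nat.cast_nonneg k).trans hx.1.le)]
      exact ⟨hx.1.le, by simpa using hx.2⟩
    simp only [this]
  have hle (k : ℕ) : (k : ℝ) ≤ (k + 1 : ℕ) := by simp
  have hint (k : ℕ) : IntervalIntegrable (fun x : ℝ => f ⌊x⌋₊) volume (k : ℝ) (k + 1 : ℕ) := by
    rw [intervalIntegrable_iff_integrableOn_Ioo_of_le (hle k)]
    exact (integrableOn_const (by simp)).congr_fun (hconst k) measurableSet_Ioo
  have h := intervalIntegral.sum_integral_adjacent_intervals (n := n)
    (a := fun k : ℕ => (k : ℝ)) fun k _ => hint k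
  rw [← Nat.cast_zero, ← h]
  refine Finset.sum_congr rfl fun k _ => ?_
  rw [intervalIntegral.integral_of_le (hle k), integral_Ioc_eq_integral_Ioo,
    ← setIntegral_congr_fun measurableSet_Ioo (hconst k)]
  simp

theorem intervalIntegral_floor_mul {n : ℕ} (hn : n ≠ 0) (f : ℕ → ℝ) :
    ∫ t in (0 : ℝ)..1, f ⌊n * t⌋₊ = (n : ℝ)⁻¹ * ∑ k ∈ Finset.range n, f k := by
  rw [intervalIntegral.integral_comp_mul_left (fun x => f ⌊x⌋₊) (Nat.cast_ne_zero.2 hn), mul_zero,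
    mul_one, smul_eq_mul, intervalIntegral_floor]

/-- The limits of the even moments of the rescaled mean eigenvalue distribution. -/
def limitMoment (c : ℝ) (m : ℕ) : ℝ :=
  ∫ τ in (0 : ℝ)..1, arcsineCoeff (τ + c) (√(τ * (τ + 2 * c))) m 0

theorem abs_momentEntry_floor_le {μ c t : ℝ} (hμ : 0 ≤ μ) {n : ℕ} (hn : n ≠ 0)
    (hc : μ / n ≤ c) (ht : t ∈ Set.Ioc 0 1) (m : ℕ) :
    |momentEntry hμ m ⌊n * t⌋₊ ⌊n * t⌋₊ / (n : ℝ) ^ m| ≤ (3 * (1 + 2 * m + c)) ^ m := by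
  have hn0 : 0 < (n : ℝ) := by positivity
  have hn1 : 1 ≤ (n : ℝ) := by exact_mod_cast Nat.one_le_iff_ne_zero.2 hn
  rw [abs_div, abs_of_pos (pow_pos hn0 m), div_le_iff₀ (pow_pos hn0 m), ← mul_pow]
  refine (abs_momentEntry_le hμ m _ _).trans (pow_le_pow_left₀ (by positivity) ?_ m)
  have hfloor : (⌊n * t⌋₊ : ℝ) ≤ n :=
    (Nat.floor_le (mul_nonneg hn0.le ht.1.le)).trans (mul_le_of_le_one_right hn0.le ht.2)
  have hμn : μ ≤ c * n := (div_le_iff₀ hn0).1 hc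
  have hm : (m : ℝ) ≤ m * n := le_mul_of_one_le_right m.cast_nonneg hn1
  linarith

theorem tendsto_average_momentEntry {μ : ℕ → ℝ} {c : ℝ} (hμ : ∀ n, 0 ≤ μ n)
    (hlim : Tendsto (fun n : ℕ => μ n / (n : ℝ)) atTop (𝓝 c)) (m : ℕ) :
    Tendsto (fun n : ℕ => (n : ℝ)⁻¹ *
      ∑ k ∈ Finset.range n, momentEntry (hμ n) m k k / (n : ℝ) ^ m) atTop
      (𝓝 (limitMoment c m)) := by
  have h : Tendsto (fun n : ℕ => ∫ t in (0 : ℝ)..1,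
      momentEntry (hμ n) m ⌊n * t⌋₊ ⌊n * t⌋₊ / (n : ℝ) ^ m) atTop (𝓝 (limitMoment c m)) := by
    refine intervalIntegral.tendsto_integral_filter_of_dominated_convergence
      (fun _ => (3 * (1 + 2 * m + (c + 1))) ^ m) (.of_forall fun n => ?_) ?_
      intervalIntegrable_const (.of_forall fun t ht => ?_)
    · exact ((measurable_from_nat (f := fun k => momentEntry (hμ n) m k k / (n : ℝ) ^ m)).comp
        (Nat.measurable_floor.comp (measurable_const_mul (n : ℝ)))).aestronglyMeasurable
    · filter_upwards [eventually_ne_atTop 0, hlim.eventually_le_const (lt_add_one c)] with n hn hc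
      refine .of_forall fun t ht => ?_
      rw [Set.uIoc_of_le zero_le_one] at ht
      exact abs_momentEntry_floor_le (hμ n) hn hc ht m
    · rw [Set.uIoc_of_le zero_le_one] at ht
      refine tendsto_momentEntry hμ hlim ht.1 ?_ m 0 (by simp)
      simpa only [mul_comm, Function.comp_def] using
        (tendsto_nat_floor_mul_div_atTop (R := ℝ) ht.1.le).comp tendsto_natCast_atTop_atTop
  refine h.congr' ?_
  filter_upwards [eventually_ne_atTop 0] with n hn
  exact intervalIntegral_floor_mul hn fun k => momentEntry (hμ n) m k k / (n : ℝ) ^ m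

end Asymptotics

/-! ### The limit measure as a mixture of arcsine laws -/

theorem setLIntegral_eq_of_subset {α : Type*} [MeasurableSpace α] {ν : Measure α} {s t : Set α}
    {f : α → ℝ≥0∞} (hs : MeasurableSet s) (ht : MeasurableSet t) (hst : s ⊆ t)
    (hf : ∀ x ∈ t \ s, f x = 0) : ∫⁻ x in t, f x ∂ν = ∫⁻ x in s, f x ∂ν := by
  rw [← lintegral_inter_add_sdiff f t hs, Set.inter_eq_self_of_subset_right hst,
    setLIntegral_eq_zero (ht.diff hs) hf, add_zero]

theorem setLIntegral_deriv_Ioo {a b : ℝ} {f f' : ℝ → ℝ} (hab : a ≤ b)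
    (hf : ContinuousOn f (Set.Icc a b)) (hf' : ∀ x ∈ Set.Ioo a b, HasDerivAt f (f' x) x)
    (h0 : ∀ x ∈ Set.Ioo a b, 0 ≤ f' x) :
    ∫⁻ x in Set.Ioo a b, ENNReal.ofReal (f' x) = ENNReal.ofReal (f b - f a) := by
  have hint := intervalIntegral.integrableOn_deriv_of_nonneg hf hf' h0
  rw [← ofReal_integral_eq_lintegral_ofReal (hint.mono_set Set.Ioo_subset_Ioc_self)
      (ae_restrict_of_forall_mem measurableSet_Ioo h0), ← integral_Ioc_eq_integral_Ioo,
    ← intervalIntegral.integral_of_le hab,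
    intervalIntegral.integral_eq_sub_of_hasDerivAt_of_le hab hf hf'
      ((intervalIntegrable_iff_integrableOn_Ioc_of_le hab).2 hint)]

theorem setLIntegral_div_sqrt_mul_sub {s : ℝ} (hs : 0 < s) (a b : ℝ) :
    ∫⁻ τ in Set.Ioo a b, ENNReal.ofReal (s / √(2 * s * (τ - a))) =
      ENNReal.ofReal √(2 * s * (b - a)) := by
  rcases le_total a b with hab | hba
  · rw [setLIntegral_deriv_Ioo (f := fun τ => √(2 * s * (τ - a))) hab (by fun_prop)
      (fun τ hτ => ?_) fun τ _ => by positivity]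
    · simp
    · have hpos : 2 * s * (τ - a) ≠ 0 := (mul_pos (by positivity) (sub_pos.2 hτ.1)).ne'
      refine (((hasDerivAt_id τ).sub_const a).const_mul (2 * s)).sqrt hpos |>.congr_deriv ?_
      rw [mul_one, mul_div_mul_left _ _ two_ne_zero, id]
  · have hneg : 2 * s * (b - a) ≤ 0 :=
      mul_nonpos_of_nonneg_of_nonpos (by positivity) (sub_nonpos.2 hba)
    rw [Set.Ioo_eq_empty hba.not_gt, setLIntegral_empty, Real.sqrt_eq_zero_of_nonpos hneg,
      ENNReal.ofReal_zero]

theorem setLIntegral_div_sqrt_linear {s : ℝ} (c : ℝ) (hs : 0 < s) :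
    ∫⁻ τ in Set.Ioo (0 : ℝ) 1, ENNReal.ofReal (s / √(2 * τ * s - (s - c) ^ 2)) =
      ENNReal.ofReal √(2 * s - (s - c) ^ 2) := by
  set τ₀ : ℝ := (s - c) ^ 2 / (2 * s) with hτ₀
  have hτ₀_nonneg : 0 ≤ τ₀ := by positivity
  have hradicand (τ : ℝ) : 2 * τ * s - (s - c) ^ 2 = 2 * s * (τ - τ₀) := by
    rw [hτ₀]
    field_simp
  have hradicand_one : 2 * s - (s - c) ^ 2 = 2 * s * (1 - τ₀) := by rw [← hradicand, mul_one]
  simp only [hradicand, hradicand_one]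
  rw [setLIntegral_eq_of_subset measurableSet_Ioo measurableSet_Ioo
    (Set.Ioo_subset_Ioo_left hτ₀_nonneg), setLIntegral_div_sqrt_mul_sub hs]
  rintro τ ⟨⟨-, hτ1⟩, hτ⟩
  -- Below `τ₀` the radicand is nonpositive, and the quotient takes the value `s / 0 = 0`.
  have hle : τ ≤ τ₀ := not_lt.1 fun h => hτ ⟨h, hτ1⟩
  rw [Real.sqrt_eq_zero_of_nonpos, div_zero, ENNReal.ofReal_zero]
  exact mul_nonpos_of_nonneg_of_nonpos (by positivity) (sub_nonpos.2 hle)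

theorem lintegral_even {g : ℝ → ℝ≥0∞} (hg : ∀ t, g (-t) = g t) :
    ∫⁻ t, g t = 2 * ∫⁻ t in Set.Ioi 0, g t := by
  have hneg : ∫⁻ t in Set.Iio 0, g t = ∫⁻ t in Set.Ioi 0, g t := by
    have h := (Measure.measurePreserving_neg (volume : Measure ℝ)).setLIntegral_comp_preimage_emb
      (MeasurableEquiv.neg ℝ).measurableEmbedding g (Set.Iio 0)
    simpa [hg] using h.symm
  rw [← lintegral_add_compl g measurableSet_Ioi, Set.compl_Ioi,
    setLIntegral_congr Iio_ae_eq_Iic.symm, hneg, two_mul]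

theorem lintegral_comp_sq_mul_abs (h : ℝ → ℝ≥0∞) :
    ∫⁻ t : ℝ, h (t ^ 2) * ENNReal.ofReal |t| = ∫⁻ s in Set.Ioi 0, h s := by
  have himage : (fun t : ℝ => t ^ 2) '' Set.Ioi 0 = Set.Ioi 0 := by
    ext s
    refine ⟨fun ⟨t, ht, hts⟩ => hts ▸ pow_pos (Set.mem_Ioi.1 ht) 2,
      fun hs => ⟨√s, Real.sqrt_pos.2 hs, ?_⟩⟩
    exact Real.sq_sqrt (Set.mem_Ioi.1 hs).le
  have hderiv (t : ℝ) : HasDerivWithinAt (fun t : ℝ => t ^ 2) (2 * t) (Set.Ioi 0) t := by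
    simpa using (hasDerivAt_pow 2 t).hasDerivWithinAt
  have hinj : Set.InjOn (fun t : ℝ => t ^ 2) (Set.Ioi 0) := fun x hx y hy hxy =>
    (pow_left_inj₀ (le_of_lt hx) (le_of_lt hy) two_ne_zero).1 hxy
  rw [lintegral_even fun t => by simp, ← lintegral_const_mul' _ _ ENNReal.ofNat_ne_top]
  nth_rw 2 [← himage]
  rw [lintegral_image_eq_lintegral_abs_deriv_mul measurableSet_Ioi (fun t _ => hderiv t) hinj]
  refine setLIntegral_congr_fun measurableSet_Ioi fun t _ => ?_
  rw [abs_mul, Nat.abs_ofNat, ENNReal.ofReal_mul zero_le_two, ENNReal.ofReal_ofNat]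
  ring

theorem image_add_mul_cos_Ioo (d : ℝ) {e : ℝ} (he : 0 < e) :
    (fun θ => d + e * Real.cos θ) '' Set.Ioo 0 Real.pi = Set.Ioo (d - e) (d + e) := by
  have hcos : Real.cos '' Set.Ioo 0 Real.pi = Set.Ioo (-1) 1 :=
    Real.cosPartialHomeomorph.image_source_eq_target
  rw [← Set.image_image (fun x => d + e * x), hcos]
  simp only [add_comm d, Set.image_affine_Ioo he, mul_neg, mul_one, sub_eq_neg_add]

theorem setLIntegral_div_sqrt_sub_sq (d : ℝ) {e : ℝ} (he : 0 < e) (f : ℝ → ℝ≥0∞) :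
    ∫⁻ s in Set.Ioo (d - e) (d + e), f s * ENNReal.ofReal (1 / √(e ^ 2 - (s - d) ^ 2)) =
      ∫⁻ θ in Set.Ioo 0 Real.pi, f (d + e * Real.cos θ) := by
  have hderiv (θ : ℝ) : HasDerivWithinAt (fun θ => d + e * Real.cos θ) (e * -Real.sin θ)
      (Set.Ioo 0 Real.pi) θ :=
    (((Real.hasDerivAt_cos θ).const_mul e).const_add d).hasDerivWithinAt
  have hinj : Set.InjOn (fun θ => d + e * Real.cos θ) (Set.Ioo 0 Real.pi) := fun x hx y hy hxy =>
    Real.injOn_cos (Set.Ioo_subset_Icc_self hx) (Set.Ioo_subset_Icc_self hy)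
      (mul_left_cancel₀ he.ne' (add_left_cancel hxy))
  rw [← image_add_mul_cos_Ioo d he,
    lintegral_image_eq_lintegral_abs_deriv_mul measurableSet_Ioo (fun θ _ => hderiv θ) hinj]
  refine setLIntegral_congr_fun measurableSet_Ioo fun θ hθ => ?_
  have hsin : 0 < e * Real.sin θ := mul_pos he (Real.sin_pos_of_pos_of_lt_pi hθ.1 hθ.2)
  have hradicand : e ^ 2 - (d + e * Real.cos θ - d) ^ 2 = (e * Real.sin θ) ^ 2 := by
    rw [mul_pow, Real.sin_sq]
    ring
  simp only [hradicand, Real.sqrt_sq hsin.le, mul_neg, abs_neg, abs_of_pos hsin]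
  rw [mul_left_comm, ← ENNReal.ofReal_mul hsin.le, mul_one_div_cancel hsin.ne',
    ENNReal.ofReal_one, mul_one]

theorem lintegral_comp_sq_mul_abs_div_sqrt {d e : ℝ} (he : 0 < e) (hed : e ≤ d)
    (f : ℝ → ℝ≥0∞) :
    ∫⁻ t : ℝ, f (t ^ 2) * ENNReal.ofReal (|t| / √(e ^ 2 - (t ^ 2 - d) ^ 2)) =
      ∫⁻ θ in Set.Ioo 0 Real.pi, f (d + e * Real.cos θ) := by
  have hsplit (t : ℝ) : f (t ^ 2) * ENNReal.ofReal (|t| / √(e ^ 2 - (t ^ 2 - d) ^ 2)) =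
      f (t ^ 2) * ENNReal.ofReal (1 / √(e ^ 2 - (t ^ 2 - d) ^ 2)) * ENNReal.ofReal |t| := by
    rw [mul_assoc, ← ENNReal.ofReal_mul (by positivity), one_div_mul_eq_div]
  simp only [hsplit]
  rw [lintegral_comp_sq_mul_abs fun s => f s * ENNReal.ofReal (1 / √(e ^ 2 - (s - d) ^ 2)),
    setLIntegral_eq_of_subset measurableSet_Ioo measurableSet_Ioi
      (fun s hs => (sub_nonneg.2 hed).trans_lt hs.1), setLIntegral_div_sqrt_sub_sq d he]
  rintro s ⟨-, hs⟩
  have habs : e ≤ |s - d| := by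
    by_contra! h
    rw [abs_lt] at h
    exact hs ⟨by linarith, by linarith⟩
  rw [Real.sqrt_eq_zero_of_nonpos, div_zero, ENNReal.ofReal_zero, mul_zero]
  rw [sub_nonpos, ← sq_abs (s - d)]
  exact pow_le_pow_left₀ he.le habs 2

section LimitMeasure

variable {c : ℝ}

theorem endA_sq (hc : 0 ≤ c) : endA c ^ 2 = 1 + c - √(1 + 2 * c) := by
  refine Real.sq_sqrt (sub_nonneg.2 (Real.sqrt_le_iff.2 ⟨by positivity, ?_⟩))
  linarith [sq_nonneg c, add_sq 1 c]

theorem endB_sq (hc : 0 ≤ c) : endB c ^ 2 = 1 + c + √(1 + 2 * c) :=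
  Real.sq_sqrt (by positivity)

theorem limitDensity_radicand (hc : 0 ≤ c) (t : ℝ) :
    (t ^ 2 - endA c ^ 2) * (endB c ^ 2 - t ^ 2) = 2 * t ^ 2 - (t ^ 2 - c) ^ 2 := by
  rw [endA_sq hc, endB_sq hc]
  have h : √(1 + 2 * c) ^ 2 = 1 + 2 * c := Real.sq_sqrt (by positivity)
  linear_combination h

theorem limitDensity_nonneg (c t : ℝ) : 0 ≤ limitDensity c t := by
  unfold limitDensity
  positivity

theorem limitDensity_neg (c t : ℝ) : limitDensity c (-t) = limitDensity c t := by
  simp only [limitDensity, abs_neg, neg_sq]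

theorem measurable_limitDensity (c : ℝ) : Measurable (limitDensity c) := by
  unfold limitDensity
  fun_prop

theorem measurableSet_limitSupport (c : ℝ) : MeasurableSet (limitSupport c) :=
  measurableSet_Icc.union measurableSet_Icc

theorem endA_nonneg (c : ℝ) : 0 ≤ endA c := Real.sqrt_nonneg _

theorem endA_le_endB (c : ℝ) : endA c ≤ endB c :=
  Real.sqrt_le_sqrt (by linarith [Real.sqrt_nonneg (1 + 2 * c)])

theorem mem_limitSupport_iff {t : ℝ} : t ∈ limitSupport c ↔ |t| ∈ Set.Icc (endA c) (endB c) := by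
  have hA := endA_nonneg c
  simp only [limitSupport, Set.mem_union, Set.mem_Icc, le_abs, abs_le]
  constructor
  · rintro (⟨h1, h2⟩ | ⟨h1, h2⟩)
    · exact ⟨.inr (by linarith), h1, by linarith⟩
    · exact ⟨.inl h1, by linarith, h2⟩
  · rintro ⟨h1 | h1, h2, h3⟩
    · exact .inr ⟨h1, h3⟩
    · exact .inl ⟨h2, by linarith⟩

theorem limitDensity_eq_zero_of_notMem {t : ℝ} (ht : t ∉ limitSupport c) :
    limitDensity c t = 0 := by
  have hA := endA_nonneg c
  have hAB := endA_le_endB c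
  rw [mem_limitSupport_iff, Set.mem_Icc, not_and_or, not_le, not_le] at ht
  rw [limitDensity, Real.sqrt_eq_zero_of_nonpos, mul_zero]
  rw [← sq_abs t]
  rcases ht with ht | ht
  · have hA' := pow_le_pow_left₀ (abs_nonneg t) ht.le 2
    have hB' := pow_le_pow_left₀ (abs_nonneg t) (ht.le.trans hAB) 2
    exact mul_nonpos_of_nonpos_of_nonneg (sub_nonpos.2 hA') (sub_nonneg.2 hB')
  · have hA' := pow_le_pow_left₀ hA (hAB.trans ht.le) 2
    have hB' := pow_le_pow_left₀ (hA.trans hAB) ht.le 2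
    exact mul_nonpos_of_nonneg_of_nonpos (sub_nonneg.2 hA') (sub_nonpos.2 hB')

theorem limitMeasure_eq (c : ℝ) :
    limitMeasure c = volume.withDensity fun t => ENNReal.ofReal (limitDensity c t) := by
  rw [limitMeasure, ← withDensity_indicator (measurableSet_limitSupport c)]
  congr 1
  refine Set.indicator_eq_self.2 (Function.support_subset_iff'.2 fun t ht => ?_)
  rw [limitDensity_eq_zero_of_notMem ht, ENNReal.ofReal_zero]

theorem limitMeasure_compl_limitSupport (c : ℝ) : limitMeasure c (limitSupport c)ᶜ = 0 :=
  withDensity_absolutelyContinuous _ _ (by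
    rw [Measure.restrict_apply (measurableSet_limitSupport c).compl, Set.compl_inter_self,
      measure_empty])

theorem ae_abs_le_limitMeasure (c : ℝ) : ∀ᵐ t ∂(limitMeasure c), |t| ≤ endB c := by
  have h : ∀ᵐ t ∂(limitMeasure c), t ∈ limitSupport c := limitMeasure_compl_limitSupport c
  filter_upwards [h] with t ht
  exact (mem_limitSupport_iff.1 ht).2

theorem ofReal_limitDensity (hc : 0 ≤ c) {t : ℝ} (ht : t ≠ 0) :
    ENNReal.ofReal (limitDensity c t) = ENNReal.ofReal (1 / Real.pi) *
      ∫⁻ τ in Set.Ioo (0 : ℝ) 1,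
        ENNReal.ofReal (|t| / √(2 * τ * t ^ 2 - (t ^ 2 - c) ^ 2)) := by
  have habs : 0 < |t| := abs_pos.2 ht
  have hfactor (τ : ℝ) : ENNReal.ofReal (|t| / √(2 * τ * t ^ 2 - (t ^ 2 - c) ^ 2)) =
      ENNReal.ofReal (1 / |t|) *
        ENNReal.ofReal (t ^ 2 / √(2 * τ * t ^ 2 - (t ^ 2 - c) ^ 2)) := by
    rw [← ENNReal.ofReal_mul (by positivity), ← mul_div_assoc, ← sq_abs t, one_div, sq |t|,
      inv_mul_cancel_left₀ habs.ne']
  simp only [hfactor]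
  rw [lintegral_const_mul' _ _ ENNReal.ofReal_ne_top,
    setLIntegral_div_sqrt_linear c (by positivity), ← ENNReal.ofReal_mul (by positivity),
    ← ENNReal.ofReal_mul (by positivity), limitDensity, limitDensity_radicand hc, ← mul_assoc,
    one_div_mul_one_div]

theorem sqrt_mul_add_two_mul_le {τ : ℝ} (hc : 0 ≤ c) (hτ : 0 ≤ τ) :
    √(τ * (τ + 2 * c)) ≤ τ + c :=
  Real.sqrt_le_iff.2 ⟨by positivity, by linarith [sq_nonneg c, add_sq τ c]⟩

theorem lintegral_comp_sq_limitMeasure (hc : 0 ≤ c) {f : ℝ → ℝ≥0∞} (hf : Measurable f) :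
    ∫⁻ t, f (t ^ 2) ∂(limitMeasure c) = ∫⁻ τ in Set.Ioo (0 : ℝ) 1, ENNReal.ofReal (1 / Real.pi) *
      ∫⁻ θ in Set.Ioo 0 Real.pi, f (τ + c + √(τ * (τ + 2 * c)) * Real.cos θ) := by
  have hmeas : Measurable fun p : ℝ × ℝ =>
      f (p.1 ^ 2) * ENNReal.ofReal (|p.1| / √(2 * p.2 * p.1 ^ 2 - (p.1 ^ 2 - c) ^ 2)) := by
    fun_prop
  have hmixture : ∫⁻ t, f (t ^ 2) ∂(limitMeasure c) =
      ∫⁻ t : ℝ, ENNReal.ofReal (1 / Real.pi) * ∫⁻ τ in Set.Ioo (0 : ℝ) 1,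
        f (t ^ 2) * ENNReal.ofReal (|t| / √(2 * τ * t ^ 2 - (t ^ 2 - c) ^ 2)) := by
    rw [limitMeasure_eq, lintegral_withDensity_eq_lintegral_mul _
      (measurable_limitDensity c).ennreal_ofReal (by fun_prop)]
    apply lintegral_congr_ae
    filter_upwards [Measure.ae_ne volume (0 : ℝ)] with t ht
    rw [Pi.mul_apply, ofReal_limitDensity hc ht, lintegral_const_mul _ (by fun_prop)]
    ring
  rw [hmixture, lintegral_const_mul' _ _ ENNReal.ofReal_ne_top,
    lintegral_lintegral_swap hmeas.aemeasurable,
    ← lintegral_const_mul' _ _ ENNReal.ofReal_ne_top]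
  refine setLIntegral_congr_fun measurableSet_Ioo fun τ hτ => ?_
  have hpos : 0 < τ * (τ + 2 * c) := mul_pos hτ.1 (add_pos_of_pos_of_nonneg hτ.1 (by positivity))
  have hradicand (s : ℝ) :
      2 * τ * s - (s - c) ^ 2 = √(τ * (τ + 2 * c)) ^ 2 - (s - (τ + c)) ^ 2 := by
    rw [Real.sq_sqrt hpos.le]
    ring
  simp only [hradicand]
  rw [lintegral_comp_sq_mul_abs_div_sqrt (Real.sqrt_pos.2 hpos)
    (sqrt_mul_add_two_mul_le hc hτ.1.le)]

theorem isProbabilityMeasure_limitMeasure (hc : 0 ≤ c) :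
    IsProbabilityMeasure (limitMeasure c) where
  measure_univ := by
    have h := lintegral_comp_sq_limitMeasure hc (f := fun _ => 1) measurable_const
    simpa [← ENNReal.ofReal_mul, Real.pi_nonneg, Real.pi_ne_zero] using h

theorem continuous_arcsineCoeff (m : ℕ) (j : ℤ) :
    Continuous fun p : ℝ × ℝ => arcsineCoeff p.1 p.2 m j := by
  unfold arcsineCoeff
  refine continuous_const.mul ?_
  apply intervalIntegral.continuous_parametric_intervalIntegral_of_continuous'
  fun_prop

theorem add_mul_cos_nonneg {d e : ℝ} (he : |e| ≤ d) (θ : ℝ) : 0 ≤ d + e * Real.cos θ := by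
  have h : |e * Real.cos θ| ≤ |e| := by
    rw [abs_mul]
    exact mul_le_of_le_one_right (abs_nonneg e) (Real.abs_cos_le_one θ)
  linarith [neg_abs_le (e * Real.cos θ)]

theorem arcsineCoeff_nonneg {d e : ℝ} (he : |e| ≤ d) (m : ℕ) : 0 ≤ arcsineCoeff d e m 0 := by
  refine mul_nonneg (by positivity) (intervalIntegral.integral_nonneg Real.pi_nonneg fun θ _ => ?_)
  simpa using pow_nonneg (add_mul_cos_nonneg he θ) m

theorem ofReal_arcsineCoeff {d e : ℝ} (he : |e| ≤ d) (m : ℕ) :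
    ENNReal.ofReal (arcsineCoeff d e m 0) = ENNReal.ofReal (1 / Real.pi) *
      ∫⁻ θ in Set.Ioo 0 Real.pi, ENNReal.ofReal ((d + e * Real.cos θ) ^ m) := by
  have hcont : Continuous fun θ : ℝ => (d + e * Real.cos θ) ^ m := by fun_prop
  rw [← ofReal_integral_eq_lintegral_ofReal
      (hcont.integrableOn_Icc.mono_set Set.Ioo_subset_Icc_self)
      (.of_forall fun θ => pow_nonneg (add_mul_cos_nonneg he θ) m),
    ← ENNReal.ofReal_mul (by positivity), ← integral_Ioc_eq_integral_Ioo,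
    ← intervalIntegral.integral_of_le Real.pi_nonneg]
  simp [arcsineCoeff]

theorem integral_even_pow_limitMeasure (hc : 0 ≤ c) (m : ℕ) :
    ∫ t, t ^ (2 * m) ∂(limitMeasure c) = limitMoment c m := by
  let a (τ : ℝ) : ℝ := arcsineCoeff (τ + c) (√(τ * (τ + 2 * c))) m 0
  have habs {τ : ℝ} (hτ : τ ∈ Set.Ioo (0 : ℝ) 1) : |√(τ * (τ + 2 * c))| ≤ τ + c := by
    rw [abs_of_nonneg (Real.sqrt_nonneg _)]
    exact sqrt_mul_add_two_mul_le hc hτ.1.le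
  have hcont : Continuous a :=
    (continuous_arcsineCoeff m 0).comp (f := fun τ => (τ + c, √(τ * (τ + 2 * c)))) (by fun_prop)
  have hnonneg : ∀ τ ∈ Set.Ioo (0 : ℝ) 1, 0 ≤ a τ := fun τ hτ => arcsineCoeff_nonneg (habs hτ) m
  have hlintegral : ∫⁻ t, ENNReal.ofReal (t ^ (2 * m)) ∂(limitMeasure c) =
      ∫⁻ τ in Set.Ioo (0 : ℝ) 1, ENNReal.ofReal (a τ) := by
    simp only [pow_mul]
    rw [lintegral_comp_sq_limitMeasure hc (f := fun s => ENNReal.ofReal (s ^ m)) (by fun_prop)]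
    exact setLIntegral_congr_fun measurableSet_Ioo fun τ hτ =>
      (ofReal_arcsineCoeff (habs hτ) m).symm
  rw [integral_eq_lintegral_of_nonneg_ae (.of_forall fun t => (even_two_mul m).pow_nonneg t)
      (by fun_prop), hlintegral,
    ← ofReal_integral_eq_lintegral_ofReal
      (hcont.integrableOn_Icc.mono_set Set.Ioo_subset_Icc_self)
      (ae_restrict_of_forall_mem measurableSet_Ioo hnonneg),
    ENNReal.toReal_ofReal (setIntegral_nonneg measurableSet_Ioo hnonneg),
    ← integral_Ioc_eq_integral_Ioo, ← intervalIntegral.integral_of_le zero_le_one, limitMoment]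

theorem integral_odd_pow_limitMeasure (c : ℝ) (m : ℕ) :
    ∫ t, t ^ (2 * m + 1) ∂(limitMeasure c) = 0 := by
  rw [limitMeasure_eq, integral_withDensity_ofReal (measurable_limitDensity c)
    (limitDensity_nonneg c)]
  refine integral_eq_zero_of_odd fun t => ?_
  rw [limitDensity_neg, Odd.neg_pow ⟨m, rfl⟩, smul_neg]

theorem limitMeasure_zero : limitMeasure 0 = semicircleLaw := by
  have hA : endA 0 = 0 := by simp [endA]
  have hB : endB 0 = √2 := by
    unfold endB
    norm_num
  have hS : limitSupport 0 = Set.Icc (-√2) √2 := by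
    rw [limitSupport, hA, hB, neg_zero, Set.Icc_union_Icc_eq_Icc (by simp) (by simp)]
  rw [limitMeasure, semicircleLaw, hS]
  apply withDensity_congr_ae
  filter_upwards [ae_restrict_of_ae (Measure.ae_ne volume (0 : ℝ))] with t ht
  have habs : |t| ≠ 0 := abs_ne_zero.2 ht
  congr 1
  rw [limitDensity, hA, hB, Real.sq_sqrt zero_le_two, zero_pow two_ne_zero, sub_zero,
    Real.sqrt_mul (sq_nonneg t), Real.sqrt_sq_eq_abs]
  field_simp

end LimitMeasure

/-! ### The method of moments -/

section MomentMethod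

open Polynomial

theorem abs_eval_le_sum_abs_coeff_mul (p : ℝ[X]) {x : ℝ} (hx : 1 ≤ |x|) :
    |p.eval x| ≤ (∑ i ∈ Finset.range (p.natDegree + 1), |p.coeff i|) * x ^ (2 * p.natDegree) := by
  rw [eval_eq_sum_range, Finset.sum_mul, ← (even_two_mul p.natDegree).pow_abs x]
  refine (Finset.abs_sum_le_sum_abs _ _).trans (Finset.sum_le_sum fun i hi => ?_)
  rw [abs_mul, abs_pow]
  have hdeg : i ≤ 2 * p.natDegree := by
    have := Finset.mem_range.1 hi
    lia
  gcongr

theorem exists_abs_sub_eval_le_mul_pow (φ : ℝ →ᵇ ℝ) (p : ℝ[X]) :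
    ∃ K, 0 ≤ K ∧ ∀ x, 1 ≤ |x| → |φ x - p.eval x| ≤ K * x ^ (2 * p.natDegree) := by
  refine ⟨‖φ‖ + ∑ i ∈ Finset.range (p.natDegree + 1), |p.coeff i|, by positivity, fun x hx => ?_⟩
  have hφ : |φ x| ≤ ‖φ‖ * x ^ (2 * p.natDegree) := by
    rw [← (even_two_mul p.natDegree).pow_abs x]
    exact (φ.norm_coe_le_norm x).trans
      (le_mul_of_one_le_right (norm_nonneg _) (one_le_pow₀ hx))
  rw [add_mul]
  exact (abs_sub _ _).trans (add_le_add hφ (abs_eval_le_sum_abs_coeff_mul p hx))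

/-- Weierstrass approximation on `[-R, R]` for some `R > B`; outside, the error grows like a fixed
power of `x`, and multiplying it by `(x / R) ^ (2 * L)` makes it negligible on `[-B, B]`. -/
theorem exists_polynomial_abs_sub_le (φ : ℝ →ᵇ ℝ) {B δ : ℝ} (hB : 0 ≤ B) (hδ : 0 < δ) :
    ∃ (p : ℝ[X]) (N : ℕ) (a : ℝ), 0 ≤ a ∧ a * B ^ (2 * N) < δ ∧
      ∀ x, |φ x - p.eval x| ≤ δ + a * x ^ (2 * N) := by
  obtain ⟨R, hR1, hBR⟩ : ∃ R, 1 ≤ R ∧ B < R := ⟨B + 1, by linarith, by linarith⟩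
  obtain ⟨p, hp⟩ := exists_polynomial_near_of_continuousOn (-R) R φ φ.continuous.continuousOn δ hδ
  obtain ⟨K, hK0, hK⟩ := exists_abs_sub_eval_le_mul_pow φ p
  set D := p.natDegree
  have hratio : (B / R) ^ 2 < 1 :=
    pow_lt_one₀ (by positivity) ((div_lt_one (by linarith)).2 hBR) two_ne_zero
  have hdecay : Tendsto (fun L : ℕ => K * B ^ (2 * D) * ((B / R) ^ 2) ^ L) atTop (𝓝 0) := by
    simpa using (tendsto_pow_atTop_nhds_zero_of_lt_one (sq_nonneg _) hratio).const_mul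
      (K * B ^ (2 * D))
  obtain ⟨L, hL⟩ := (hdecay.eventually_lt_const hδ).exists
  refine ⟨p, D + L, K / R ^ (2 * L), by positivity, ?_, fun x => ?_⟩
  · refine lt_of_eq_of_lt ?_ hL
    rw [← pow_mul, div_pow, mul_add, pow_add]
    ring
  have hnonneg : 0 ≤ x ^ (2 * D) := (even_two_mul D).pow_nonneg x
  rcases le_or_gt |x| R with hx | hx
  · rw [abs_sub_comm]
    exact (hp x (abs_le.1 hx)).le.trans (le_add_of_nonneg_right
      (mul_nonneg (by positivity) ((even_two_mul (D + L)).pow_nonneg x)))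
  · have hpow : R ^ (2 * L) ≤ x ^ (2 * L) := by
      rw [← (even_two_mul L).pow_abs x]
      gcongr
    calc |φ x - p.eval x| ≤ K * x ^ (2 * D) := hK x (hR1.trans hx.le)
      _ ≤ K * x ^ (2 * D) * (x ^ (2 * L) / R ^ (2 * L)) :=
          le_mul_of_one_le_right (by positivity) ((one_le_div (by positivity)).2 hpow)
      _ = K / R ^ (2 * L) * x ^ (2 * (D + L)) := by ring
      _ ≤ δ + K / R ^ (2 * L) * x ^ (2 * (D + L)) := le_add_of_nonneg_left hδ.le

section Moments

variable {ρ : Measure ℝ}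

theorem integrable_eval (h : ∀ k : ℕ, Integrable (fun x => x ^ k) ρ) (p : ℝ[X]) :
    Integrable (fun x => p.eval x) ρ := by
  simp only [eval_eq_sum_range]
  exact integrable_finsetSum _ fun i _ => (h i).const_mul _

theorem integral_eval (h : ∀ k : ℕ, Integrable (fun x => x ^ k) ρ) (p : ℝ[X]) :
    ∫ x, p.eval x ∂ρ = ∑ i ∈ Finset.range (p.natDegree + 1), p.coeff i * ∫ x, x ^ i ∂ρ := by
  simp only [eval_eq_sum_range]
  rw [integral_finsetSum _ fun i _ => (h i).const_mul _]
  simp only [integral_const_mul]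

theorem integrable_pow_of_ae_abs_le [IsFiniteMeasure ρ] {B : ℝ} (hB : ∀ᵐ t ∂ρ, |t| ≤ B) (k : ℕ) :
    Integrable (fun x => x ^ k) ρ := by
  refine Integrable.of_bound (by fun_prop) (B ^ k) ?_
  filter_upwards [hB] with t ht
  rw [Real.norm_eq_abs, abs_pow]
  gcongr

theorem integral_even_pow_le [IsProbabilityMeasure ρ] {B : ℝ} (hB : ∀ᵐ t ∂ρ, |t| ≤ B) (N : ℕ) :
    ∫ x, x ^ (2 * N) ∂ρ ≤ B ^ (2 * N) := by
  refine (integral_mono_ae (integrable_pow_of_ae_abs_le hB _) (integrable_const (B ^ (2 * N))) ?_)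
    |>.trans (by simp)
  filter_upwards [hB] with t ht
  rw [← (even_two_mul N).pow_abs t]
  gcongr

theorem abs_integral_sub_integral_eval_le [IsProbabilityMeasure ρ]
    (h : ∀ k : ℕ, Integrable (fun x => x ^ k) ρ) {φ : ℝ →ᵇ ℝ} {p : ℝ[X]} {δ a : ℝ} {N : ℕ}
    (hφ : ∀ x, |φ x - p.eval x| ≤ δ + a * x ^ N) :
    |∫ x, φ x ∂ρ - ∫ x, p.eval x ∂ρ| ≤ δ + a * ∫ x, x ^ N ∂ρ := by
  have hφp : Integrable (fun x => φ x - p.eval x) ρ := (φ.integrable ρ).sub (integrable_eval h p)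
  have hbound : Integrable (fun x => δ + a * x ^ N) ρ :=
    (integrable_const δ).add ((h N).const_mul a)
  calc |∫ x, φ x ∂ρ - ∫ x, p.eval x ∂ρ| = |∫ x, φ x - p.eval x ∂ρ| := by
        rw [integral_sub (φ.integrable ρ) (integrable_eval h p)]
    _ ≤ ∫ x, |φ x - p.eval x| ∂ρ := abs_integral_le_integral_abs
    _ ≤ ∫ x, (δ + a * x ^ N) ∂ρ := integral_mono hφp.abs hbound hφ
    _ = δ + a * ∫ x, x ^ N ∂ρ := by
        rw [integral_add (integrable_const δ) ((h N).const_mul a), integral_const_mul]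
        simp

end Moments

theorem tendsto_integral_of_tendsto_moments {ι : Type*} {l : Filter ι} {ρ : ι → Measure ℝ}
    {ν : Measure ℝ} [∀ i, IsProbabilityMeasure (ρ i)] [IsProbabilityMeasure ν] {B : ℝ}
    (hB : ∀ᵐ t ∂ν, |t| ≤ B) (hρ : ∀ i (k : ℕ), Integrable (fun x => x ^ k) (ρ i))
    (hmoments : ∀ k : ℕ, Tendsto (fun i => ∫ x, x ^ k ∂(ρ i)) l (𝓝 (∫ x, x ^ k ∂ν)))
    (φ : ℝ →ᵇ ℝ) : Tendsto (fun i => ∫ x, φ x ∂(ρ i)) l (𝓝 (∫ x, φ x ∂ν)) := by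
  have hν := integrable_pow_of_ae_abs_le hB
  obtain ⟨t₀, ht₀⟩ := hB.exists
  have hB0 : 0 ≤ B := (abs_nonneg t₀).trans ht₀
  rw [Metric.tendsto_nhds]
  intro ε hε
  obtain ⟨p, N, a, ha, haB, hφ⟩ := exists_polynomial_abs_sub_le φ hB0 (δ := ε / 5) (by positivity)
  have hpoly : Tendsto (fun i => ∫ x, p.eval x ∂(ρ i)) l (𝓝 (∫ x, p.eval x ∂ν)) := by
    simp only [integral_eval (hρ _), integral_eval hν]
    exact tendsto_finsetSum _ fun k _ => (hmoments k).const_mul _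
  have hν_tail : a * ∫ x, x ^ (2 * N) ∂ν < ε / 5 :=
    (mul_le_mul_of_nonneg_left (integral_even_pow_le hB N) ha).trans_lt haB
  filter_upwards [((hmoments (2 * N)).const_mul a).eventually_lt_const hν_tail,
    Metric.tendsto_nhds.1 hpoly (ε / 5) (by positivity)] with i hρ_tail hpoly_i
  have hρ_i := abs_integral_sub_integral_eval_le (hρ i) hφ
  have hν_i := abs_integral_sub_integral_eval_le hν hφ
  rw [Real.dist_eq, abs_lt] at hpoly_i ⊢
  rw [abs_le] at hρ_i hν_i
  constructor <;> linarith [hpoly_i.1, hpoly_i.2, hρ_i.1, hρ_i.2, hν_i.1, hν_i.2]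

end MomentMethod

/-! ### Convergence of the mean eigenvalue distributions -/

section Convergence

open Polynomial

section Moments

variable {μ : ℝ} (hμ : 0 ≤ μ)

theorem pow_mul_hermFun_sq (j k : ℕ) (x : ℝ) : hermFun hμ k x ^ 2 * x ^ j =
    (X ^ j * hermOrth hμ k * hermOrth hμ k).eval x * hermWeight μ x := by
  rw [sq, hermFun_mul]
  simp only [eval_mul, eval_pow, eval_X]
  ring

theorem integrable_pow_hermMeasure (k j : ℕ) :
    Integrable (fun x => x ^ j) (hermMeasure hμ k) := by
  rw [hermMeasure, integrable_withDensity_ofReal ((measurable_hermFun hμ k).pow_const 2)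
    fun x => sq_nonneg _]
  simp only [smul_eq_mul, pow_mul_hermFun_sq]
  exact integrable_eval_mul_hermWeight hμ _

theorem integral_pow_hermMeasure (k j : ℕ) : ∫ x, x ^ j ∂(hermMeasure hμ k) =
    hermInt hμ (X ^ j * hermOrth hμ k * hermOrth hμ k) := by
  rw [hermMeasure, integral_withDensity_ofReal ((measurable_hermFun hμ k).pow_const 2)
    fun x => sq_nonneg _]
  simp only [smul_eq_mul, pow_mul_hermFun_sq, hermInt_apply]

theorem integral_odd_pow_hermMeasure (k m : ℕ) :
    ∫ x, x ^ (2 * m + 1) ∂(hermMeasure hμ k) = 0 := by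
  rw [integral_pow_hermMeasure, hermInt_apply]
  refine integral_eq_zero_of_odd fun x => ?_
  have hsign : ((-1 : ℝ) ^ k) ^ 2 = 1 := by rw [← pow_mul, mul_comm, (even_two_mul k).neg_one_pow]
  simp only [eval_mul, eval_pow, eval_X, eval_neg_hermOrth, hermWeight_neg,
    Odd.neg_pow (odd_two_mul_add_one m)]
  linear_combination (-(x ^ (2 * m + 1) * (hermOrth hμ k).eval x ^ 2 * hermWeight μ x)) * hsign

theorem integral_pow_meanEigenvalueDist (n j : ℕ) :
    ∫ x, x ^ j ∂(meanEigenvalueDist n μ) =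
      (n : ℝ)⁻¹ * ∑ k ∈ Finset.range n, ∫ x, x ^ j ∂(hermMeasure hμ k) := by
  rw [meanEigenvalueDist_eq hμ, integral_smul_measure,
    integral_finsetSum_measure fun (k : Fin n) _ => integrable_pow_hermMeasure hμ k j,
    Finset.sum_range fun k => ∫ x, x ^ j ∂(hermMeasure hμ k)]
  simp

end Moments

theorem integrable_pow_meanEigenvalueDist {μ : ℝ} (hμ : 0 ≤ μ) {n : ℕ} (hn : n ≠ 0) (j : ℕ) :
    Integrable (fun x => x ^ j) (meanEigenvalueDist n μ) := by
  rw [meanEigenvalueDist_eq hμ]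
  refine Integrable.smul_measure ?_ (ENNReal.inv_ne_top.2 (Nat.cast_ne_zero.2 hn))
  exact integrable_finsetSum_measure.2 fun k _ => integrable_pow_hermMeasure hμ k j

section Limit

variable {μ : ℕ → ℝ} {c : ℝ}

theorem tendsto_moments_meanEigenvalueDist (hμ : ∀ n, 0 ≤ μ n) (hc : 0 ≤ c)
    (hlim : Tendsto (fun n : ℕ => μ n / (n : ℝ)) atTop (𝓝 c)) (j : ℕ) :
    Tendsto (fun n : ℕ => ∫ u, (u / √(n : ℝ)) ^ j ∂(meanEigenvalueDist n (μ n))) atTop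
      (𝓝 (∫ u, u ^ j ∂(limitMeasure c))) := by
  simp only [div_pow, integral_div, integral_pow_meanEigenvalueDist (hμ _)]
  obtain ⟨m, rfl | rfl⟩ := Nat.even_or_odd' j
  · rw [integral_even_pow_limitMeasure hc]
    refine (tendsto_average_momentEntry hμ hlim m).congr fun n => ?_
    simp only [integral_pow_hermMeasure, momentEntry]
    rw [pow_mul (√(n : ℝ)), Real.sq_sqrt (Nat.cast_nonneg n), ← Finset.sum_div, mul_div_assoc]
  · simp [integral_odd_pow_limitMeasure, integral_odd_pow_hermMeasure]

theorem tendsto_integral_meanEigenvalueDist (hμ : ∀ n, 0 ≤ μ n) (hc : 0 ≤ c)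
    (hlim : Tendsto (fun n : ℕ => μ n / (n : ℝ)) atTop (𝓝 c)) (φ : ℝ →ᵇ ℝ) :
    Tendsto (fun n : ℕ => ∫ u, φ (u / √(n : ℝ)) ∂(meanEigenvalueDist n (μ n)))
      atTop (𝓝 (∫ u, φ u ∂(limitMeasure c))) := by
  -- For `n = 0` the mean eigenvalue distribution is not a probability measure.
  rw [← tendsto_add_atTop_iff_nat 1]
  have hprob (n : ℕ) : IsProbabilityMeasure (meanEigenvalueDist (n + 1) (μ (n + 1))) :=
    isProbabilityMeasure_meanEigenvalueDist (hμ _) (Nat.le_add_left 1 n)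
  have hmeas (n : ℕ) : Measurable fun u : ℝ => u / √((n + 1 : ℕ) : ℝ) := by fun_prop
  let ρ (n : ℕ) : Measure ℝ :=
    (meanEigenvalueDist (n + 1) (μ (n + 1))).map fun u => u / √((n + 1 : ℕ) : ℝ)
  have hρ (n : ℕ) : IsProbabilityMeasure (ρ n) :=
    Measure.isProbabilityMeasure_map (hmeas n).aemeasurable
  have hν := isProbabilityMeasure_limitMeasure hc
  have hmap (n : ℕ) {f : ℝ → ℝ} (hf : Continuous f) : ∫ x, f x ∂(ρ n) =
      ∫ u, f (u / √((n + 1 : ℕ) : ℝ)) ∂(meanEigenvalueDist (n + 1) (μ (n + 1))) :=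
    integral_map (hmeas n).aemeasurable hf.aestronglyMeasurable
  have h := tendsto_integral_of_tendsto_moments (ρ := ρ) (l := atTop)
    (ae_abs_le_limitMeasure c) (fun n k => ?_) (fun k => ?_) φ
  · simpa only [hmap _ φ.continuous] using h
  · rw [integrable_map_measure (by fun_prop) (hmeas n).aemeasurable]
    simpa only [Function.comp_def, div_pow] using
      (integrable_pow_meanEigenvalueDist (hμ _) n.succ_ne_zero k).div_const _
  · simp only [hmap _ (continuous_pow k)]
    exact (tendsto_add_atTop_iff_nat 1).2 (tendsto_moments_meanEigenvalueDist hμ hc hlim k)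

end Limit

end Convergence

end GenHermitian

end

theorem theorem2p1 (μ : ℕ → ℝ) (hμ : ∀ n, 0 ≤ μ n) (c : ℝ) (hc : 0 ≤ c)
    (hlim : Tendsto (fun n : ℕ => μ n / (n : ℝ)) atTop (𝓝 c)) :
    (∀ n, IsProbabilityMeasure (GenHermitian.ensemble n (μ n))) ∧
    (∀ n, 1 ≤ n → IsProbabilityMeasure (GenHermitian.meanEigenvalueDist n (μ n))) ∧
    IsProbabilityMeasure (GenHermitian.limitMeasure c) ∧
    GenHermitian.limitMeasure c (GenHermitian.limitSupport c)ᶜ = 0 ∧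
    (∀ φ : ℝ →ᵇ ℝ,
      Tendsto (fun n : ℕ => ∫ u, φ (u / √(n : ℝ)) ∂(GenHermitian.meanEigenvalueDist n (μ n)))
        atTop (𝓝 (∫ u, φ u ∂(GenHermitian.limitMeasure c)))) ∧
    (c = 0 → GenHermitian.limitMeasure c = GenHermitian.semicircleLaw) :=
  ⟨fun n => GenHermitian.isProbabilityMeasure_ensemble n (hμ n),
    fun n hn => GenHermitian.isProbabilityMeasure_meanEigenvalueDist (hμ n) hn,
    GenHermitian.isProbabilityMeasure_limitMeasure hc,
    GenHermitian.limitMeasure_compl_limitSupport c,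
    GenHermitian.tendsto_integral_meanEigenvalueDist hμ hc hlim,
    fun h => by rw [h, GenHermitian.limitMeasure_zero]⟩
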